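/- Let $M$ be a closed (compact, without boundary) Kähler manifold of complex dimension $n$, with Kähler metric $g$ and Kähler form $\omega$. Let $G$ be a (finite-dimensional) Lie group whose Lie algebra $\mathfrak g$ carries an $\mathrm{Ad}$-invariant inner product, let $P\to M$ be a smooth principal $G$-bundle, and let $A$ be a smooth connection on $P$ with curvature $F=F(A)\in\Omega^2(M,\mathrm{Ad}\,P)$. The metric $g$ and the inner product on $\mathfrak g$ induce the $L^2$ inner product on $\Omega^*(M,\mathrm{Ad}\,P)$, and the corresponding Hermitian $L^2$ inner product on $\Omega^*(M,\mathrm{Ad}\,P\otimes\mathbb C)$. Write $F=F_p+\Phi\,\omega$ for the Lefschetz decomposition, where $F_p$ is primitive ($\Lambda F_p=0$) and $\Phi\in\Omega^0(M,\mathrm{Ad}\,P)$. The connection $A$ is called Yang–Mills if it is a critical point of $A\mapsto\|F(A)\|^2$, and primitive Yang–Mills if it is a critical point of $A\mapsto\|F_p(A)\|^2$, that is, if $\frac{d}{dt}\big|_{t=0}$ of the functional at $A+t\eta$ vanishes for every $\eta\in\Omega^1(M,\mathrm{Ad}\,P)$. The exterior covariant derivative decomposes on $\mathrm{Ad}\,P\otimes\mathbb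 C$-valued forms as $d_A=\partial_A+\bar\partial_A$, where $\partial_A:\Omega^{p,q}\to\Omega^{p+1,q}$ and $\bar\partial_A:\Omega^{p,q}\to\Omega^{p,q+1}$. Let $\partial_A^*$, $\bar\partial_A^*$ be their formal adjoints with respect to the $L^2$ inner product. If $A$ is a Yang–Mills connection and $$\left[(\partial_A^*)^2-(\bar\partial_A^*)^2\right]F=0,$$ then $A$ is a primitive Yang–Mills connection. -/

import Mathlib

open scoped Manifold ContDiff

noncomputable section

namespace KahlerYM

/-! ### Differential forms on real manifolds -/

section Forms

variable {V : Type*} [NormedAddCommGroup V] [NormedSpace ℝ V]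
  {X : Type*} [TopologicalSpace X] [ChartedSpace V X]
  {W : Type*} [NormedAddCommGroup W] [NormedSpace ℝ W] {k : ℕ}

/-- The differential of a map between real manifolds. In Mathlib the tangent space of a manifold
at a point is the model vector space (through the preferred chart at that point). -/
def tmap {V' : Type*} [NormedAddCommGroup V'] [NormedSpace ℝ V']
    {X' : Type*} [TopologicalSpace X'] [ChartedSpace V' X'] (f : X → X') (x : X) : V →L[ℝ] V' :=
  mfderiv 𝓘(ℝ, V) 𝓘(ℝ, V') f x

/-- The differential at `y` of the inverse of the preferred chart at `x`. -/
def chartSymmDeriv (x : X) (y : V) : V →L[ℝ] V :=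
  mfderiv 𝓘(ℝ, V) 𝓘(ℝ, V) (extChartAt 𝓘(ℝ, V) x).symm y

/-- The expression of a `W`-valued `k`-form `α` on the manifold `X` in the preferred chart at `x`,
i.e. its pull-back to the chart's target in `V`. -/
def chartForm (α : X → V [⋀^Fin k]→L[ℝ] W) (x : X) (y : V) : V [⋀^Fin k]→L[ℝ] W :=
  (α ((extChartAt 𝓘(ℝ, V) x).symm y)).compContinuousLinearMap (chartSymmDeriv x y)

/-- A form is smooth if all its chart expressions are. -/
def IsSmoothForm (α : X → V [⋀^Fin k]→L[ℝ] W) : Prop :=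
  ∀ x : X, ContDiffOn ℝ ∞ (chartForm α x) (extChartAt 𝓘(ℝ, V) x).target

/-- The exterior derivative of a form on a manifold, computed at `x` in the preferred chart
at `x` (whose differential at `x` is the identity of the tangent space). -/
def extD (α : X → V [⋀^Fin k]→L[ℝ] W) (x : X) : V [⋀^Fin (k + 1)]→L[ℝ] W :=
  extDeriv (chartForm α x) (extChartAt 𝓘(ℝ, V) x x)

end Forms

/-! ### Kähler manifolds -/

/-- A complex manifold is a smooth real manifold. -/
instance realIsManifold {E : Type*} [NormedAddCommGroup E] [NormedSpace ℂ E]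
    {M : Type*} [TopologicalSpace M] [ChartedSpace E M] [IsManifold 𝓘(ℂ, E) ω M] :
    IsManifold 𝓘(ℝ, E) ∞ M := by
  refine isManifold_of_contDiffOn 𝓘(ℝ, E) ∞ M fun e e' he he' => ?_
  have h := (contDiffGroupoid ω 𝓘(ℂ, E)).compatible he he'
  rw [contDiffGroupoid, mem_groupoid_of_pregroupoid] at h
  exact (h.1.restrict_scalars ℝ).of_le le_top

/-- Multiplication by the complex number `z` on a complex vector space, as a real-linear map.
On the tangent spaces of a complex manifold, `mulC Complex.I` is the complex structure `J`. -/
def mulC {E : Type*} [NormedAddCommGroup E] [NormedSpace ℂ E] (z : ℂ) : E →L[ℝ] E :=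
  (z • ContinuousLinearMap.id ℂ E).restrictScalars ℝ

/-- A Kähler structure on a complex manifold `M`: a smooth Riemannian metric `g` whose fundamental
form `ω(v, w) = g(J v, w)` is alternating (equivalently, `g` is `J`-invariant) and closed. -/
structure KahlerStructure (E M : Type*) [NormedAddCommGroup E] [NormedSpace ℂ E]
    [TopologicalSpace M] [ChartedSpace E M] [IsManifold 𝓘(ℂ, E) ω M] where
  metric : Bundle.ContMDiffRiemannianMetric 𝓘(ℝ, E) ∞ E (fun x : M => TangentSpace 𝓘(ℝ, E) x)
  form : M → E [⋀^Fin 2]→L[ℝ] ℝ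
  form_apply : ∀ (x : M) (v w : E), form x ![v, w] = metric.inner x (mulC Complex.I v : E) w
  closed : ∀ x : M, extD form x = 0

/-! ### Riemannian volume, inner products of forms, Lefschetz contraction -/

section Metric

variable {E : Type*} [NormedAddCommGroup E] [NormedSpace ℂ E] [FiniteDimensional ℂ E]
  {M : Type*} [TopologicalSpace M] [ChartedSpace E M] [IsManifold 𝓘(ℂ, E) ω M]

/-- A fixed real basis `e` of the model space `E`, hence of all tangent spaces. -/
def realBasis (E : Type*) [NormedAddCommGroup E] [NormedSpace ℂ E] [FiniteDimensional ℂ E] :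
    Module.Basis (Fin (Module.finrank ℝ E)) ℝ E :=
  haveI : FiniteDimensional ℝ E := FiniteDimensional.complexToReal E
  Module.finBasis ℝ E

/-- The Gram matrix `g_x(e i, e j)`; its inverse is the matrix of the metric on covectors. -/
def gram (K : KahlerStructure E M) (x : M) :
    Matrix (Fin (Module.finrank ℝ E)) (Fin (Module.finrank ℝ E)) ℝ :=
  Matrix.of fun i j => K.metric.inner x (realBasis E i : E) (realBasis E j : E)

/-- The Gram matrix at the point with coordinate `y` of the coordinate frame of the preferred
chart at `x`. -/
def chartGram (K : KahlerStructure E M) (x : M) (y : E) :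
    Matrix (Fin (Module.finrank ℝ E)) (Fin (Module.finrank ℝ E)) ℝ :=
  Matrix.of fun i j => K.metric.inner ((extChartAt 𝓘(ℝ, E) x).symm y)
    (chartSymmDeriv x y (realBasis E i) : E) (chartSymmDeriv x y (realBasis E j) : E)

variable [MeasurableSpace E] [BorelSpace E] [MeasurableSpace M] [BorelSpace M]

/-- The Riemannian volume measure `√(det g) dy` on the domain of the preferred chart at `x`,
extended by zero to `M`. -/
def chartVolume (K : KahlerStructure E M) (x : M) : MeasureTheory.Measure M :=
  (((realBasis E).addHaar.restrict (extChartAt 𝓘(ℝ, E) x).target).withDensity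
    fun y => ENNReal.ofReal (Real.sqrt (chartGram K x y).det)).map (extChartAt 𝓘(ℝ, E) x).symm

/-- The Riemannian volume measure of `M`. The measures in the charts agree on overlaps, so that
their supremum is the measure which restricts to each of them. -/
def volumeMeasure (K : KahlerStructure E M) : MeasureTheory.Measure M :=
  ⨆ x : M, chartVolume K x

end Metric

/-! ### Principal bundles and connections -/

section Bundle

variable (E EP EG M P G : Type*)
  [NormedAddCommGroup E] [NormedSpace ℝ E]
  [NormedAddCommGroup EP] [NormedSpace ℝ EP]
  [NormedAddCommGroup EG] [NormedSpace ℝ EG]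
  [TopologicalSpace M] [ChartedSpace E M]
  [TopologicalSpace P] [ChartedSpace EP P]
  [TopologicalSpace G] [ChartedSpace EG G] [Group G]

/-- A smooth principal `G`-bundle `proj : P → M` with right action `act`. -/
structure PrincipalBundle where
  proj : P → M
  act : P → G → P
  act_one : ∀ p, act p 1 = p
  act_mul : ∀ p g h, act p (g * h) = act (act p g) h
  proj_act : ∀ p g, proj (act p g) = proj p
  contMDiff_proj : ContMDiff 𝓘(ℝ, EP) 𝓘(ℝ, E) ∞ proj
  contMDiff_act :
    ContMDiff (𝓘(ℝ, EP).prod 𝓘(ℝ, EG)) 𝓘(ℝ, EP) ∞ (fun q : P × G => act q.1 q.2)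
  locally_trivial : ∀ x : M, ∃ (U : Set M) (e : OpenPartialHomeomorph P (M × G)),
    IsOpen U ∧ x ∈ U ∧ e.source = proj ⁻¹' U ∧ e.target = U ×ˢ Set.univ ∧
    ContMDiffOn 𝓘(ℝ, EP) (𝓘(ℝ, E).prod 𝓘(ℝ, EG)) ∞ e e.source ∧
    ContMDiffOn (𝓘(ℝ, E).prod 𝓘(ℝ, EG)) 𝓘(ℝ, EP) ∞ e.symm e.target ∧
    ∀ p ∈ e.source, (e p).1 = proj p ∧ ∀ g : G, e (act p g) = ((e p).1, (e p).2 * g)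

variable {E EP M P G}

/-- The adjoint action of `G` on its Lie algebra `T_1 G = EG`. -/
def Ad (g : G) : EG →L[ℝ] EG := tmap (fun h : G => g * h * g⁻¹) 1

variable {EG}

theorem PrincipalBundle.surjective (Q : PrincipalBundle E EP EG M P G) :
    Function.Surjective Q.proj := by
  intro x
  obtain ⟨U, e, -, hx, hs, ht, -, -, he⟩ := Q.locally_trivial x
  have hm : ((x, 1) : M × G) ∈ e.target := by rw [ht]; exact ⟨hx, trivial⟩
  refine ⟨e.symm (x, 1), ?_⟩
  rw [← (he _ (e.map_target hm)).1, e.right_inv hm]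

/-- A point of the fibre of `P` over `x`. -/
def PrincipalBundle.pt (Q : PrincipalBundle E EP EG M P G) (x : M) : P :=
  Function.surjInv Q.surjective x

/-- A connection on a principal bundle, given by its `𝔤`-valued connection `1`-form on `P`, which
reproduces the generators of the fundamental vector fields and satisfies `R_g^* A = Ad(g⁻¹) A`. -/
structure Connection (Q : PrincipalBundle E EP EG M P G) where
  form : P → EP [⋀^Fin 1]→L[ℝ] EG
  smooth : IsSmoothForm form
  vertical : ∀ (p : P) (X : EG), form p ![tmap (fun g : G => Q.act p g) 1 X] = X
  equivariant : ∀ (p : P) (g : G) (v : EP),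
    form (Q.act p g) ![tmap (fun q : P => Q.act q g) p v] = Ad EG g⁻¹ (form p ![v])

/-- The horizontal lift `T_{proj p} M → T_p P` of the connection form `A`: the inverse of
`(d proj, A) : T_p P → T_{proj p} M × 𝔤`, restricted to the first factor. -/
def horLift (Q : PrincipalBundle E EP EG M P G) (A : P → EP [⋀^Fin 1]→L[ℝ] EG) (p : P) :
    E →L[ℝ] EP :=
  (((tmap Q.proj p : EP →L[ℝ] E).prod
    ((ContinuousAlternatingMap.ofSubsingleton ℝ EP EG (0 : Fin 1)).symm (A p))).inverse).comp
    (ContinuousLinearMap.inl ℝ E EG)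

/-- The curvature `F`, as an `Ad P`-valued `2`-form on `M`:
`F(v, w) = dA (horizontal lift of v, horizontal lift of w)`.

Here and below an `Ad P`-valued `k`-form on `M` is a family `α p` (`p : P`) of `𝔤`-valued
alternating forms on `T_{proj p} M`, with the equivariance stated in `IsAdForm`; this is the
description of the sections of a bundle associated with `P` as equivariant functions on `P`. -/
def curvature (Q : PrincipalBundle E EP EG M P G) (A : P → EP [⋀^Fin 1]→L[ℝ] EG) (p : P) :
    E [⋀^Fin 2]→L[ℝ] EG :=
  (extD A p).compContinuousLinearMap (horLift Q A p)

variable {k : ℕ}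

/-- The pull-back to `P` of an `Ad P`-valued form on `M`: a `𝔤`-valued form on `P`. -/
def toP (Q : PrincipalBundle E EP EG M P G) (α : P → E [⋀^Fin k]→L[ℝ] EG) (p : P) :
    EP [⋀^Fin k]→L[ℝ] EG :=
  (α p).compContinuousLinearMap (tmap Q.proj p)

/-- `α` is a smooth `Ad P`-valued `k`-form on `M`. -/
structure IsAdForm (Q : PrincipalBundle E EP EG M P G) (α : P → E [⋀^Fin k]→L[ℝ] EG) :
    Prop where
  equivariant : ∀ (p : P) (g : G) (v : Fin k → E), α (Q.act p g) v = Ad EG g⁻¹ (α p v)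
  smooth : IsSmoothForm (toP Q α)

/-- The exterior covariant derivative `d_A` of an `Ad P`-valued form: the exterior derivative on
`P`, evaluated on horizontal lifts. -/
def covD (Q : PrincipalBundle E EP EG M P G) (A : P → EP [⋀^Fin 1]→L[ℝ] EG)
    (α : P → E [⋀^Fin k]→L[ℝ] EG) (p : P) : E [⋀^Fin (k + 1)]→L[ℝ] EG :=
  (extD (toP Q α) p).compContinuousLinearMap (horLift Q A p)

variable (EG G) in
/-- An `Ad`-invariant inner product on the Lie algebra of `G`. -/
structure AdInvariantInner where
  inner : EG →L[ℝ] EG →L[ℝ] ℝ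
  symm : ∀ X Y, inner X Y = inner Y X
  pos : ∀ X, X ≠ 0 → 0 < inner X X
  invariant : ∀ (g : G) (X Y : EG), inner (Ad EG g X) (Ad EG g Y) = inner X Y

end Bundle

/-! ### Complexified forms and the operators `∂_A`, `∂̄_A` -/

section Operators

variable {E EP EG M P G : Type*}
  [NormedAddCommGroup E] [NormedSpace ℂ E]
  [NormedAddCommGroup EP] [NormedSpace ℝ EP]
  [NormedAddCommGroup EG] [NormedSpace ℝ EG]
  [TopologicalSpace M] [ChartedSpace E M]
  [TopologicalSpace P] [ChartedSpace EP P]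
  [TopologicalSpace G] [ChartedSpace EG G] [Group G] {k : ℕ}

variable (E EG P) in
/-- `Ad P ⊗ ℂ`-valued `k`-forms on `M`; the pair `(a, b)` stands for `a + i b`. -/
abbrev CForm (k : ℕ) : Type _ :=
  (P → E [⋀^Fin k]→L[ℝ] EG) × (P → E [⋀^Fin k]→L[ℝ] EG)

/-- Multiplication of a complex form by a complex number. -/
def csmul (z : ℂ) (α : CForm E EG P k) : CForm E EG P k :=
  (z.re • α.1 - z.im • α.2, z.re • α.2 + z.im • α.1)

/-- The form `(v₁, …, v_k) ↦ α(z v₁, …, z v_k)`. -/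
def pullC (z : ℂ) (α : CForm E EG P k) : CForm E EG P k :=
  (fun p => (α.1 p).compContinuousLinearMap (mulC z),
    fun p => (α.2 p).compContinuousLinearMap (mulC z))

/-- `α` is of type `(p, q)`: `α(z v₁, …, z v_k) = z ^ p z̄ ^ q α(v₁, …, v_k)` for all `z : ℂ`. -/
def IsOfType (p q : ℕ) (α : CForm E EG P k) : Prop :=
  ∀ z : ℂ, pullC z α = csmul (z ^ p * (starRingEnd ℂ z) ^ q) α

/-- `α` is a smooth `Ad P ⊗ ℂ`-valued form. -/
def IsAdCForm (Q : PrincipalBundle E EP EG M P G) (α : CForm E EG P k) : Prop :=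
  IsAdForm Q α.1 ∧ IsAdForm Q α.2

/-- The complex-linear extension of `d_A`. -/
def covDC (Q : PrincipalBundle E EP EG M P G) (A : P → EP [⋀^Fin 1]→L[ℝ] EG)
    (α : CForm E EG P k) : CForm E EG P (k + 1) :=
  (covD Q A α.1, covD Q A α.2)

/-- `d_A^c = C⁻¹ d_A C`, where `C = pullC I` acts on forms of type `(p, q)` as `i ^ (p - q)`. -/
def covDc (Q : PrincipalBundle E EP EG M P G) (A : P → EP [⋀^Fin 1]→L[ℝ] EG)
    (α : CForm E EG P k) : CForm E EG P (k + 1) :=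
  pullC (-Complex.I) (covDC Q A (pullC Complex.I α))

/-- `∂_A = (d_A + i d_A^c) / 2`. On forms of type `(p, q)`, `d_A^c` is `-i` times the
`(p + 1, q)`-part plus `i` times the `(p, q + 1)`-part of `d_A`, so that `∂_A` is the
`(p + 1, q)`-part of `d_A`. -/
def del (Q : PrincipalBundle E EP EG M P G) (A : P → EP [⋀^Fin 1]→L[ℝ] EG)
    (α : CForm E EG P k) : CForm E EG P (k + 1) :=
  csmul (1 / 2) (covDC Q A α + csmul Complex.I (covDc Q A α))

/-- `∂̄_A = (d_A - i d_A^c) / 2`, the `(p, q + 1)`-part of `d_A` on forms of type `(p, q)`. -/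
def delbar (Q : PrincipalBundle E EP EG M P G) (A : P → EP [⋀^Fin 1]→L[ℝ] EG)
    (α : CForm E EG P k) : CForm E EG P (k + 1) :=
  csmul (1 / 2) (covDC Q A α - csmul Complex.I (covDc Q A α))

variable [FiniteDimensional ℂ E] [IsManifold 𝓘(ℂ, E) ω M]

/-- The pointwise inner product of `𝔤`-valued `k`-forms on `T_x M`, in index notation
`(1 / k!) g^{i₁ j₁} ⋯ g^{i_k j_k} ⟨α_{i₁ … i_k}, β_{j₁ … j_k}⟩`. -/
def formInner (K : KahlerStructure E M) (B : AdInvariantInner EG G) (x : M)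
    (α β : E [⋀^Fin k]→L[ℝ] EG) : ℝ :=
  (k.factorial : ℝ)⁻¹ * ∑ I : Fin k → Fin (Module.finrank ℝ E),
    ∑ J : Fin k → Fin (Module.finrank ℝ E), (∏ l, (gram K x)⁻¹ (I l) (J l)) *
      B.inner (α fun l => realBasis E (I l)) (β fun l => realBasis E (J l))

/-- The dual Lefschetz operator `Λ` on `2`-forms, the contraction with the Kähler form:
`Λ F = (1 / 2) g^{i₁ j₁} g^{i₂ j₂} ω_{i₁ i₂} F_{j₁ j₂}`. -/
def lefschetzLambda (K : KahlerStructure E M) (x : M) (α : E [⋀^Fin 2]→L[ℝ] EG) : EG :=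
  (1 / 2 : ℝ) • ∑ I : Fin 2 → Fin (Module.finrank ℝ E),
    ∑ J : Fin 2 → Fin (Module.finrank ℝ E),
      ((∏ l, (gram K x)⁻¹ (I l) (J l)) * K.form x (fun l => realBasis E (I l))) •
        α (fun l => realBasis E (J l))

/-- The primitive component `F_p = F - Φ ω`, `Φ = Λ F / n`, of an `Ad P`-valued `2`-form
`F = F_p + Φ ω` (where `Λ F_p = 0`); here `n = dim_ℂ M` and `Λ ω = n`. -/
def primitivePart (K : KahlerStructure E M) (Q : PrincipalBundle E EP EG M P G)
    (F : P → E [⋀^Fin 2]→L[ℝ] EG) (p : P) : E [⋀^Fin 2]→L[ℝ] EG :=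
  F p - (ContinuousLinearMap.toSpanSingleton ℝ
    ((Module.finrank ℂ E : ℝ)⁻¹ • lefschetzLambda K (Q.proj p) (F p))).compContinuousAlternatingMap
      (K.form (Q.proj p))

variable [MeasurableSpace E] [BorelSpace E] [MeasurableSpace M] [BorelSpace M]

/-- The `L²` inner product of `Ad P`-valued forms. The integrand at `x` may be evaluated at any
point of the fibre over `x`, by equivariance of the forms and invariance of `B`. -/
def l2Inner (K : KahlerStructure E M) (Q : PrincipalBundle E EP EG M P G)
    (B : AdInvariantInner EG G) (α β : P → E [⋀^Fin k]→L[ℝ] EG) : ℝ :=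
  ∫ x, formInner K B x (α (Q.pt x)) (β (Q.pt x)) ∂(volumeMeasure K)

/-- The Hermitian `L²` inner product of `Ad P ⊗ ℂ`-valued forms, linear in the first variable and
conjugate-linear in the second one. -/
def l2InnerC (K : KahlerStructure E M) (Q : PrincipalBundle E EP EG M P G)
    (B : AdInvariantInner EG G) (α β : CForm E EG P k) : ℂ :=
  ⟨l2Inner K Q B α.1 β.1 + l2Inner K Q B α.2 β.2, l2Inner K Q B α.2 β.1 - l2Inner K Q B α.1 β.2⟩

open Classical in
/-- The formal adjoint `D^*` of an operator `D` on smooth `Ad P ⊗ ℂ`-valued forms: `D^* α` is the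
smooth form with `⟨D β, α⟩ = ⟨β, D^* α⟩` for all smooth `β` (and `0` should there be none). -/
def formalAdjoint (K : KahlerStructure E M) (Q : PrincipalBundle E EP EG M P G)
    (B : AdInvariantInner EG G) (D : CForm E EG P k → CForm E EG P (k + 1))
    (α : CForm E EG P (k + 1)) : CForm E EG P k :=
  if h : ∃ γ : CForm E EG P k, IsAdCForm Q γ ∧
      ∀ β : CForm E EG P k, IsAdCForm Q β → l2InnerC K Q B (D β) α = l2InnerC K Q B β γ
  then Classical.choose h else 0

/-- `∂_A^*`. -/
def delStar (K : KahlerStructure E M) (Q : PrincipalBundle E EP EG M P G)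
    (B : AdInvariantInner EG G) (A : P → EP [⋀^Fin 1]→L[ℝ] EG)
    (α : CForm E EG P (k + 1)) : CForm E EG P k :=
  formalAdjoint K Q B (del Q A) α

/-- `∂̄_A^*`. -/
def delbarStar (K : KahlerStructure E M) (Q : PrincipalBundle E EP EG M P G)
    (B : AdInvariantInner EG G) (A : P → EP [⋀^Fin 1]→L[ℝ] EG)
    (α : CForm E EG P (k + 1)) : CForm E EG P k :=
  formalAdjoint K Q B (delbar Q A) α

/-- The Yang–Mills functional `‖F(A)‖²`. -/
def yangMills (K : KahlerStructure E M) (Q : PrincipalBundle E EP EG M P G)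
    (B : AdInvariantInner EG G) (A : P → EP [⋀^Fin 1]→L[ℝ] EG) : ℝ :=
  l2Inner K Q B (curvature Q A) (curvature Q A)

/-- The primitive Yang–Mills functional `‖F_p(A)‖²`. -/
def primitiveYangMills (K : KahlerStructure E M) (Q : PrincipalBundle E EP EG M P G)
    (B : AdInvariantInner EG G) (A : P → EP [⋀^Fin 1]→L[ℝ] EG) : ℝ :=
  l2Inner K Q B (primitivePart K Q (curvature Q A)) (primitivePart K Q (curvature Q A))

/-- `A` is a critical point of the functional `S` on connections: the first variation
`d/dt S(A + t η)` at `t = 0` vanishes for every `η ∈ Ω¹(M, Ad P)`. -/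
def IsCriticalPoint (Q : PrincipalBundle E EP EG M P G)
    (S : (P → EP [⋀^Fin 1]→L[ℝ] EG) → ℝ) (A : Connection Q) : Prop :=
  ∀ η : P → E [⋀^Fin 1]→L[ℝ] EG, IsAdForm Q η →
    HasDerivAt (fun t : ℝ => S (A.form + t • toP Q η)) 0 0

/-- Yang–Mills connections. -/
def IsYangMills (K : KahlerStructure E M) (Q : PrincipalBundle E EP EG M P G)
    (B : AdInvariantInner EG G) (A : Connection Q) : Prop :=
  IsCriticalPoint Q (yangMills K Q B) A

/-- Primitive Yang–Mills connections. -/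
def IsPrimitiveYangMills (K : KahlerStructure E M) (Q : PrincipalBundle E EP EG M P G)
    (B : AdInvariantInner EG G) (A : Connection Q) : Prop :=
  IsCriticalPoint Q (primitiveYangMills K Q B) A

end Operators

end KahlerYM

end

/-!
The type decomposition is pointwise. Every point `p` of the bundle has a local section which is
horizontal at `p` (`Connection.exists_horizontal`), and in the gauge it defines the covariant
derivative at the base point is the ordinary exterior derivative
(`LocalSection.Horizontal.extDeriv_loc`). Since the charts are holomorphic, the types of `∂_A α` and
`∂̄_A α` can then be read off from the coordinate formula for `d`. The same gauge gives the Bianchi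
identity `d_A F = 0` (`Connection.covD_curvature`).

The analytic content is a Kähler identity in weak form. Because `ω` is closed, the bivector inverse
to `ω`, times the volume density, is divergence free (`sum_fderiv_sqrt_det_mul_bivec`). Hence
`∫ Λ dθ = 0` for every smooth one-form `θ` (`integral_contrD`). For an `Ad P`-valued function `f` and
one-form `η`, the choice `θ = ⟨f, η⟩` gives `⟨d_A f, η ∘ J⟩ = -⟨f, Λ d_A η⟩`
(`Connection.l2Inner_covD_pullR`). For a one-form `γ` and a two-form `F` with `d_A F = 0`, the choice
`θ = ⟨γ, Λ F⟩` minus the contraction of `γ` with `F` along the bivector gives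
`⟨d_A γ, F ∘ J⟩ = ⟨Λ d_A γ, Λ F⟩` (`Connection.l2Inner_lamForm_covD`): the terms that differentiate
`F` or `ω` cancel because both are closed (`kahler_index_identity`). Together these identities say
that `(d_A^c)^* F = d_A Λ F`.

Let `A` be Yang–Mills, so that `d_A^* F = 0`. Then `∂_A^* F = -(i / 2) d_A Λ F` and
`∂̄_A^* F = (i / 2) d_A Λ F`. The imaginary part of the pairing of `Λ F` with
`[(∂_A^*)² - (∂̄_A^*)²] F` is, up to sign, half the squared norm of `d_A Λ F`, so the hypothesis forces
this norm to vanish (`IsYangMills.l2Inner_covD_lamForm`).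

Finally `‖F_p‖² = ‖F‖² - n⁻¹ ‖Λ F‖²` (`l2Inner_primitivePart`). In the direction `η` the first term
on the right has derivative zero, and the derivative of the second is a multiple of
`⟨Λ d_A η, Λ F⟩ = -⟨d_A Λ F, η ∘ J⟩ = 0`, which proves that `A` is primitive Yang–Mills
(`IsYangMills.isPrimitiveYangMills`).
-/

open scoped Manifold ContDiff

noncomputable section

namespace KahlerYM

set_option linter.unusedSectionVars false

/-! ### Smooth families of alternating forms on a vector space -/

section FlatForms

open Filter Topology

variable {Y : Type*} [NormedAddCommGroup Y] [NormedSpace ℝ Y]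
  {V : Type*} [NormedAddCommGroup V] [NormedSpace ℝ V] [FiniteDimensional ℝ V]
  {V' : Type*} [NormedAddCommGroup V'] [NormedSpace ℝ V'] [FiniteDimensional ℝ V']
  {W : Type*} [NormedAddCommGroup W] [NormedSpace ℝ W] [FiniteDimensional ℝ W] {k : ℕ}
  {n : WithTop ℕ∞}

theorem form_apply_eq_sum {ι : Type*} [Fintype ι] (b : Module.Basis ι ℝ V)
    (α : V [⋀^Fin k]→L[ℝ] W) (v : Fin k → V) :
    α v = ∑ I : Fin k → ι, (∏ l, b.repr (v l) (I l)) • α (fun l => b (I l)) := by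
  classical
  conv_lhs => rw [show v = fun l => ∑ i, b.repr (v l) i • b i from funext fun l =>
    (b.sum_repr (v l)).symm]
  have := α.toMultilinearMap.map_sum (fun l (i : ι) => b.repr (v l) i • b i)
  refine this.trans (Finset.sum_congr rfl fun I _ => ?_)
  exact α.toMultilinearMap.map_smul_univ (fun l => b.repr (v l) (I l)) (fun l => b (I l))

theorem finiteDimensional_form : FiniteDimensional ℝ (V [⋀^Fin k]→L[ℝ] W) := by
  let L : (V [⋀^Fin k]→L[ℝ] W) →ₗ[ℝ] MultilinearMap ℝ (fun _ : Fin k => V) W :=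
    { toFun := fun α => α.toMultilinearMap, map_add' := fun _ _ => rfl, map_smul' := fun _ _ => rfl }
  refine FiniteDimensional.of_injective L fun a b h => ?_
  ext v
  exact congrArg (fun m : MultilinearMap ℝ (fun _ : Fin k => V) W => m v) h

/-- A family of forms is smooth as soon as all its evaluations are. -/
theorem contDiffAt_form {f : Y → V [⋀^Fin k]→L[ℝ] W} {y : Y}
    (h : ∀ v, ContDiffAt ℝ n (fun z => f z v) y) : ContDiffAt ℝ n f y := by
  have : FiniteDimensional ℝ (V [⋀^Fin k]→L[ℝ] W) := finiteDimensional_form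
  let b := Module.finBasis ℝ V
  let L : (V [⋀^Fin k]→L[ℝ] W) →ₗ[ℝ] ((Fin k → Fin (Module.finrank ℝ V)) → W) :=
    { toFun := fun α I => α (fun l => b (I l)), map_add' := fun _ _ => rfl,
      map_smul' := fun _ _ => rfl }
  have hL : LinearMap.ker L = ⊥ := by
    rw [LinearMap.ker_eq_bot']
    intro α hα
    ext v
    rw [form_apply_eq_sum b α v]
    have : ∀ I : Fin k → Fin (Module.finrank ℝ V), α (fun l => b (I l)) = 0 :=
      fun I => congrFun hα I
    simp [this]
  obtain ⟨R, hR⟩ := L.exists_leftInverse_of_injective hL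
  have h1 : ContDiffAt ℝ n (fun z => L (f z)) y := contDiffAt_pi.2 fun I => h _
  have h2 : ContDiffAt ℝ n (fun z => R.toContinuousLinearMap (L (f z))) y :=
    R.toContinuousLinearMap.contDiff.contDiffAt.comp y h1
  refine h2.congr_of_eventuallyEq (Eventually.of_forall fun z => ?_)
  exact (LinearMap.congr_fun hR (f z)).symm

theorem contDiffAt_form_apply {f : Y → V [⋀^Fin k]→L[ℝ] W} {v : Y → Fin k → V} {y : Y}
    (hf : ContDiffAt ℝ n f y) (hv : ∀ l, ContDiffAt ℝ n (fun z => v z l) y) :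
    ContDiffAt ℝ n (fun z => f z (v z)) y := by
  let b := Module.finBasis ℝ V
  have : (fun z => f z (v z)) = fun z => ∑ I : Fin k → Fin (Module.finrank ℝ V),
      (∏ l, b.repr (v z l) (I l)) • f z (fun l => b (I l)) :=
    funext fun z => form_apply_eq_sum b (f z) (v z)
  rw [this]
  refine ContDiffAt.sum fun I _ => ContDiffAt.smul (contDiffAt_prod fun l _ => ?_) ?_
  · exact (LinearMap.toContinuousLinearMap (b.coord (I l))).contDiff.contDiffAt.comp y (hv l)
  · exact (ContinuousAlternatingMap.apply ℝ V W (fun l => b (I l))).contDiff.contDiffAt.comp y hf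

theorem contDiffAt_form_comp {f : Y → V [⋀^Fin k]→L[ℝ] W} {g : Y → V' →L[ℝ] V} {y : Y}
    (hf : ContDiffAt ℝ n f y) (hg : ContDiffAt ℝ n g y) :
    ContDiffAt ℝ n (fun z => (f z).compContinuousLinearMap (g z)) y :=
  contDiffAt_form fun v => contDiffAt_form_apply (v := fun z l => g z (v l)) hf
    fun _ => hg.clm_apply contDiffAt_const

theorem contDiffAt_extDeriv {f : V → V [⋀^Fin k]→L[ℝ] W} {y : V} (hf : ContDiffAt ℝ ∞ f y) :
    ContDiffAt ℝ ∞ (extDeriv f) y :=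
  ContDiffAt.comp (g := ContinuousAlternatingMap.alternatizeUncurryFinCLM ℝ V W) y
    (ContinuousLinearMap.contDiff _).contDiffAt (hf.fderiv_right (m := ∞) le_rfl)

theorem extDeriv_zero_apply {f : V → V [⋀^Fin 0]→L[ℝ] W} {y : V} (hf : DifferentiableAt ℝ f y)
    (v : Fin 1 → V) : extDeriv f y v = fderiv ℝ (fun z => f z 0) y (v 0) := by
  rw [extDeriv_apply hf]
  have h : ∀ z, f z (Fin.removeNth 0 v) = f z 0 := fun z => congrArg (f z) (Subsingleton.elim _ _)
  rw [Fin.sum_univ_one]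
  simp_rw [h]
  simp

theorem extDeriv_one_apply {f : V → V [⋀^Fin 1]→L[ℝ] W} {y : V} (hf : DifferentiableAt ℝ f y)
    (u v : V) : extDeriv f y ![u, v] =
      fderiv ℝ (fun z => f z ![v]) y u - fderiv ℝ (fun z => f z ![u]) y v := by
  rw [extDeriv_apply hf]
  have h0 : Fin.removeNth 0 ![u, v] = ![v] := by ext i; fin_cases i; rfl
  have h1 : Fin.removeNth 1 ![u, v] = ![u] := by ext i; fin_cases i; rfl
  simp [Fin.sum_univ_two, h0, h1, sub_eq_add_neg]

theorem extDeriv_two_apply {f : V → V [⋀^Fin 2]→L[ℝ] W} {y : V} (hf : DifferentiableAt ℝ f y)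
    (u v w : V) : extDeriv f y ![u, v, w] =
      fderiv ℝ (fun z => f z ![v, w]) y u - fderiv ℝ (fun z => f z ![u, w]) y v
        + fderiv ℝ (fun z => f z ![u, v]) y w := by
  rw [extDeriv_apply hf]
  have h0 : Fin.removeNth 0 ![u, v, w] = ![v, w] := by ext i; fin_cases i <;> rfl
  have h1 : Fin.removeNth 1 ![u, v, w] = ![u, w] := by ext i; fin_cases i <;> rfl
  have h2 : Fin.removeNth 2 ![u, v, w] = ![u, v] := by ext i; fin_cases i <;> rfl
  simp [Fin.sum_univ_three, h0, h1, h2, sub_eq_add_neg]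

end FlatForms

/-! ### Pull-back of forms on manifolds -/

section PullBack

open Filter Topology

variable {V : Type*} [NormedAddCommGroup V] [NormedSpace ℝ V] [FiniteDimensional ℝ V]
  {X : Type*} [TopologicalSpace X] [ChartedSpace V X] [IsManifold 𝓘(ℝ, V) ∞ X]
  {V' : Type*} [NormedAddCommGroup V'] [NormedSpace ℝ V'] [FiniteDimensional ℝ V']
  {X' : Type*} [TopologicalSpace X'] [ChartedSpace V' X'] [IsManifold 𝓘(ℝ, V') ∞ X']
  {V'' : Type*} [NormedAddCommGroup V''] [NormedSpace ℝ V''] [FiniteDimensional ℝ V'']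
  {X'' : Type*} [TopologicalSpace X''] [ChartedSpace V'' X''] [IsManifold 𝓘(ℝ, V'') ∞ X'']
  {W : Type*} [NormedAddCommGroup W] [NormedSpace ℝ W] [FiniteDimensional ℝ W] {k : ℕ}

/-- The pull-back `f^* α` of a form along a map of manifolds. -/
def pullForm (f : X → X') (α : X' → V' [⋀^Fin k]→L[ℝ] W) (x : X) : V [⋀^Fin k]→L[ℝ] W :=
  (α (f x)).compContinuousLinearMap (tmap f x)

/-- `f` is smooth on a neighbourhood of `x`. -/
def SmoothNear (V V' : Type*) [NormedAddCommGroup V] [NormedSpace ℝ V]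
    [NormedAddCommGroup V'] [NormedSpace ℝ V'] {X X' : Type*} [TopologicalSpace X]
    [ChartedSpace V X] [TopologicalSpace X'] [ChartedSpace V' X'] (f : X → X') (x : X) : Prop :=
  ∀ᶠ z in 𝓝 x, ContMDiffAt 𝓘(ℝ, V) 𝓘(ℝ, V') ∞ f z

/-- The form `α` is smooth near the point `x`, in the preferred chart at `x`. -/
def SmoothFormAt (α : X → V [⋀^Fin k]→L[ℝ] W) (x : X) : Prop :=
  ContDiffAt ℝ ∞ (chartForm α x) (extChartAt 𝓘(ℝ, V) x x)

theorem SmoothNear.contMDiffAt {f : X → X'} {x : X} (h : SmoothNear V V' f x) :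
    ContMDiffAt 𝓘(ℝ, V) 𝓘(ℝ, V') ∞ f x := h.self_of_nhds

theorem SmoothNear.mdifferentiableAt {f : X → X'} {x : X} (h : SmoothNear V V' f x) :
    MDifferentiableAt 𝓘(ℝ, V) 𝓘(ℝ, V') f x := h.contMDiffAt.mdifferentiableAt (by simp)

theorem SmoothNear.eventually {f : X → X'} {x : X} (h : SmoothNear V V' f x) :
    ∀ᶠ z in 𝓝 x, SmoothNear V V' f z := eventually_eventually_nhds.2 h

theorem SmoothNear.comp {g : X' → X''} {f : X → X'} {x : X} (hg : SmoothNear V' V'' g (f x))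
    (hf : SmoothNear V V' f x) : SmoothNear V V'' (g ∘ f) x := by
  filter_upwards [hf, hf.contMDiffAt.continuousAt.eventually hg] with z h1 h2
  exact h2.comp z h1

theorem ContMDiff.smoothNear {f : X → X'} (hf : ContMDiff 𝓘(ℝ, V) 𝓘(ℝ, V') ∞ f) (x : X) :
    SmoothNear V V' f x := Eventually.of_forall fun z => hf z

theorem smoothNear_of_contMDiffOn {f : X → X'} {s : Set X}
    (hf : ContMDiffOn 𝓘(ℝ, V) 𝓘(ℝ, V') ∞ f s) (hs : IsOpen s) {x : X} (hx : x ∈ s) :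
    SmoothNear V V' f x := by
  filter_upwards [hs.mem_nhds hx] with z hz
  exact hf.contMDiffAt (hs.mem_nhds hz)

theorem SmoothNear.contDiffAt {f : V → V'} {y : V} (h : SmoothNear V V' f y) : ContDiffAt ℝ ∞ f y :=
  h.contMDiffAt.contDiffAt

theorem tmap_comp {g : X' → X''} {f : X → X'} {x : X}
    (hg : MDifferentiableAt 𝓘(ℝ, V') 𝓘(ℝ, V'') g (f x))
    (hf : MDifferentiableAt 𝓘(ℝ, V) 𝓘(ℝ, V') f x) :
    (tmap (g ∘ f) x : V →L[ℝ] V'') = (tmap g (f x) : V' →L[ℝ] V'').comp (tmap f x) :=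
  mfderiv_comp x hg hf

theorem tmap_congr {f g : X → X'} {x : X} (h : f =ᶠ[𝓝 x] g) :
    (tmap f x : V →L[ℝ] V') = tmap g x :=
  h.mfderiv_eq

theorem tmap_eq_id {f : X → X} {x : X} (h : f =ᶠ[𝓝 x] id) :
    (tmap f x : V →L[ℝ] V) = ContinuousLinearMap.id ℝ V :=
  (tmap_congr h).trans mfderiv_id

theorem tmap_const {x : X} (z : X') : (tmap (fun _ : X => z) x : V →L[ℝ] V') = 0 :=
  mfderiv_const

theorem tmap_eq_fderiv (f : V → V') (y : V) : (tmap f y : V →L[ℝ] V') = fderiv ℝ f y :=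
  mfderiv_eq_fderiv

theorem pullForm_comp {g : X' → X''} {f : X → X'} {x : X}
    (hg : MDifferentiableAt 𝓘(ℝ, V') 𝓘(ℝ, V'') g (f x))
    (hf : MDifferentiableAt 𝓘(ℝ, V) 𝓘(ℝ, V') f x) (α : X'' → V'' [⋀^Fin k]→L[ℝ] W) :
    (pullForm (g ∘ f) α x : V [⋀^Fin k]→L[ℝ] W) =
      pullForm f (pullForm g α : X' → V' [⋀^Fin k]→L[ℝ] W) x := by
  ext v
  simp only [pullForm, tmap_comp hg hf]
  rfl

theorem pullForm_congr {f g : X → X'} {x : X} (h : f =ᶠ[𝓝 x] g)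
    (α : X' → V' [⋀^Fin k]→L[ℝ] W) : (pullForm f α x : V [⋀^Fin k]→L[ℝ] W) = pullForm g α x := by
  simp only [pullForm, tmap_congr h, h.self_of_nhds]

theorem pullForm_congr_form {f : X → X'} {x : X} {α β : X' → V' [⋀^Fin k]→L[ℝ] W}
    (hf : ContinuousAt f x) (h : α =ᶠ[𝓝 (f x)] β) :
    (pullForm f α : X → V [⋀^Fin k]→L[ℝ] W) =ᶠ[𝓝 x] pullForm f β := by
  filter_upwards [hf.eventually h] with z hz
  simp only [pullForm, hz]

/-! ### The preferred charts -/

theorem chartForm_eq_pullForm (α : X → V [⋀^Fin k]→L[ℝ] W) (x : X) :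
    chartForm α x = pullForm (extChartAt 𝓘(ℝ, V) x).symm α := rfl

theorem smoothNear_extChartAt {x z : X} (hz : z ∈ (extChartAt 𝓘(ℝ, V) x).source) :
    SmoothNear V V (extChartAt 𝓘(ℝ, V) x) z := by
  rw [extChartAt_source] at hz
  exact smoothNear_of_contMDiffOn contMDiffOn_extChartAt (chartAt V x).open_source hz

theorem smoothNear_extChartAt_symm {x : X} {y : V} (hy : y ∈ (extChartAt 𝓘(ℝ, V) x).target) :
    SmoothNear V V (extChartAt 𝓘(ℝ, V) x).symm y :=
  smoothNear_of_contMDiffOn (contMDiffOn_extChartAt_symm x) (isOpen_extChartAt_target x) hy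

theorem extChartAt_symm_comp_self {x z : X} (hz : z ∈ (extChartAt 𝓘(ℝ, V) x).source) :
    (extChartAt 𝓘(ℝ, V) x).symm ∘ extChartAt 𝓘(ℝ, V) x =ᶠ[𝓝 z] id := by
  filter_upwards [extChartAt_source_mem_nhds' (I := 𝓘(ℝ, V)) hz] with w hw
  exact (extChartAt 𝓘(ℝ, V) x).left_inv hw

theorem extChartAt_comp_symm_self {x : X} {y : V} (hy : y ∈ (extChartAt 𝓘(ℝ, V) x).target) :
    extChartAt 𝓘(ℝ, V) x ∘ (extChartAt 𝓘(ℝ, V) x).symm =ᶠ[𝓝 y] id := by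
  filter_upwards [(isOpen_extChartAt_target x).mem_nhds hy] with w hw
  exact (extChartAt 𝓘(ℝ, V) x).right_inv hw

theorem chartSymmDeriv_self (x : X) :
    chartSymmDeriv x (extChartAt 𝓘(ℝ, V) x x) = ContinuousLinearMap.id ℝ V := by
  have hs := mem_extChartAt_target (I := 𝓘(ℝ, V)) x
  have hd := (smoothNear_extChartAt_symm hs).mdifferentiableAt
  have h := hd.mfderiv
  rw [chartSymmDeriv, h]
  simp only [writtenInExtChartAt, extChartAt_model_space_eq_id, PartialEquiv.refl_coe,
    PartialEquiv.refl_symm, Function.comp_id, modelWithCornersSelf_coe, Set.range_id,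
    fderivWithin_univ, id_eq, extChartAt_to_inv]
  rw [(extChartAt_comp_symm_self hs).fderiv_eq, fderiv_id]

theorem tmap_extChartAt_self (x : X) :
    (tmap (extChartAt 𝓘(ℝ, V) x) x : V →L[ℝ] V) = ContinuousLinearMap.id ℝ V := by
  have hs := mem_extChartAt_target (I := 𝓘(ℝ, V)) x
  have hx := mem_extChartAt_source (I := 𝓘(ℝ, V)) x
  have h1 := tmap_comp (x := extChartAt 𝓘(ℝ, V) x x) (f := (extChartAt 𝓘(ℝ, V) x).symm)
    (g := extChartAt 𝓘(ℝ, V) x) (by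
      rw [extChartAt_to_inv]; exact (smoothNear_extChartAt hx).mdifferentiableAt)
    (smoothNear_extChartAt_symm hs).mdifferentiableAt
  rw [tmap_eq_id (extChartAt_comp_symm_self hs)] at h1
  have h2 : (tmap (extChartAt 𝓘(ℝ, V) x).symm (extChartAt 𝓘(ℝ, V) x x) : V →L[ℝ] V) =
    ContinuousLinearMap.id ℝ V := chartSymmDeriv_self x
  rw [h2, extChartAt_to_inv] at h1
  exact h1.symm

/-- On a vector space, the chart expression of a form is the form itself. -/
theorem chartForm_flat (α : V → V [⋀^Fin k]→L[ℝ] W) (y : V) : chartForm α y = α := by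
  ext z v
  have : (chartSymmDeriv y z : V →L[ℝ] V) = ContinuousLinearMap.id ℝ V := by
    have h : ((extChartAt 𝓘(ℝ, V) y).symm : V → V) = id := by
      rw [extChartAt_model_space_eq_id]; rfl
    rw [chartSymmDeriv, h]
    exact mfderiv_id
  rw [chartForm, this]
  simp only [extChartAt_model_space_eq_id]
  rfl

theorem smoothFormAt_flat {α : V → V [⋀^Fin k]→L[ℝ] W} {y : V} :
    SmoothFormAt α y ↔ ContDiffAt ℝ ∞ α y := by
  rw [SmoothFormAt, chartForm_flat, extChartAt_model_space_eq_id]; rfl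

theorem eventually_eq_pullForm_chartForm (α : X → V [⋀^Fin k]→L[ℝ] W) (x : X) :
    α =ᶠ[𝓝 x] (pullForm (extChartAt 𝓘(ℝ, V) x) (chartForm α x)) := by
  filter_upwards [extChartAt_source_mem_nhds (I := 𝓘(ℝ, V)) x] with z hz
  rw [chartForm_eq_pullForm, ← pullForm_comp, pullForm_congr (extChartAt_symm_comp_self hz)]
  · ext v
    simp only [pullForm, tmap_eq_id (EventuallyEq.refl _ (id : X → X))]
    rfl
  · exact (smoothNear_extChartAt_symm ((extChartAt 𝓘(ℝ, V) x).map_source hz)).mdifferentiableAt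
  · exact (smoothNear_extChartAt hz).mdifferentiableAt

/-- Local expression of the pull-back to a vector space in terms of the chart at the image. -/
theorem pullForm_eventuallyEq_chart {f : V → X'} {y : V} (hf : SmoothNear V V' f y)
    (α : X' → V' [⋀^Fin k]→L[ℝ] W) :
    (pullForm f α : V → V [⋀^Fin k]→L[ℝ] W) =ᶠ[𝓝 y]
      fun z => (chartForm α (f y) (extChartAt 𝓘(ℝ, V') (f y) (f z))).compContinuousLinearMap
        (fderiv ℝ (extChartAt 𝓘(ℝ, V') (f y) ∘ f) z) := by
  have h1 := eventually_eventually_nhds.2 (eventually_eq_pullForm_chartForm α (f y))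
  have hs := extChartAt_source_mem_nhds (I := 𝓘(ℝ, V')) (f y)
  filter_upwards [hf, hf.contMDiffAt.continuousAt.eventually h1,
    hf.contMDiffAt.continuousAt.eventually hs] with z hz h2 h3
  have h4 := (pullForm_congr_form (V := V) hz.continuousAt h2).self_of_nhds
  rw [h4, ← pullForm_comp (smoothNear_extChartAt h3).mdifferentiableAt
    (hz.mdifferentiableAt (by simp))]
  simp only [pullForm, tmap_eq_fderiv]
  rfl

theorem SmoothFormAt.pull_flat {f : V → X'} {y : V} (hf : SmoothNear V V' f y)
    {α : X' → V' [⋀^Fin k]→L[ℝ] W} (hα : SmoothFormAt α (f y)) :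
    ContDiffAt ℝ ∞ (pullForm f α : V → V [⋀^Fin k]→L[ℝ] W) y := by
  refine ContDiffAt.congr_of_eventuallyEq ?_ (pullForm_eventuallyEq_chart hf α)
  have hs := (SmoothNear.comp (smoothNear_extChartAt (mem_extChartAt_source (I := 𝓘(ℝ, V')) (f y)))
    hf).contDiffAt
  exact contDiffAt_form_comp (ContDiffAt.comp (g := chartForm α (f y)) y hα hs)
    (hs.fderiv_right (m := ∞) le_rfl)

theorem extDeriv_pullForm {f : V → X'} {y : V} (hf : SmoothNear V V' f y)
    {α : X' → V' [⋀^Fin k]→L[ℝ] W} (hα : SmoothFormAt α (f y)) :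
    extDeriv (pullForm f α : V → V [⋀^Fin k]→L[ℝ] W) y =
      (extD α (f y)).compContinuousLinearMap (tmap f y) := by
  rw [(pullForm_eventuallyEq_chart hf α).extDeriv_eq]
  have hs := (SmoothNear.comp (smoothNear_extChartAt (mem_extChartAt_source (I := 𝓘(ℝ, V')) (f y)))
    hf)
  have hd : DifferentiableAt ℝ (chartForm α (f y)) ((extChartAt 𝓘(ℝ, V') (f y) ∘ f) y) :=
    ContDiffAt.differentiableAt hα (by simp)
  have h := extDeriv_pullback hd hs.contDiffAt (by
    simpa using (WithTop.coe_le_coe.2 le_top : ((2 : ℕ∞) : WithTop ℕ∞) ≤ ∞))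
  refine h.trans ?_
  rw [← tmap_eq_fderiv, tmap_comp
    (smoothNear_extChartAt (mem_extChartAt_source (I := 𝓘(ℝ, V')) (f y))).mdifferentiableAt
    hf.mdifferentiableAt, tmap_extChartAt_self]
  rfl

theorem chartForm_pullForm {f : X → X'} {x : X} (hf : SmoothNear V V' f x)
    (α : X' → V' [⋀^Fin k]→L[ℝ] W) :
    (chartForm (pullForm f α) x : V → V [⋀^Fin k]→L[ℝ] W) =ᶠ[𝓝 (extChartAt 𝓘(ℝ, V) x x)]
      pullForm (f ∘ (extChartAt 𝓘(ℝ, V) x).symm) α := by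
  have hs := mem_extChartAt_target (I := 𝓘(ℝ, V)) x
  have hc := smoothNear_extChartAt_symm hs
  have h1 : ContinuousAt (extChartAt 𝓘(ℝ, V) x).symm (extChartAt 𝓘(ℝ, V) x x) :=
    hc.contMDiffAt.continuousAt
  have h2 : ∀ᶠ z in 𝓝 ((extChartAt 𝓘(ℝ, V) x).symm (extChartAt 𝓘(ℝ, V) x x)),
    ContMDiffAt 𝓘(ℝ, V) 𝓘(ℝ, V') ∞ f z := by rw [extChartAt_to_inv]; exact hf
  filter_upwards [hc, h1.eventually h2] with z h3 h4
  rw [chartForm_eq_pullForm, ← pullForm_comp (h4.mdifferentiableAt (by simp))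
    (h3.mdifferentiableAt (by simp))]

theorem SmoothNear.comp_extChartAt_symm {f : X → X'} {x : X} (hf : SmoothNear V V' f x) :
    SmoothNear V V' (f ∘ (extChartAt 𝓘(ℝ, V) x).symm) (extChartAt 𝓘(ℝ, V) x x) := by
  refine SmoothNear.comp ?_ (smoothNear_extChartAt_symm (mem_extChartAt_target x))
  rw [extChartAt_to_inv]; exact hf

theorem SmoothFormAt.pull {f : X → X'} {x : X} (hf : SmoothNear V V' f x)
    {α : X' → V' [⋀^Fin k]→L[ℝ] W} (hα : SmoothFormAt α (f x)) :
    SmoothFormAt (pullForm f α : X → V [⋀^Fin k]→L[ℝ] W) x := by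
  refine ContDiffAt.congr_of_eventuallyEq ?_ (chartForm_pullForm hf α)
  refine SmoothFormAt.pull_flat hf.comp_extChartAt_symm ?_
  simpa only [Function.comp, extChartAt_to_inv] using hα

/-- The exterior derivative commutes with pull-back. -/
theorem extD_pullForm {f : X → X'} {x : X} (hf : SmoothNear V V' f x)
    {α : X' → V' [⋀^Fin k]→L[ℝ] W} (hα : SmoothFormAt α (f x)) :
    extD (pullForm f α : X → V [⋀^Fin k]→L[ℝ] W) x =
      (extD α (f x)).compContinuousLinearMap (tmap f x) := by
  rw [extD, (chartForm_pullForm hf α).extDeriv_eq, extDeriv_pullForm hf.comp_extChartAt_symm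
    (by simpa only [Function.comp, extChartAt_to_inv] using hα)]
  have h : (tmap (f ∘ (extChartAt 𝓘(ℝ, V) x).symm) (extChartAt 𝓘(ℝ, V) x x) : V →L[ℝ] V') =
      tmap f x := by
    rw [tmap_comp (by rw [extChartAt_to_inv]; exact hf.mdifferentiableAt)
      (smoothNear_extChartAt_symm (mem_extChartAt_target x)).mdifferentiableAt]
    have h2 : (tmap (extChartAt 𝓘(ℝ, V) x).symm (extChartAt 𝓘(ℝ, V) x x) : V →L[ℝ] V) =
      ContinuousLinearMap.id ℝ V := chartSymmDeriv_self x
    rw [h2, extChartAt_to_inv]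
    rfl
  rw [h]
  simp only [Function.comp, extChartAt_to_inv]

theorem isSmoothForm_iff {α : X → V [⋀^Fin k]→L[ℝ] W} :
    IsSmoothForm α ↔ ∀ x, SmoothFormAt α x := by
  refine ⟨fun h x => (h x).contDiffAt
    ((isOpen_extChartAt_target x).mem_nhds (mem_extChartAt_target x)), fun h x y hy => ?_⟩
  exact (SmoothFormAt.pull_flat (smoothNear_extChartAt_symm hy) (h _)).contDiffWithinAt

theorem chartForm_congr {α β : X → V [⋀^Fin k]→L[ℝ] W} {x : X} (h : α =ᶠ[𝓝 x] β) :
    chartForm α x =ᶠ[𝓝 (extChartAt 𝓘(ℝ, V) x x)] chartForm β x := by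
  refine pullForm_congr_form (smoothNear_extChartAt_symm
    (mem_extChartAt_target x)).contMDiffAt.continuousAt ?_
  rwa [extChartAt_to_inv]

theorem SmoothFormAt.congr {α β : X → V [⋀^Fin k]→L[ℝ] W} {x : X} (hα : SmoothFormAt α x)
    (h : β =ᶠ[𝓝 x] α) : SmoothFormAt β x :=
  ContDiffAt.congr_of_eventuallyEq hα (chartForm_congr h)

theorem extD_congr {α β : X → V [⋀^Fin k]→L[ℝ] W} {x : X} (h : α =ᶠ[𝓝 x] β) :
    extD α x = extD β x :=
  (chartForm_congr h).extDeriv_eq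

/-- The chart expression of `dα` is the exterior derivative of the chart expression of `α`. -/
theorem chartForm_extD {α : X → V [⋀^Fin k]→L[ℝ] W} (hα : IsSmoothForm α) (x : X) {y : V}
    (hy : y ∈ (extChartAt 𝓘(ℝ, V) x).target) :
    chartForm (extD α) x y = extDeriv (chartForm α x) y :=
  (extDeriv_pullForm (smoothNear_extChartAt_symm hy) (isSmoothForm_iff.1 hα _)).symm

theorem IsSmoothForm.extD {α : X → V [⋀^Fin k]→L[ℝ] W} (hα : IsSmoothForm α) :
    IsSmoothForm (KahlerYM.extD α) := by
  refine isSmoothForm_iff.2 fun x => ?_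
  have h : chartForm (KahlerYM.extD α) x =ᶠ[𝓝 (extChartAt 𝓘(ℝ, V) x x)]
      extDeriv (chartForm α x) := by
    filter_upwards [(isOpen_extChartAt_target x).mem_nhds
      (mem_extChartAt_target (I := 𝓘(ℝ, V)) x)] with y hy
    exact chartForm_extD hα x hy
  exact (contDiffAt_extDeriv (isSmoothForm_iff.1 hα x)).congr_of_eventuallyEq h

theorem SmoothFormAt.add {α β : X → V [⋀^Fin k]→L[ℝ] W} {x : X} (hα : SmoothFormAt α x)
    (hβ : SmoothFormAt β x) : SmoothFormAt (α + β) x := ContDiffAt.add hα hβ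

theorem SmoothFormAt.smul {α : X → V [⋀^Fin k]→L[ℝ] W} {x : X} (c : ℝ) (hα : SmoothFormAt α x) :
    SmoothFormAt (c • α) x := ContDiffAt.const_smul c hα

theorem extD_add {α β : X → V [⋀^Fin k]→L[ℝ] W} {x : X} (hα : SmoothFormAt α x)
    (hβ : SmoothFormAt β x) : extD (α + β) x = extD α x + extD β x :=
  extDeriv_add (hα.differentiableAt (by simp)) (hβ.differentiableAt (by simp))

theorem extD_smul (α : X → V [⋀^Fin k]→L[ℝ] W) (c : ℝ) (x : X) :
    extD (c • α) x = c • extD α x := by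
  have h : chartForm (c • α) x = c • chartForm α x := rfl
  rw [extD, h, extDeriv_smul]
  rfl

theorem extD_compCLM {W' : Type*} [NormedAddCommGroup W'] [NormedSpace ℝ W']
    {α : X → V [⋀^Fin k]→L[ℝ] W} {x : X} (hα : SmoothFormAt α x) (L : W →L[ℝ] W') :
    extD (fun z => L.compContinuousAlternatingMap (α z)) x =
      L.compContinuousAlternatingMap (extD α x) := by
  have h : chartForm (fun z => L.compContinuousAlternatingMap (α z)) x =
      fun y => L.compContinuousAlternatingMap (chartForm α x y) := rfl
  have hd := hα.differentiableAt (n := ∞) (by simp)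
  let Λ := ContinuousLinearMap.compContinuousAlternatingMapCLM ℝ V W W' (ι := Fin k) L
  have hd' : DifferentiableAt ℝ (fun y => L.compContinuousAlternatingMap (chartForm α x y))
      (extChartAt 𝓘(ℝ, V) x x) := Λ.differentiableAt.comp _ hd
  rw [extD, h, extD]
  ext v
  rw [ContinuousLinearMap.compContinuousAlternatingMap_coe, Function.comp_apply,
    extDeriv_apply hd', extDeriv_apply hd, map_sum]
  refine Finset.sum_congr rfl fun i _ => ?_
  rw [map_zsmul]
  congr 1
  have h3 : DifferentiableAt ℝ (fun y => chartForm α x y (i.removeNth v))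
      (extChartAt 𝓘(ℝ, V) x x) :=
    (ContinuousAlternatingMap.apply ℝ V W (i.removeNth v)).differentiableAt.comp _ hd
  have := (L.hasFDerivAt.comp _ h3.hasFDerivAt).fderiv
  exact congrArg (fun A : V →L[ℝ] W' => A (v i)) this

end PullBack

/-! ### Coordinates adapted to a principal bundle and horizontal lifts -/

section Adapted

open Filter Topology

variable {E EP EG M P G : Type*}
  [NormedAddCommGroup E] [NormedSpace ℝ E] [FiniteDimensional ℝ E]
  [NormedAddCommGroup EP] [NormedSpace ℝ EP] [FiniteDimensional ℝ EP]
  [NormedAddCommGroup EG] [NormedSpace ℝ EG] [FiniteDimensional ℝ EG]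
  [TopologicalSpace M] [ChartedSpace E M] [IsManifold 𝓘(ℝ, E) ∞ M]
  [TopologicalSpace P] [ChartedSpace EP P] [IsManifold 𝓘(ℝ, EP) ∞ P]
  [TopologicalSpace G] [ChartedSpace EG G] [Group G] [LieGroup 𝓘(ℝ, EG) ∞ G]
  (Q : PrincipalBundle E EP EG M P G)

/-- The coordinate of `proj p` in the preferred chart at `proj p`. -/
def PrincipalBundle.base (p : P) : E := extChartAt 𝓘(ℝ, E) (Q.proj p) (Q.proj p)

/-- Local coordinates `(y, w) ∈ E × 𝔤` on `P` near `p`, obtained from a local trivialization: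
`y` is the coordinate of the base point in the preferred chart at `proj p`, and `w` is a coordinate
of the group component, centred at `p`. The map `fibre` parametrizes the group near `1` such that
`(base p, w)` are the coordinates of `p · fibre w`. -/
structure AdaptedCoord (p : P) where
  toFun : E × EG → P
  inv : P → E × EG
  fibre : EG → G
  toFun_base : toFun (Q.base p, 0) = p
  smooth_toFun : SmoothNear (E × EG) EP toFun (Q.base p, 0)
  smooth_inv : SmoothNear EP (E × EG) inv p
  toFun_inv : toFun ∘ inv =ᶠ[𝓝 p] id
  inv_toFun : inv ∘ toFun =ᶠ[𝓝 (Q.base p, 0)] id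
  proj_toFun : ∀ᶠ z in 𝓝 (Q.base p, (0 : EG)),
    Q.proj (toFun z) = (extChartAt 𝓘(ℝ, E) (Q.proj p)).symm z.1
  smooth_fibre : SmoothNear EG EG fibre 0
  fibre_zero : fibre 0 = 1
  act_fibre : ∀ᶠ w in 𝓝 (0 : EG), toFun (Q.base p, w) = Q.act p (fibre w)

theorem AdaptedCoord.nonempty (p : P) : Nonempty (AdaptedCoord Q p) := by
  obtain ⟨U, e, hU, hx, hs, ht, he, he', hp⟩ := Q.locally_trivial (Q.proj p)
  have hpe : p ∈ e.source := by rw [hs]; exact hx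
  set x := Q.proj p with hxdef
  set g0 := (e p).2 with hg0
  have hep : e p = (x, g0) := Prod.ext (hp p hpe).1 rfl
  set φ := extChartAt 𝓘(ℝ, E) x with hφ
  set ψ := extChartAt 𝓘(ℝ, EG) g0 with hψ
  have hb : Q.base p = φ x := rfl
  let t : E × EG → M × G := fun z => (φ.symm z.1, ψ.symm (ψ g0 + z.2))
  let s : M × G → E × EG := fun m => (φ m.1, ψ m.2 - ψ g0)
  have hφt := mem_extChartAt_target (I := 𝓘(ℝ, E)) x
  have hψt := mem_extChartAt_target (I := 𝓘(ℝ, EG)) g0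
  have ht0 : t (φ x, 0) = (x, g0) := by
    simp only [t, add_zero]
    rw [extChartAt_to_inv, extChartAt_to_inv]
  -- `t` is smooth near the base point
  have hshift : Continuous fun z : E × EG => ψ g0 + z.2 := by fun_prop
  have hmem : ∀ᶠ z in 𝓝 (φ x, (0 : EG)), z.1 ∈ φ.target ∧ ψ g0 + z.2 ∈ ψ.target := by
    refine (continuous_fst.continuousAt.eventually ?_).and (hshift.continuousAt.eventually ?_)
    · exact (isOpen_extChartAt_target x).mem_nhds hφt
    · simp only [add_zero]; exact (isOpen_extChartAt_target g0).mem_nhds hψt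
  have htsm : ∀ᶠ z in 𝓝 (φ x, (0 : EG)),
      ContMDiffAt 𝓘(ℝ, E × EG) (𝓘(ℝ, E).prod 𝓘(ℝ, EG)) ∞ t z := by
    filter_upwards [hmem] with z hz
    refine ContMDiffAt.prodMk ?_ ?_
    · exact (smoothNear_extChartAt_symm hz.1).contMDiffAt.comp z
        (contDiff_fst.contMDiff.contMDiffAt)
    · exact ContMDiffAt.comp (g := ψ.symm) z (smoothNear_extChartAt_symm hz.2).contMDiffAt
        (contDiff_const.add contDiff_snd).contMDiff.contMDiffAt
  have htc : ContinuousAt t (φ x, 0) := htsm.self_of_nhds.continuousAt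
  have htarget : ∀ᶠ z in 𝓝 (φ x, (0 : EG)), t z ∈ e.target := by
    refine htc.eventually (e.open_target.mem_nhds ?_)
    rw [ht0, ← hep]; exact e.map_source hpe
  have hsrc : ∀ᶠ q in 𝓝 p, q ∈ e.source := e.open_source.mem_nhds hpe
  have hsmem : ∀ᶠ q in 𝓝 p, (e q).1 ∈ φ.source ∧ (e q).2 ∈ ψ.source := by
    have hc := (e.continuousAt hpe)
    refine ((continuous_fst.continuousAt.comp hc).eventually ?_).and
      ((continuous_snd.continuousAt.comp hc).eventually ?_)
    · change _ ∈ 𝓝 (e p).1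
      rw [hep]; exact extChartAt_source_mem_nhds x
    · exact extChartAt_source_mem_nhds g0
  have hψinv : Continuous fun w : EG => ψ g0 + w := by fun_prop
  have hψmem : ∀ᶠ w in 𝓝 (0 : EG), ψ g0 + w ∈ ψ.target := by
    refine hψinv.continuousAt.eventually ?_
    simp only [add_zero]; exact (isOpen_extChartAt_target g0).mem_nhds hψt
  refine ⟨{ toFun := e.symm ∘ t, inv := s ∘ e, fibre := fun w => g0⁻¹ * ψ.symm (ψ g0 + w),
            toFun_base := ?_, smooth_toFun := ?_, smooth_inv := ?_, toFun_inv := ?_,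
            inv_toFun := ?_, proj_toFun := ?_, smooth_fibre := ?_, fibre_zero := ?_,
            act_fibre := ?_ }⟩
  · rw [hb, Function.comp_apply, ht0, ← hep, e.left_inv hpe]
  · rw [hb]
    filter_upwards [htsm, htarget] with z h1 h2
    exact (he'.contMDiffAt (e.open_target.mem_nhds h2)).comp z h1
  · filter_upwards [hsrc, hsmem] with q h1 h2
    have h3 := he.contMDiffAt (e.open_source.mem_nhds h1)
    refine ContMDiffAt.prodMk_space ?_ ?_
    · exact (smoothNear_extChartAt h2.1).contMDiffAt.comp q (contMDiffAt_fst.comp q h3)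
    · exact ((smoothNear_extChartAt h2.2).contMDiffAt.comp q (contMDiffAt_snd.comp q h3)).sub
        contMDiffAt_const
  · filter_upwards [hsrc, hsmem] with q h1 h2
    simp only [Function.comp_apply, t, s, id_eq, add_sub_cancel]
    rw [φ.left_inv h2.1, ψ.left_inv h2.2, Prod.mk.eta, e.left_inv h1]
  · rw [hb]
    filter_upwards [htarget, hmem] with z h1 h2
    simp only [Function.comp_apply, e.right_inv h1, id_eq]
    simp only [t, s]
    rw [φ.right_inv h2.1, ψ.right_inv h2.2]
    simp
  · rw [hb]
    filter_upwards [htarget] with z h1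
    rw [Function.comp_apply, ← (hp _ (e.map_target h1)).1, e.right_inv h1]
  · filter_upwards [hψmem] with w hw
    refine ContMDiffAt.mul contMDiffAt_const ?_
    exact ContMDiffAt.comp (g := ψ.symm) w (smoothNear_extChartAt_symm hw).contMDiffAt
      (contDiff_const.add contDiff_id).contMDiff.contMDiffAt
  · simp only [add_zero]
    rw [extChartAt_to_inv]; exact inv_mul_cancel g0
  · filter_upwards with w
    have h1 := (hp p hpe).2 (g0⁻¹ * ψ.symm (ψ g0 + w))
    have h2 : Q.act p (g0⁻¹ * ψ.symm (ψ g0 + w)) ∈ e.source := by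
      rw [hs, Set.mem_preimage, Q.proj_act]; exact hx
    rw [← e.left_inv h2, h1]
    simp only [Function.comp_apply, t, hb, extChartAt_to_inv, hφ]
    rw [hep]
    simp only [mul_inv_cancel_left]

variable {Q}

theorem AdaptedCoord.inv_self {p : P} (c : AdaptedCoord Q p) : c.inv p = (Q.base p, 0) := by
  have := c.inv_toFun.self_of_nhds
  simpa [c.toFun_base] using this

theorem AdaptedCoord.smooth_toFun' {p : P} (c : AdaptedCoord Q p) :
    SmoothNear (E × EG) EP c.toFun (c.inv p) := by rw [c.inv_self]; exact c.smooth_toFun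

variable (Q)

theorem PrincipalBundle.smoothNear_proj (p : P) : SmoothNear EP E Q.proj p :=
  ContMDiff.smoothNear Q.contMDiff_proj p

theorem PrincipalBundle.smoothNear_act_left (g : G) (p : P) :
    SmoothNear EP EP (fun q => Q.act q g) p := by
  refine ContMDiff.smoothNear ?_ p
  exact Q.contMDiff_act.comp (contMDiff_id.prodMk contMDiff_const)

theorem PrincipalBundle.smoothNear_act_right (p : P) (g : G) :
    SmoothNear EG EP (fun h => Q.act p h) g := by
  refine ContMDiff.smoothNear ?_ g
  exact Q.contMDiff_act.comp (contMDiff_const.prodMk contMDiff_id)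

/-- The value at `p` of the fundamental vector fields. -/
def PrincipalBundle.vert (p : P) : EG →L[ℝ] EP := tmap (fun g : G => Q.act p g) 1

/-- The differential of the bundle projection. -/
abbrev PrincipalBundle.dproj (p : P) : EP →L[ℝ] E := tmap Q.proj p

theorem PrincipalBundle.dproj_vert (p : P) (X : EG) : Q.dproj p (Q.vert p X) = 0 := by
  have h := tmap_comp (V'' := E) (g := Q.proj) (f := fun g : G => Q.act p g) (x := (1 : G))
    (Q.smoothNear_proj _).mdifferentiableAt (Q.smoothNear_act_right p 1).mdifferentiableAt
  have h2 : Q.proj ∘ (fun g : G => Q.act p g) = fun _ => Q.proj p := funext fun g => Q.proj_act p g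
  rw [h2, tmap_const, Q.act_one] at h
  exact (congrArg (fun L : EG →L[ℝ] E => L X) h).symm

theorem PrincipalBundle.dproj_act (p : P) (g : G) (v : EP) :
    Q.dproj (Q.act p g) (tmap (fun q : P => Q.act q g) p v) = Q.dproj p v := by
  have h := tmap_comp (V'' := E) (g := Q.proj) (f := fun q : P => Q.act q g) (x := p)
    (Q.smoothNear_proj _).mdifferentiableAt (Q.smoothNear_act_left g p).mdifferentiableAt
  have h2 : Q.proj ∘ (fun q : P => Q.act q g) = Q.proj := funext fun q => Q.proj_act q g
  rw [h2] at h
  exact (congrArg (fun L : EP →L[ℝ] E => L v) h).symm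

variable {Q}

/-- The differential of adapted coordinates composed with the projection, at nearby points. -/
theorem AdaptedCoord.dproj_toFun {p : P} (c : AdaptedCoord Q p) :
    ∀ᶠ z in 𝓝 (Q.base p, (0 : EG)), ∀ u : E × EG,
      Q.dproj (c.toFun z) (tmap c.toFun z u) = chartSymmDeriv (Q.proj p) z.1 u.1 := by
  have hy : Q.base p ∈ (extChartAt 𝓘(ℝ, E) (Q.proj p)).target := mem_extChartAt_target _
  have h1 : ∀ᶠ z in 𝓝 (Q.base p, (0 : EG)), z.1 ∈ (extChartAt 𝓘(ℝ, E) (Q.proj p)).target :=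
    continuous_fst.continuousAt.eventually ((isOpen_extChartAt_target _).mem_nhds hy)
  filter_upwards [c.smooth_toFun.eventually, eventually_eventually_nhds.2 c.proj_toFun, h1]
    with z h2 h3 h4 u
  have h5 := tmap_comp (V'' := E) (g := Q.proj) (f := c.toFun) (x := z)
    (Q.smoothNear_proj _).mdifferentiableAt h2.mdifferentiableAt
  have h6 : Q.proj ∘ c.toFun =ᶠ[𝓝 z] (extChartAt 𝓘(ℝ, E) (Q.proj p)).symm ∘ Prod.fst := h3
  rw [tmap_congr h6, tmap_comp (V' := E) (smoothNear_extChartAt_symm h4).mdifferentiableAt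
    (contDiff_fst.contMDiff.contMDiffAt.mdifferentiableAt (n := ∞) (by simp))] at h5
  have h7 := congrArg (fun L : E × EG →L[ℝ] E => L u) h5
  refine h7.symm.trans ?_
  have h8 : (tmap (Prod.fst : E × EG → E) z : E × EG →L[ℝ] E) = ContinuousLinearMap.fst ℝ E EG := by
    rw [tmap_eq_fderiv]; exact fderiv_fst
  rw [h8]
  rfl

theorem AdaptedCoord.tmap_toFun_inv {p : P} (c : AdaptedCoord Q p) (v : EP) :
    tmap c.toFun (Q.base p, (0 : EG)) (tmap c.inv p v : E × EG) = v := by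
  have h := tmap_comp (V'' := EP) (g := c.toFun) (f := c.inv) (x := p)
    c.smooth_toFun'.mdifferentiableAt c.smooth_inv.mdifferentiableAt
  rw [tmap_eq_id c.toFun_inv, c.inv_self] at h
  exact (congrArg (fun L : EP →L[ℝ] EP => L v) h).symm

theorem AdaptedCoord.tmap_inv_toFun {p : P} (c : AdaptedCoord Q p) :
    ∀ᶠ z in 𝓝 (Q.base p, (0 : EG)), ∀ u : E × EG,
      tmap c.inv (c.toFun z) (tmap c.toFun z u : EP) = u := by
  have h0 : ∀ᶠ z in 𝓝 (Q.base p, (0 : EG)), SmoothNear EP (E × EG) c.inv (c.toFun z) := by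
    refine c.smooth_toFun.contMDiffAt.continuousAt.eventually ?_
    rw [c.toFun_base]; exact c.smooth_inv.eventually
  filter_upwards [h0, c.smooth_toFun.eventually, eventually_eventually_nhds.2 c.inv_toFun]
    with z h1 h2 h3 u
  have h := tmap_comp (V'' := E × EG) (g := c.inv) (f := c.toFun) (x := z)
    h1.mdifferentiableAt h2.mdifferentiableAt
  rw [tmap_eq_id h3] at h
  exact (congrArg (fun L : E × EG →L[ℝ] E × EG => L u) h).symm

variable (Q)

theorem PrincipalBundle.exists_vert_eq {p : P} {v : EP} (hv : Q.dproj p v = 0) :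
    ∃ X, Q.vert p X = v := by
  obtain ⟨c⟩ := AdaptedCoord.nonempty Q p
  set b : E × EG := tmap c.inv p v with hb
  have h1 := c.dproj_toFun.self_of_nhds b
  have hv' := c.tmap_toFun_inv v
  have h2 : b.1 = 0 := by
    rw [c.toFun_base] at h1
    rw [← hb] at hv'
    rw [hv', hv, PrincipalBundle.base, chartSymmDeriv_self] at h1
    exact h1.symm
  have hj : SmoothNear EG (E × EG) (fun w : EG => (Q.base p, w)) 0 :=
    ContMDiff.smoothNear (contDiff_const.prodMk contDiff_id).contMDiff 0
  have h3 := tmap_comp (V'' := EP) (g := c.toFun) (f := fun w : EG => (Q.base p, w)) (x := (0 : EG))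
    c.smooth_toFun.mdifferentiableAt hj.mdifferentiableAt
  have h4 : c.toFun ∘ (fun w : EG => (Q.base p, w)) =ᶠ[𝓝 0] (fun g => Q.act p g) ∘ c.fibre :=
    c.act_fibre
  rw [tmap_congr h4, tmap_comp (V' := EG) (by
    rw [c.fibre_zero]; exact (Q.smoothNear_act_right p 1).mdifferentiableAt)
    c.smooth_fibre.mdifferentiableAt, c.fibre_zero] at h3
  refine ⟨tmap c.fibre (0 : EG) b.2, ?_⟩
  have h5 := congrArg (fun L : EG →L[ℝ] EP => L b.2) h3
  refine h5.trans ?_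
  have h6 : (tmap (fun w : EG => (Q.base p, w)) (0 : EG) : EG →L[ℝ] E × EG) =
      ContinuousLinearMap.inr ℝ E EG := by
    rw [tmap_eq_fderiv]
    exact (hasFDerivAt_prodMk_right (Q.base p) (0 : EG)).fderiv
  rw [h6]
  refine Eq.trans ?_ hv'
  change tmap c.toFun (Q.base p, 0) (0, b.2) = _
  rw [← h2]

theorem PrincipalBundle.dproj_surjective (p : P) : Function.Surjective (Q.dproj p) := by
  intro u
  obtain ⟨c⟩ := AdaptedCoord.nonempty Q p
  have h1 := c.dproj_toFun.self_of_nhds (u, 0)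
  rw [c.toFun_base, PrincipalBundle.base, chartSymmDeriv_self] at h1
  exact ⟨_, h1⟩

variable {Q} (A : Connection Q)

/-- The connection form at `p`, as a linear map. -/
def Connection.lin (p : P) : EP →L[ℝ] EG :=
  (ContinuousAlternatingMap.ofSubsingleton ℝ EP EG (0 : Fin 1)).symm (A.form p)

theorem Connection.lin_apply (p : P) (v : EP) : A.lin p v = A.form p ![v] := by
  rw [Matrix.vec_single_eq_const]; rfl

theorem Connection.lin_vert (p : P) (X : EG) : A.lin p (Q.vert p X) = X := by
  rw [A.lin_apply]; exact A.vertical p X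

theorem Connection.bijective_prod (p : P) :
    Function.Bijective ((Q.dproj p).prod (A.lin p)) := by
  constructor
  · rw [injective_iff_map_eq_zero]
    intro v hv
    have h1 : Q.dproj p v = 0 := congrArg Prod.fst hv
    have h2 : A.lin p v = 0 := congrArg Prod.snd hv
    obtain ⟨X, rfl⟩ := Q.exists_vert_eq h1
    rw [A.lin_vert] at h2
    rw [h2, map_zero]
  · rintro ⟨u, X⟩
    obtain ⟨v, rfl⟩ := Q.dproj_surjective p u
    refine ⟨v + Q.vert p (X - A.lin p v), ?_⟩
    simp only [ContinuousLinearMap.prod_apply, map_add, Q.dproj_vert, A.lin_vert, Prod.mk_add_mk,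
      add_zero, add_sub_cancel]

theorem Connection.prod_horLift (p : P) (u : E) :
    (Q.dproj p).prod (A.lin p) (horLift Q A.form p u) = (u, 0) := by
  let e := (LinearEquiv.ofBijective ((Q.dproj p).prod (A.lin p)).toLinearMap
    (A.bijective_prod p)).toContinuousLinearEquiv
  have he : ((Q.dproj p).prod (A.lin p)) = (e : EP →L[ℝ] E × EG) := by ext <;> rfl
  change (Q.dproj p).prod (A.lin p) (((Q.dproj p).prod (A.lin p)).inverse (u, 0)) = (u, 0)
  rw [he, ContinuousLinearMap.inverse_equiv]
  exact e.apply_symm_apply _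

theorem Connection.dproj_horLift (p : P) (u : E) : Q.dproj p (horLift Q A.form p u) = u :=
  congrArg Prod.fst (A.prod_horLift p u)

theorem Connection.lin_horLift (p : P) (u : E) : A.lin p (horLift Q A.form p u) = 0 :=
  congrArg Prod.snd (A.prod_horLift p u)

theorem Connection.horLift_unique {p : P} {u : E} {v : EP} (h1 : Q.dproj p v = u)
    (h2 : A.lin p v = 0) : v = horLift Q A.form p u :=
  (A.bijective_prod p).1 ((Prod.ext h1 h2 : (Q.dproj p).prod (A.lin p) v = (u, 0)).trans
    (A.prod_horLift p u).symm)

theorem Connection.horLift_act (p : P) (g : G) (u : E) :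
    horLift Q A.form (Q.act p g) u = tmap (fun q : P => Q.act q g) p (horLift Q A.form p u) := by
  refine (A.horLift_unique ?_ ?_).symm
  · rw [Q.dproj_act, A.dproj_horLift]
  · rw [A.lin_apply, A.equivariant, ← A.lin_apply, A.lin_horLift, map_zero]

end Adapted

/-! ### Covariant derivative, curvature and the Bianchi identity -/

section TwoForms

variable {V W : Type*} [NormedAddCommGroup V] [NormedSpace ℝ V] [NormedAddCommGroup W]
  [NormedSpace ℝ W]

theorem form_two_add_left (β : V [⋀^Fin 2]→L[ℝ] W) (a b c : V) :
    β ![a + b, c] = β ![a, c] + β ![b, c] := β.toMultilinearMap.cons_add ![c] a b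

theorem form_two_smul_left (β : V [⋀^Fin 2]→L[ℝ] W) (t : ℝ) (a c : V) :
    β ![t • a, c] = t • β ![a, c] := β.toMultilinearMap.cons_smul ![c] t a

theorem form_two_swap (β : V [⋀^Fin 2]→L[ℝ] W) (a b : V) : β ![a, b] = -β ![b, a] := by
  have h := β.toAlternatingMap.map_swap ![b, a] (i := 0) (j := 1) (by decide)
  have h2 : (![b, a] ∘ (Equiv.swap (0 : Fin 2) 1)) = ![a, b] := by
    ext i; fin_cases i <;> simp
  rw [h2] at h
  exact h

theorem form_two_add_right (β : V [⋀^Fin 2]→L[ℝ] W) (a b c : V) :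
    β ![a, b + c] = β ![a, b] + β ![a, c] := by
  rw [form_two_swap, form_two_add_left, form_two_swap β a b, form_two_swap β a c, neg_add]

theorem form_two_smul_right (β : V [⋀^Fin 2]→L[ℝ] W) (t : ℝ) (a c : V) :
    β ![a, t • c] = t • β ![a, c] := by
  rw [form_two_swap, form_two_smul_left, form_two_swap β a c, smul_neg]

theorem form_two_neg_left (β : V [⋀^Fin 2]→L[ℝ] W) (a c : V) : β ![-a, c] = -β ![a, c] := by
  rw [← neg_one_smul ℝ a, form_two_smul_left, neg_one_smul]

theorem form_two_neg_right (β : V [⋀^Fin 2]→L[ℝ] W) (a c : V) : β ![a, -c] = -β ![a, c] := by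
  rw [← neg_one_smul ℝ c, form_two_smul_right, neg_one_smul]

theorem form_two_ext {β γ : V [⋀^Fin 2]→L[ℝ] W} (h : ∀ u v, β ![u, v] = γ ![u, v]) : β = γ := by
  ext v
  have : v = ![v 0, v 1] := by ext i; fin_cases i <;> rfl
  rw [this]; exact h _ _

theorem form_one_ext {β γ : V [⋀^Fin 1]→L[ℝ] W} (h : ∀ u, β ![u] = γ ![u]) : β = γ := by
  ext v
  have : v = ![v 0] := by ext i; fin_cases i; rfl
  rw [this]; exact h _

theorem comp_two_apply {V' : Type*} [NormedAddCommGroup V'] [NormedSpace ℝ V']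
    (β : V [⋀^Fin 2]→L[ℝ] W) (L : V' →L[ℝ] V) (u v : V') :
    β.compContinuousLinearMap L ![u, v] = β ![L u, L v] := by
  rw [ContinuousAlternatingMap.compContinuousLinearMap_apply]
  congr 1; ext i; fin_cases i <;> rfl

theorem comp_one_apply {V' : Type*} [NormedAddCommGroup V'] [NormedSpace ℝ V']
    (β : V [⋀^Fin 1]→L[ℝ] W) (L : V' →L[ℝ] V) (u : V') :
    β.compContinuousLinearMap L ![u] = β ![L u] := by
  rw [ContinuousAlternatingMap.compContinuousLinearMap_apply]
  congr 1; ext i; fin_cases i; rfl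

theorem fderiv_apply_eq_zero {f : V → W} {x v : V} (hf : DifferentiableAt ℝ f x)
    (h : ∀ᶠ t in nhds (0 : ℝ), f (x + t • v) = f x) : fderiv ℝ f x v = 0 := by
  have h1 := (hf.hasFDerivAt.hasLineDerivAt v)
  have h2 : HasDerivAt (fun t : ℝ => f (x + t • v)) 0 0 :=
    (hasDerivAt_const (0 : ℝ) (f x)).congr_of_eventuallyEq h
  exact HasDerivAt.unique h1 h2

end TwoForms

section Covariant

open Filter Topology

variable {E EP EG M P G : Type*}
  [NormedAddCommGroup E] [NormedSpace ℝ E] [FiniteDimensional ℝ E]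
  [NormedAddCommGroup EP] [NormedSpace ℝ EP] [FiniteDimensional ℝ EP]
  [NormedAddCommGroup EG] [NormedSpace ℝ EG] [FiniteDimensional ℝ EG]
  [TopologicalSpace M] [ChartedSpace E M] [IsManifold 𝓘(ℝ, E) ∞ M]
  [TopologicalSpace P] [ChartedSpace EP P] [IsManifold 𝓘(ℝ, EP) ∞ P]
  [TopologicalSpace G] [ChartedSpace EG G] [Group G] [LieGroup 𝓘(ℝ, EG) ∞ G]
  {Q : PrincipalBundle E EP EG M P G} {k : ℕ}

/-- The expression of an `Ad P`-valued form in adapted coordinates. -/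
def AdaptedCoord.loc {p : P} (c : AdaptedCoord Q p) (α : P → E [⋀^Fin k]→L[ℝ] EG) (z : E × EG) :
    E [⋀^Fin k]→L[ℝ] EG :=
  (α (c.toFun z)).compContinuousLinearMap (chartSymmDeriv (Q.proj p) z.1)

theorem AdaptedCoord.pullForm_toP {p : P} (c : AdaptedCoord Q p) (α : P → E [⋀^Fin k]→L[ℝ] EG) :
    (pullForm c.toFun (toP Q α) : E × EG → (E × EG) [⋀^Fin k]→L[ℝ] EG) =ᶠ[𝓝 (Q.base p, 0)]
      fun z => (c.loc α z).compContinuousLinearMap (ContinuousLinearMap.fst ℝ E EG) := by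
  filter_upwards [c.dproj_toFun] with z hz
  ext v
  exact congrArg (α (c.toFun z)) (funext fun i => hz (v i))

theorem AdaptedCoord.contDiffAt_loc {p : P} (c : AdaptedCoord Q p)
    {α : P → E [⋀^Fin k]→L[ℝ] EG} (h : SmoothFormAt (toP Q α) p) :
    ContDiffAt ℝ ∞ (c.loc α) (Q.base p, 0) := by
  have h1 : ContDiffAt ℝ ∞ (pullForm c.toFun (toP Q α) : E × EG → (E × EG) [⋀^Fin k]→L[ℝ] EG)
      (Q.base p, 0) := SmoothFormAt.pull_flat c.smooth_toFun (by rwa [c.toFun_base])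
  refine (contDiffAt_form_comp (h1.congr_of_eventuallyEq (c.pullForm_toP α).symm)
    (contDiffAt_const (c := ContinuousLinearMap.inl ℝ E EG))).congr_of_eventuallyEq
      (Eventually.of_forall fun z => ?_)
  ext v; rfl

theorem AdaptedCoord.smoothFormAt {p : P} (c : AdaptedCoord Q p)
    {α : P → E [⋀^Fin k]→L[ℝ] EG} (h : ContDiffAt ℝ ∞ (c.loc α) (Q.base p, 0)) :
    SmoothFormAt (toP Q α) p := by
  have h1 : ContDiffAt ℝ ∞ (pullForm c.toFun (toP Q α) : E × EG → (E × EG) [⋀^Fin k]→L[ℝ] EG)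
      (Q.base p, 0) :=
    (contDiffAt_form_comp h (contDiffAt_const (c := ContinuousLinearMap.fst ℝ E EG))
      ).congr_of_eventuallyEq (c.pullForm_toP α)
  rw [← c.inv_self, ← smoothFormAt_flat] at h1
  refine (SmoothFormAt.pull c.smooth_inv h1).congr ?_
  have h2 : ∀ᶠ q in 𝓝 p, SmoothNear (E × EG) EP c.toFun (c.inv q) := by
    refine c.smooth_inv.contMDiffAt.continuousAt.eventually ?_
    exact c.smooth_toFun'.eventually
  filter_upwards [h2, c.smooth_inv.eventually, eventually_eventually_nhds.2 c.toFun_inv]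
    with q hq1 hq2 hq3
  rw [← pullForm_comp hq1.mdifferentiableAt hq2.mdifferentiableAt, pullForm_congr hq3]
  ext v
  simp only [pullForm, tmap_eq_id (EventuallyEq.refl _ (id : P → P))]
  rfl

/-- The horizontal lift in adapted coordinates. -/
theorem AdaptedCoord.exists_horLift {p : P} (c : AdaptedCoord Q p) (A : Connection Q) :
    ∃ L : E × EG → E →L[ℝ] EG, ContDiffAt ℝ ∞ L (Q.base p, 0) ∧
      ∀ᶠ z in 𝓝 (Q.base p, (0 : EG)), ∀ u : E,
        horLift Q A.form (c.toFun z) (chartSymmDeriv (Q.proj p) z.1 u) =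
          tmap c.toFun z (u, L z u) := by
  -- `a` is the pulled-back connection form. Its restriction to the fibre direction is invertible,
  -- and this determines the vertical component of the lift of a vector of the base.
  let a : E × EG → E × EG →L[ℝ] EG := fun z => (A.lin (c.toFun z)).comp (tmap c.toFun z)
  have ha : ContDiffAt ℝ ∞ a (Q.base p, 0) := by
    have h1 : ContDiffAt ℝ ∞ (pullForm c.toFun A.form : E × EG → (E × EG) [⋀^Fin 1]→L[ℝ] EG)
      (Q.base p, 0) := SmoothFormAt.pull_flat c.smooth_toFun (isSmoothForm_iff.1 A.smooth _)
    let e := (ContinuousAlternatingMap.ofSubsingletonLIE (𝕜 := ℝ) (E := E × EG) (F := EG)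
      (0 : Fin 1)).symm.toContinuousLinearEquiv
    exact ContDiffAt.comp (g := e) (Q.base p, (0 : EG)) e.contDiff.contDiffAt h1
  have h1 : ContDiffAt ℝ ∞ (fun z => (a z).comp (ContinuousLinearMap.inr ℝ E EG))
    (Q.base p, 0) := ha.clm_comp contDiffAt_const
  have h2 : ContDiffAt ℝ ∞ (fun z => (a z).comp (ContinuousLinearMap.inl ℝ E EG))
    (Q.base p, 0) := ha.clm_comp contDiffAt_const
  have hinj : ∀ᶠ z in 𝓝 (Q.base p, (0 : EG)),
      Function.Injective ((a z).comp (ContinuousLinearMap.inr ℝ E EG)) := by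
    filter_upwards [c.dproj_toFun, c.tmap_inv_toFun] with z hz1 hz2
    rw [injective_iff_map_eq_zero]
    intro X hX
    have h3 : Q.dproj (c.toFun z) (tmap c.toFun z ((0, X) : E × EG)) = 0 := by
      rw [hz1, map_zero]
    have h4 : (tmap c.toFun z ((0, X) : E × EG) : EP) = 0 :=
      (A.bijective_prod (c.toFun z)).1 ((Prod.ext h3 hX : _ = (0 : E × EG)).trans (map_zero _).symm)
    have h5 := hz2 (0, X)
    rw [h4, map_zero] at h5
    exact (congrArg Prod.snd h5).symm
  have hinv : ∀ᶠ z in 𝓝 (Q.base p, (0 : EG)), ∃ e : EG ≃L[ℝ] EG,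
      (a z).comp (ContinuousLinearMap.inr ℝ E EG) = e := by
    filter_upwards [hinj] with z hz
    refine ⟨(LinearEquiv.ofInjectiveEndo _ hz).toContinuousLinearEquiv, ?_⟩
    ext X; rfl
  refine ⟨fun z => -(((a z).comp (ContinuousLinearMap.inr ℝ E EG)).inverse.comp
    ((a z).comp (ContinuousLinearMap.inl ℝ E EG))), ?_, ?_⟩
  · refine ContDiffAt.neg (ContDiffAt.clm_comp ?_ h2)
    obtain ⟨e, he⟩ := hinv.self_of_nhds
    refine ContDiffAt.comp (g := ContinuousLinearMap.inverse) _ ?_ h1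
    rw [he]
    exact contDiffAt_map_inverse e
  · filter_upwards [hinv, c.dproj_toFun] with z ⟨e, he⟩ hz u
    refine (A.horLift_unique (hz (u, _)) ?_).symm
    change a z _ = 0
    rw [he, ContinuousLinearMap.inverse_equiv]
    set w := (a z).comp (ContinuousLinearMap.inl ℝ E EG) u with hw
    have h3 : ∀ X, a z (0, X) = e X := fun X => congrArg (fun L : EG →L[ℝ] EG => L X) he
    have h4 : ((u, (-((e.symm : EG →L[ℝ] EG).comp ((a z).comp (ContinuousLinearMap.inl ℝ E EG)))) u)
        : E × EG) = (u, 0) + (0, -(e.symm w)) := by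
      simp [hw]
    rw [h4, map_add, h3, map_neg, e.apply_symm_apply]
    exact add_neg_cancel _

/-- The pull-back of `β` by the right translation by `g` is `Ad(g⁻¹) β`. -/
def IsEquivariantForm (Q : PrincipalBundle E EP EG M P G) (β : P → EP [⋀^Fin k]→L[ℝ] EG) : Prop :=
  ∀ g : G, (pullForm (fun q => Q.act q g) β : P → EP [⋀^Fin k]→L[ℝ] EG) =
    fun q => (Ad EG g⁻¹).compContinuousAlternatingMap (β q)

theorem IsEquivariantForm.extD {β : P → EP [⋀^Fin k]→L[ℝ] EG} (h : IsEquivariantForm Q β)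
    (hβ : IsSmoothForm β) : IsEquivariantForm Q (extD β) := by
  intro g
  ext1 q
  have h1 := extD_pullForm (V := EP) (Q.smoothNear_act_left g q) (isSmoothForm_iff.1 hβ _)
  rw [h g] at h1
  exact h1.symm.trans (extD_compCLM (isSmoothForm_iff.1 hβ q) _)

theorem IsAdForm.isEquivariantForm {α : P → E [⋀^Fin k]→L[ℝ] EG} (h : IsAdForm Q α) :
    IsEquivariantForm Q (toP Q α) := by
  intro g
  ext q v
  refine Eq.trans ?_ (h.equivariant q g (fun i => Q.dproj q (v i)))
  exact congrArg (α (Q.act q g)) (funext fun i => Q.dproj_act q g (v i))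

theorem Connection.isEquivariantForm (A : Connection Q) : IsEquivariantForm Q A.form := by
  intro g
  ext1 q
  refine form_one_ext fun u => ?_
  rw [pullForm, comp_one_apply]
  exact A.equivariant q g u

/-- The horizontal part of a smooth equivariant form on `P` is a smooth `Ad P`-valued form. -/
theorem Connection.isAdForm_horizontal (A : Connection Q) {β : P → EP [⋀^Fin k]→L[ℝ] EG}
    (hβ : IsSmoothForm β) (he : IsEquivariantForm Q β) :
    IsAdForm Q (fun p => (β p).compContinuousLinearMap (horLift Q A.form p)) where
  equivariant p g v := by
    have h := congrArg (fun (γ : P → EP [⋀^Fin k]→L[ℝ] EG) =>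
      γ p (fun i => horLift Q A.form p (v i))) (he g)
    refine Eq.trans ?_ h
    exact congrArg (β (Q.act p g)) (funext fun i => A.horLift_act p g (v i))
  smooth := by
    refine isSmoothForm_iff.2 fun p => ?_
    obtain ⟨c⟩ := AdaptedCoord.nonempty Q p
    obtain ⟨L, hL, hL'⟩ := c.exists_horLift A
    refine c.smoothFormAt ?_
    have h1 : ContDiffAt ℝ ∞ (pullForm c.toFun β : E × EG → (E × EG) [⋀^Fin k]→L[ℝ] EG)
      (Q.base p, 0) := SmoothFormAt.pull_flat c.smooth_toFun (isSmoothForm_iff.1 hβ _)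
    have h2 : ContDiffAt ℝ ∞ (fun z => (ContinuousLinearMap.id ℝ E).prod (L z))
        (Q.base p, 0) := by
      refine ((contDiffAt_const (c := ContinuousLinearMap.inl ℝ E EG)).add
        ((contDiffAt_const (c := ContinuousLinearMap.inr ℝ E EG)).clm_comp
          hL)).congr_of_eventuallyEq (Eventually.of_forall fun z => ?_)
      ext u <;> simp
    refine (contDiffAt_form_comp h1 h2).congr_of_eventuallyEq ?_
    filter_upwards [hL'] with z hz
    ext v
    exact congrArg (β (c.toFun z)) (funext fun i => hz (v i))

theorem IsAdForm.covD {α : P → E [⋀^Fin k]→L[ℝ] EG} (h : IsAdForm Q α) (A : Connection Q) :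
    IsAdForm Q (covD Q A.form α) :=
  A.isAdForm_horizontal h.smooth.extD (h.isEquivariantForm.extD h.smooth)

theorem Connection.isAdForm_curvature (A : Connection Q) : IsAdForm Q (curvature Q A.form) :=
  A.isAdForm_horizontal A.smooth.extD (A.isEquivariantForm.extD A.smooth)

/-! ### The form `dA` vanishes on a vertical and a horizontal vector -/

/-- Pull the connection form back by the action `(q, g) ↦ q · g`, written in charts. Its value on a
vector tangent to `G` is given by the Maurer–Cartan form and does not depend on `q`; its value on a
horizontal vector at `p` stays zero as `g` varies, by equivariance. Both terms of `dA` vanish. -/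
theorem Connection.extD_vert_horizontal (A : Connection Q) {p : P} {v : EP} (hv : A.lin p v = 0)
    (X : EG) : extD A.form p ![Q.vert p X, v] = 0 := by
  set φ := extChartAt 𝓘(ℝ, EP) p with hφ
  set ψ := extChartAt 𝓘(ℝ, EG) (1 : G) with hψ
  have hz0 : φ p ∈ φ.target := mem_extChartAt_target p
  have hw0 : ψ 1 ∈ ψ.target := mem_extChartAt_target (1 : G)
  let f : EP × EG → P := fun z => Q.act (φ.symm z.1) (ψ.symm z.2)
  have hf0 : f (φ p, ψ 1) = p := by
    simp only [f, hφ, hψ, extChartAt_to_inv, Q.act_one]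
  have hmem : ∀ᶠ z in 𝓝 (φ p, ψ 1), z.1 ∈ φ.target ∧ z.2 ∈ ψ.target :=
    (continuous_fst.continuousAt.eventually ((isOpen_extChartAt_target p).mem_nhds hz0)).and
      (continuous_snd.continuousAt.eventually ((isOpen_extChartAt_target (1 : G)).mem_nhds hw0))
  have hf : SmoothNear (EP × EG) EP f (φ p, ψ 1) := by
    filter_upwards [hmem] with z hz
    refine ContMDiffAt.comp (g := fun q : P × G => Q.act q.1 q.2)
      (I' := 𝓘(ℝ, EP).prod 𝓘(ℝ, EG)) (f := fun z : EP × EG => (φ.symm z.1, ψ.symm z.2)) z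
      Q.contMDiff_act.contMDiffAt ?_
    refine ContMDiffAt.prodMk ?_ ?_
    · exact (smoothNear_extChartAt_symm hz.1).contMDiffAt.comp z
        (contDiff_fst.contMDiff.contMDiffAt)
    · exact (smoothNear_extChartAt_symm hz.2).contMDiffAt.comp z
        (contDiff_snd.contMDiff.contMDiffAt)
  -- values of the pulled back form on vectors tangent to the second factor
  have hG : ∀ᶠ z in 𝓝 (φ p, ψ 1), pullForm (V := EP × EG) f A.form z ![((0, X) : EP × EG)] =
      tmap (fun h : G => (ψ.symm z.2)⁻¹ * h) (ψ.symm z.2) (tmap ψ.symm z.2 X : EG) := by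
    filter_upwards [hmem, hf.eventually] with z hz hfz
    set g := ψ.symm z.2 with hg
    set q := φ.symm z.1 with hq
    have hj : SmoothNear EG (EP × EG) (fun w : EG => (z.1, w)) z.2 :=
      ContMDiff.smoothNear (contDiff_const.prodMk contDiff_id).contMDiff z.2
    have h1 := tmap_comp (V'' := EP) (g := f) (f := fun w : EG => (z.1, w)) (x := z.2)
      hfz.mdifferentiableAt hj.mdifferentiableAt
    have h2 : (tmap (fun w : EG => (z.1, w)) z.2 : EG →L[ℝ] EP × EG) =
      ContinuousLinearMap.inr ℝ EP EG := by
      rw [tmap_eq_fderiv]; exact (hasFDerivAt_prodMk_right z.1 z.2).fderiv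
    have hm : SmoothNear EG EG (fun h : G => g⁻¹ * h) g :=
      ContMDiff.smoothNear (contMDiff_const.mul contMDiff_id) g
    have h3 : f ∘ (fun w : EG => (z.1, w)) =
        ((fun h => Q.act (Q.act q g) h) ∘ (fun h : G => g⁻¹ * h)) ∘ ψ.symm := by
      ext w
      simp only [Function.comp_apply, f, ← Q.act_mul, mul_inv_cancel_left, hq]
    have h4 : SmoothNear EG EP ((fun h => Q.act (Q.act q g) h) ∘ (fun h : G => g⁻¹ * h)) g :=
      SmoothNear.comp (Q.smoothNear_act_right _ _) hm
    rw [h3, tmap_comp (V' := EG) (f := ψ.symm) (x := z.2) h4.mdifferentiableAt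
      (smoothNear_extChartAt_symm hz.2).mdifferentiableAt,
      tmap_comp (V' := EG) (Q.smoothNear_act_right _ _).mdifferentiableAt hm.mdifferentiableAt,
      h2, inv_mul_cancel] at h1
    have h5 := congrArg (fun L : EG →L[ℝ] EP => L X) h1
    rw [pullForm, comp_one_apply]
    change A.form (f z) ![((tmap f z).comp (ContinuousLinearMap.inr ℝ EP EG)) X] = _
    rw [← h5]
    exact A.vertical _ _
  -- values on vectors tangent to the first factor, over the point `p`
  have hP : ∀ᶠ w in 𝓝 (ψ 1), pullForm (V := EP × EG) f A.form (φ p, w) ![((v, 0) : EP × EG)] = 0 := by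
    have hc : ContinuousAt (fun w : EG => (φ p, w)) (ψ 1) := by fun_prop
    filter_upwards [hc.eventually hf.eventually] with w hfz
    set g := ψ.symm w with hg
    have hj : SmoothNear EP (EP × EG) (fun z : EP => (z, w)) (φ p) :=
      ContMDiff.smoothNear (contDiff_id.prodMk contDiff_const).contMDiff (φ p)
    have h1 := tmap_comp (V'' := EP) (g := f) (f := fun z : EP => (z, w)) (x := φ p)
      hfz.mdifferentiableAt hj.mdifferentiableAt
    have h2 : (tmap (fun z : EP => (z, w)) (φ p) : EP →L[ℝ] EP × EG) =
      ContinuousLinearMap.inl ℝ EP EG := by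
      rw [tmap_eq_fderiv]; exact (hasFDerivAt_prodMk_left (φ p) w).fderiv
    have h3 : f ∘ (fun z : EP => (z, w)) = (fun q => Q.act q g) ∘ φ.symm := rfl
    have h6 : (tmap φ.symm (φ p) : EP →L[ℝ] EP) = ContinuousLinearMap.id ℝ EP :=
      chartSymmDeriv_self p
    rw [h3, tmap_comp (V' := EP) (f := φ.symm) (Q.smoothNear_act_left _ _).mdifferentiableAt
      (smoothNear_extChartAt_symm hz0).mdifferentiableAt, h2, h6] at h1
    have h5 := congrArg (fun L : EP →L[ℝ] EP => L v) h1
    have h7 : φ.symm (φ p) = p := extChartAt_to_inv p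
    rw [pullForm, comp_one_apply]
    change A.form (f (φ p, w)) ![((tmap f (φ p, w)).comp (ContinuousLinearMap.inl ℝ EP EG)) v] = _
    rw [← h5]
    change A.form (Q.act (φ.symm (φ p)) g) ![tmap (fun q => Q.act q g) (φ.symm (φ p)) v] = 0
    rw [h7, A.equivariant, ← A.lin_apply, hv, map_zero]
  have hsm : SmoothFormAt A.form (f (φ p, ψ 1)) := isSmoothForm_iff.1 A.smooth _
  have hd : DifferentiableAt ℝ (pullForm f A.form : EP × EG → (EP × EG) [⋀^Fin 1]→L[ℝ] EG)
    (φ p, ψ 1) := (SmoothFormAt.pull_flat hf hsm).differentiableAt (by simp)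
  have hev : ∀ u : EP × EG, DifferentiableAt ℝ (fun z => pullForm (V := EP × EG) f A.form z ![u]) (φ p, ψ 1) :=
    fun u => hd.continuousAlternatingMap_apply_const _
  have key := extDeriv_one_apply hd ((0, X) : EP × EG) (v, 0)
  have e1 : fderiv ℝ (fun z => pullForm (V := EP × EG) f A.form z ![((v, 0) : EP × EG)]) (φ p, ψ 1) (0, X) = 0 := by
    refine fderiv_apply_eq_zero (hev _) ?_
    have hc : ContinuousAt (fun t : ℝ => ψ 1 + t • X) 0 := by fun_prop
    have hc' := hc.eventually (p := fun w => pullForm (V := EP × EG) f A.form (φ p, w) ![((v, 0) : EP × EG)] = 0)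
      (by simpa using hP)
    filter_upwards [hc'] with t ht
    rw [hP.self_of_nhds]
    simpa using ht
  have e2 : fderiv ℝ (fun z => pullForm (V := EP × EG) f A.form z ![((0, X) : EP × EG)]) (φ p, ψ 1) (v, 0) = 0 := by
    refine fderiv_apply_eq_zero (hev _) ?_
    have hc : ContinuousAt (fun t : ℝ => (φ p, ψ 1) + t • ((v, 0) : EP × EG)) 0 := by fun_prop
    have hc' := hc.eventually (p := fun z => pullForm (V := EP × EG) f A.form z ![((0, X) : EP × EG)] =
      tmap (fun h : G => (ψ.symm z.2)⁻¹ * h) (ψ.symm z.2) (tmap ψ.symm z.2 X : EG))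
      (by simpa using hG)
    filter_upwards [hc'] with t ht
    rw [hG.self_of_nhds, ht]
    simp
  rw [e1, e2, sub_zero, extDeriv_pullForm hf hsm, comp_two_apply, hf0] at key
  -- identify the images of the two vectors
  have i1 : (tmap f (φ p, ψ 1) ((0, X) : EP × EG) : EP) = Q.vert p X := by
    have hj : SmoothNear EG (EP × EG) (fun w : EG => (φ p, w)) (ψ 1) :=
      ContMDiff.smoothNear (contDiff_const.prodMk contDiff_id).contMDiff _
    have h1 := tmap_comp (V'' := EP) (g := f) (f := fun w : EG => (φ p, w)) (x := ψ 1)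
      hf.mdifferentiableAt hj.mdifferentiableAt
    have h2 : (tmap (fun w : EG => (φ p, w)) (ψ 1) : EG →L[ℝ] EP × EG) =
      ContinuousLinearMap.inr ℝ EP EG := by
      rw [tmap_eq_fderiv]; exact (hasFDerivAt_prodMk_right (φ p) (ψ 1)).fderiv
    have h3 : f ∘ (fun w : EG => (φ p, w)) = (fun g => Q.act p g) ∘ ψ.symm := by
      ext w; simp only [Function.comp_apply, f, hφ, extChartAt_to_inv]
    have h6 : (tmap ψ.symm (ψ 1) : EG →L[ℝ] EG) = ContinuousLinearMap.id ℝ EG :=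
      chartSymmDeriv_self (1 : G)
    have h7 : ψ.symm (ψ 1) = 1 := extChartAt_to_inv (1 : G)
    rw [h3, tmap_comp (V' := EG) (f := ψ.symm) (Q.smoothNear_act_right _ _).mdifferentiableAt
      (smoothNear_extChartAt_symm hw0).mdifferentiableAt, h2, h6, h7] at h1
    exact (congrArg (fun L : EG →L[ℝ] EP => L X) h1).symm
  have i2 : (tmap f (φ p, ψ 1) ((v, 0) : EP × EG) : EP) = v := by
    have hj : SmoothNear EP (EP × EG) (fun z : EP => (z, ψ 1)) (φ p) :=
      ContMDiff.smoothNear (contDiff_id.prodMk contDiff_const).contMDiff _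
    have h1 := tmap_comp (V'' := EP) (g := f) (f := fun z : EP => (z, ψ 1)) (x := φ p)
      hf.mdifferentiableAt hj.mdifferentiableAt
    have h2 : (tmap (fun z : EP => (z, ψ 1)) (φ p) : EP →L[ℝ] EP × EG) =
      ContinuousLinearMap.inl ℝ EP EG := by
      rw [tmap_eq_fderiv]; exact (hasFDerivAt_prodMk_left (φ p) (ψ 1)).fderiv
    have h3 : f ∘ (fun z : EP => (z, ψ 1)) = φ.symm := by
      ext z; simp only [Function.comp_apply, f, hψ, extChartAt_to_inv, Q.act_one]
    have h6 : (tmap φ.symm (φ p) : EP →L[ℝ] EP) = ContinuousLinearMap.id ℝ EP :=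
      chartSymmDeriv_self p
    rw [h3, h2, h6] at h1
    exact (congrArg (fun L : EP →L[ℝ] EP => L v) h1).symm
  rw [i1, i2] at key
  exact key

end Covariant

/-! ### Local sections, the Bianchi identity and the variation of the curvature -/

section Sections

open Filter Topology

variable {E EP EG M P G : Type*}
  [NormedAddCommGroup E] [NormedSpace ℝ E] [FiniteDimensional ℝ E]
  [NormedAddCommGroup EP] [NormedSpace ℝ EP] [FiniteDimensional ℝ EP]
  [NormedAddCommGroup EG] [NormedSpace ℝ EG] [FiniteDimensional ℝ EG]
  [TopologicalSpace M] [ChartedSpace E M] [IsManifold 𝓘(ℝ, E) ∞ M]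
  [TopologicalSpace P] [ChartedSpace EP P] [IsManifold 𝓘(ℝ, EP) ∞ P]
  [TopologicalSpace G] [ChartedSpace EG G] [Group G] [LieGroup 𝓘(ℝ, EG) ∞ G]
  {k : ℕ}

/-- A smooth local section of `P` through `p`, in terms of the coordinate `y ∈ E` of the base
point in the preferred chart at `proj p`. -/
structure LocalSection (Q : PrincipalBundle E EP EG M P G) (p : P) where
  toFun : E → P
  smooth : SmoothNear E EP toFun (Q.base p)
  toFun_base : toFun (Q.base p) = p
  proj_toFun : ∀ᶠ y in 𝓝 (Q.base p),
    Q.proj (toFun y) = (extChartAt 𝓘(ℝ, E) (Q.proj p)).symm y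

variable {Q : PrincipalBundle E EP EG M P G}

/-- The expression of an `Ad P`-valued form in the gauge given by a local section. -/
def LocalSection.loc {p : P} (σ : LocalSection Q p) (α : P → E [⋀^Fin k]→L[ℝ] EG) (y : E) :
    E [⋀^Fin k]→L[ℝ] EG :=
  (α (σ.toFun y)).compContinuousLinearMap (chartSymmDeriv (Q.proj p) y)

theorem LocalSection.loc_base {p : P} (σ : LocalSection Q p) (α : P → E [⋀^Fin k]→L[ℝ] EG) :
    σ.loc α (Q.base p) = α p := by
  rw [LocalSection.loc, σ.toFun_base, PrincipalBundle.base, chartSymmDeriv_self]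
  ext v; rfl

theorem LocalSection.dproj_toFun {p : P} (σ : LocalSection Q p) :
    ∀ᶠ y in 𝓝 (Q.base p), ∀ u : E,
      Q.dproj (σ.toFun y) (tmap σ.toFun y u) = chartSymmDeriv (Q.proj p) y u := by
  have hy : Q.base p ∈ (extChartAt 𝓘(ℝ, E) (Q.proj p)).target := mem_extChartAt_target _
  filter_upwards [σ.smooth.eventually, eventually_eventually_nhds.2 σ.proj_toFun] with y h2 h3 u
  have h5 := tmap_comp (V'' := E) (g := Q.proj) (f := σ.toFun) (x := y)
    (Q.smoothNear_proj _).mdifferentiableAt h2.mdifferentiableAt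
  have h6 : Q.proj ∘ σ.toFun =ᶠ[𝓝 y] (extChartAt 𝓘(ℝ, E) (Q.proj p)).symm := h3
  rw [tmap_congr h6] at h5
  exact (congrArg (fun L : E →L[ℝ] E => L u) h5).symm

theorem LocalSection.pullForm_toP {p : P} (σ : LocalSection Q p)
    (α : P → E [⋀^Fin k]→L[ℝ] EG) :
    (pullForm σ.toFun (toP Q α) : E → E [⋀^Fin k]→L[ℝ] EG) =ᶠ[𝓝 (Q.base p)] σ.loc α := by
  filter_upwards [σ.dproj_toFun] with y hy
  ext v
  exact congrArg (α (σ.toFun y)) (funext fun i => hy (v i))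

theorem LocalSection.contDiffAt_loc {p : P} (σ : LocalSection Q p)
    {α : P → E [⋀^Fin k]→L[ℝ] EG} (h : IsAdForm Q α) : ContDiffAt ℝ ∞ (σ.loc α) (Q.base p) :=
  (SmoothFormAt.pull_flat σ.smooth (isSmoothForm_iff.1 h.smooth _)).congr_of_eventuallyEq
    (σ.pullForm_toP α).symm

/-- The section is tangent at `p` to the horizontal space. -/
def LocalSection.Horizontal {p : P} (σ : LocalSection Q p) (A : Connection Q) : Prop :=
  tmap σ.toFun (Q.base p) = horLift Q A.form p

/-- In a gauge which is horizontal at `p`, the covariant derivative at `p` is the exterior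
derivative. -/
theorem LocalSection.Horizontal.extDeriv_loc {p : P} {σ : LocalSection Q p} {A : Connection Q}
    (hσ : σ.Horizontal A) {α : P → E [⋀^Fin k]→L[ℝ] EG} (h : IsAdForm Q α) :
    extDeriv (σ.loc α) (Q.base p) = covD Q A.form α p := by
  rw [← (σ.pullForm_toP α).extDeriv_eq, extDeriv_pullForm σ.smooth (isSmoothForm_iff.1 h.smooth _),
    σ.toFun_base, covD, hσ]

/-- The section `y ↦ (y, L (y - base p))` in adapted coordinates. -/
def AdaptedCoord.sectionOf {p : P} (c : AdaptedCoord Q p) (L : E →L[ℝ] EG) : LocalSection Q p where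
  toFun y := c.toFun (y, L (y - Q.base p))
  smooth := by
    have h : SmoothNear E (E × EG) (fun y => (y, L (y - Q.base p))) (Q.base p) :=
      ContMDiff.smoothNear (contDiff_id.prodMk
        (L.contDiff.comp (contDiff_id.sub contDiff_const))).contMDiff _
    refine SmoothNear.comp (V' := E × EG) (g := c.toFun) ?_ h
    simpa using c.smooth_toFun
  toFun_base := by simpa using c.toFun_base
  proj_toFun := by
    have h : ContinuousAt (fun y => (y, L (y - Q.base p))) (Q.base p) := by fun_prop
    exact h.eventually (by simpa using c.proj_toFun)

theorem AdaptedCoord.tendsto_section {p : P} (L : E →L[ℝ] EG) :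
    Tendsto (fun y => (y, L (y - Q.base p))) (𝓝 (Q.base p)) (𝓝 (Q.base p, (0 : EG))) := by
  have h : ContinuousAt (fun y => (y, L (y - Q.base p))) (Q.base p) := by fun_prop
  simpa [ContinuousAt] using h

theorem AdaptedCoord.tmap_sectionOf {p : P} (c : AdaptedCoord Q p) (L : E →L[ℝ] EG) :
    ∀ᶠ y in 𝓝 (Q.base p), ∀ u : E, tmap (c.sectionOf L).toFun y u =
      (tmap c.toFun (y, L (y - Q.base p)) ((u, L u) : E × EG) : EP) := by
  filter_upwards [(AdaptedCoord.tendsto_section L).eventually c.smooth_toFun.eventually] with y hy u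
  have h : SmoothNear E (E × EG) (fun y => (y, L (y - Q.base p))) y :=
    ContMDiff.smoothNear (contDiff_id.prodMk
      (L.contDiff.comp (contDiff_id.sub contDiff_const))).contMDiff _
  have h1 := tmap_comp (V'' := EP) (g := c.toFun) (f := fun y => (y, L (y - Q.base p))) (x := y)
    hy.mdifferentiableAt h.mdifferentiableAt
  have h2 : (tmap (fun y => (y, L (y - Q.base p))) y : E →L[ℝ] E × EG) =
      (ContinuousLinearMap.id ℝ E).prod L := by
    rw [tmap_eq_fderiv]
    exact ((hasFDerivAt_id y).prodMk
      (L.hasFDerivAt.comp y ((hasFDerivAt_id y).sub_const (Q.base p)))).fderiv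
  rw [h2] at h1
  exact congrArg (fun L : E →L[ℝ] EP => L u) h1

theorem AdaptedCoord.horizontal_sectionOf {p : P} (c : AdaptedCoord Q p) (A : Connection Q)
    {L : E →L[ℝ] EG}
    (hL : ∀ u : E, horLift Q A.form p u = (tmap c.toFun (Q.base p, 0) ((u, L u) : E × EG) : EP)) :
    (c.sectionOf L).Horizontal A := by
  ext u
  have h := (c.tmap_sectionOf L).self_of_nhds u
  rw [sub_self, map_zero] at h
  rw [hL, h]

theorem AdaptedCoord.horLift_base {p : P} (c : AdaptedCoord Q p) (A : Connection Q)
    {L : E × EG → E →L[ℝ] EG} (hL : ∀ᶠ z in 𝓝 (Q.base p, (0 : EG)), ∀ u : E,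
        horLift Q A.form (c.toFun z) (chartSymmDeriv (Q.proj p) z.1 u) =
          tmap c.toFun z (u, L z u)) (u : E) :
    horLift Q A.form p u = (tmap c.toFun (Q.base p, 0) ((u, L (Q.base p, 0) u) : E × EG) : EP) := by
  have h := hL.self_of_nhds u
  rw [c.toFun_base, PrincipalBundle.base, chartSymmDeriv_self] at h
  exact h

theorem Connection.exists_horizontal (A : Connection Q) (p : P) :
    ∃ σ : LocalSection Q p, σ.Horizontal A := by
  obtain ⟨c⟩ := AdaptedCoord.nonempty Q p
  obtain ⟨L, -, hL'⟩ := c.exists_horLift A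
  exact ⟨c.sectionOf (L (Q.base p, 0)), c.horizontal_sectionOf A (c.horLift_base A hL')⟩

theorem LocalSection.nonempty (p : P) : Nonempty (LocalSection Q p) := by
  obtain ⟨c⟩ := AdaptedCoord.nonempty Q p
  exact ⟨c.sectionOf 0⟩

/-- The Bianchi identity. In a gauge which is horizontal at `p` the curvature differs from an exact
form by a term vanishing to second order. -/
theorem Connection.covD_curvature (A : Connection Q) : covD Q A.form (curvature Q A.form) = 0 := by
  ext1 p
  obtain ⟨c⟩ := AdaptedCoord.nonempty Q p
  obtain ⟨L, hLs, hL⟩ := c.exists_horLift A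
  set L0 := L (Q.base p, 0) with hL0
  set σ := c.sectionOf L0 with hσdef
  have hσ : σ.Horizontal A := c.horizontal_sectionOf A (c.horLift_base A hL)
  have hF := A.isAdForm_curvature
  rw [← hσ.extDeriv_loc hF]
  let s : E → E × EG := fun y => (y, L0 (y - Q.base p))
  have hs0 : s (Q.base p) = (Q.base p, 0) := by simp [s]
  have hssm : ContDiff ℝ ∞ s :=
    contDiff_id.prodMk (L0.contDiff.comp (contDiff_id.sub contDiff_const))
  -- `N` measures the failure of `σ` to be horizontal away from `p`.
  let N : E → E →L[ℝ] EG := fun y => L (s y) - L0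
  have hN : ContDiffAt ℝ ∞ N (Q.base p) :=
    (ContDiffAt.comp (g := L) (Q.base p) (by rw [hs0]; exact hLs)
      hssm.contDiffAt).sub contDiffAt_const
  have hN0 : N (Q.base p) = 0 := by simp only [N, hs0, ← hL0, sub_self]
  let b : E → (E × EG) [⋀^Fin 2]→L[ℝ] EG := fun y =>
    pullForm (V := E × EG) c.toFun (extD A.form) (s y)
  have hb : ContDiffAt ℝ ∞ b (Q.base p) := by
    refine ContDiffAt.comp (g := pullForm (V := E × EG) c.toFun (extD A.form)) (Q.base p) ?_
      hssm.contDiffAt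
    rw [hs0]
    exact SmoothFormAt.pull_flat c.smooth_toFun (isSmoothForm_iff.1 A.smooth.extD _)
  let a : E → E [⋀^Fin 1]→L[ℝ] EG := pullForm σ.toFun A.form
  have ha : ContDiffAt ℝ ∞ a (Q.base p) :=
    SmoothFormAt.pull_flat σ.smooth (isSmoothForm_iff.1 A.smooth _)
  have hda : ContDiffAt ℝ ∞ (extDeriv a) (Q.base p) := contDiffAt_extDeriv ha
  -- `R` is quadratic in `N`, which vanishes at `p`; hence `dR = 0` at `p`.
  let R : E → E [⋀^Fin 2]→L[ℝ] EG := fun y =>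
    (b y).compContinuousLinearMap ((ContinuousLinearMap.inr ℝ E EG).comp (N y))
  have hR : ContDiffAt ℝ ∞ R (Q.base p) :=
    contDiffAt_form_comp hb (contDiffAt_const.clm_comp hN)
  have hmain : σ.loc (curvature Q A.form) =ᶠ[𝓝 (Q.base p)] fun y => extDeriv a y + -R y := by
    have ht := AdaptedCoord.tendsto_section (Q := Q) (p := p) L0
    filter_upwards [σ.smooth.eventually, c.tmap_sectionOf L0, ht.eventually hL,
      ht.eventually c.dproj_toFun] with y h1 h2 h3 h4
    refine form_two_ext fun u v => ?_
    have e1 : extDeriv a y = (extD A.form (σ.toFun y)).compContinuousLinearMap (tmap σ.toFun y) :=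
      extDeriv_pullForm h1 (isSmoothForm_iff.1 A.smooth _)
    have e2 : ∀ w : E, horLift Q A.form (σ.toFun y) (chartSymmDeriv (Q.proj p) y w) =
        tmap σ.toFun y w + (tmap c.toFun (s y) ((0, N y w) : E × EG) : EP) := by
      intro w
      rw [h2 w]
      refine (h3 w).trans ?_
      rw [← map_add]
      congr 1
      simp [N, s]
    have e3 : ∀ w : E, ∃ X : EG,
        Q.vert (σ.toFun y) X = (tmap c.toFun (s y) ((0, N y w) : E × EG) : EP) := by
      intro w
      refine Q.exists_vert_eq ?_
      have := h4 (0, N y w)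
      rw [map_zero] at this
      exact this
    obtain ⟨X, hX⟩ := e3 u
    obtain ⟨Y, hY⟩ := e3 v
    have e4 : σ.loc (curvature Q A.form) y ![u, v] = extD A.form (σ.toFun y)
        ![horLift Q A.form (σ.toFun y) (chartSymmDeriv (Q.proj p) y u),
          horLift Q A.form (σ.toFun y) (chartSymmDeriv (Q.proj p) y v)] := by
      rw [LocalSection.loc, comp_two_apply, curvature, comp_two_apply]
    have e5 : R y ![u, v] = extD A.form (σ.toFun y) ![Q.vert (σ.toFun y) X,
        Q.vert (σ.toFun y) Y] := by
      rw [hX, hY, comp_two_apply]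
      exact comp_two_apply _ _ _ _
    have e6 : ∀ w, tmap σ.toFun y w =
        horLift Q A.form (σ.toFun y) (chartSymmDeriv (Q.proj p) y w) +
          -(tmap c.toFun (s y) ((0, N y w) : E × EG) : EP) := by
      intro w; rw [e2 w, add_neg_cancel_right]
    have e7 : ∀ w X, extD A.form (σ.toFun y) ![Q.vert (σ.toFun y) X,
        horLift Q A.form (σ.toFun y) (chartSymmDeriv (Q.proj p) y w)] = 0 := fun w X =>
      A.extD_vert_horizontal (A.lin_horLift _ _) X
    have e8 : ∀ w X, extD A.form (σ.toFun y)
        ![horLift Q A.form (σ.toFun y) (chartSymmDeriv (Q.proj p) y w),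
          Q.vert (σ.toFun y) X] = 0 := fun w X => by rw [form_two_swap, e7, neg_zero]
    rw [ContinuousAlternatingMap.add_apply, ContinuousAlternatingMap.neg_apply, e4, e5, e1,
      comp_two_apply, e6 u, e6 v, ← hX, ← hY]
    simp only [form_two_add_left, form_two_add_right, form_two_neg_left, form_two_neg_right, e7, e8]
    simp
  rw [hmain.extDeriv_eq]
  have hd1 : DifferentiableAt ℝ (extDeriv a) (Q.base p) := hda.differentiableAt (by simp)
  have hd2 : DifferentiableAt ℝ R (Q.base p) := hR.differentiableAt (by simp)
  have h1 := extDeriv_fun_add hd1 (ω₂ := fun y => -R y) hd2.neg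
  rw [h1, extDeriv_extDeriv_apply ha
    (by simpa using (WithTop.coe_le_coe.2 le_top : ((2 : ℕ∞) : WithTop ℕ∞) ≤ ∞))]
  -- the derivative of `R` at the base point vanishes
  have h2 : fderiv ℝ R (Q.base p) = 0 := by
    ext w v
    have hg : DifferentiableAt ℝ (fun y => (ContinuousLinearMap.inr ℝ E EG).comp (N y))
      (Q.base p) := (ContDiffAt.clm_comp contDiffAt_const hN).differentiableAt (n := ∞) (by simp)
    have h3 : (fun y => R y v) = fun y => b y
      (fun i => (ContinuousLinearMap.inr ℝ E EG).comp (N y) (v i)) := rfl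
    have h5 := (fderiv_continuousAlternatingMap_apply_const_apply hd2 v w).symm
    rw [h5, h3]
    have hbd : DifferentiableAt ℝ b (Q.base p) := hb.differentiableAt (by simp)
    rw [fderiv_continuousAlternatingMap_apply_apply hbd
      (fun i => hg.clm_apply (differentiableAt_const (v i)))]
    have hz : ∀ i, (ContinuousLinearMap.inr ℝ E EG).comp (N (Q.base p)) (v i) = 0 := by
      intro i; rw [hN0]; simp
    have hz' : (fun i => (ContinuousLinearMap.inr ℝ E EG).comp (N (Q.base p)) (v i)) = 0 :=
      funext hz
    rw [hz', ContinuousAlternatingMap.map_zero, zero_add]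
    refine Finset.sum_eq_zero fun i _ => ?_
    refine (b (Q.base p)).map_coord_zero (i + 1) ?_
    rw [Function.update_of_ne (by fin_cases i <;> decide)]
    rfl
  rw [extDeriv, fderiv_fun_neg, h2, neg_zero, zero_add]
  exact (ContinuousAlternatingMap.alternatizeUncurryFinCLM ℝ E EG).map_zero

/-! ### The affine line of connections `A + t η` -/

theorem form_two_shift {V W : Type*} [NormedAddCommGroup V] [NormedSpace ℝ V]
    [NormedAddCommGroup W] [NormedSpace ℝ W] {α β : V [⋀^Fin 2]→L[ℝ] W} {a b a' b' : V}
    (h1 : α ![a', b] = 0) (h2 : α ![a, b'] = 0) (t : ℝ) :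
    (α + t • β) ![a + (-t) • a', b + (-t) • b'] = α ![a, b] + t • β ![a, b] +
      t ^ 2 • (α ![a', b'] - β ![a', b] - β ![a, b']) + t ^ 3 • β ![a', b'] := by
  simp only [ContinuousAlternatingMap.add_apply, ContinuousAlternatingMap.smul_apply,
    form_two_add_left, form_two_add_right, form_two_smul_left, form_two_smul_right, h1, h2]
  module

/-- The connection `A + t η`. -/
def Connection.shift (A : Connection Q) {η : P → E [⋀^Fin 1]→L[ℝ] EG} (hη : IsAdForm Q η) (t : ℝ) :
    Connection Q where
  form := A.form + t • toP Q η
  smooth := isSmoothForm_iff.2 fun x =>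
    (isSmoothForm_iff.1 A.smooth x).add ((isSmoothForm_iff.1 hη.smooth x).smul t)
  vertical p X := by
    have h : toP Q η p ![Q.vert p X] = 0 := by
      rw [toP, comp_one_apply]
      refine (η p).map_coord_zero 0 ?_
      exact Q.dproj_vert p X
    have h2 := A.vertical p X
    change A.form p ![Q.vert p X] + t • toP Q η p ![Q.vert p X] = X
    rw [h, smul_zero, add_zero]
    exact h2
  equivariant p g v := by
    have h := congrArg (fun (γ : P → EP [⋀^Fin 1]→L[ℝ] EG) => γ p ![v]) (hη.isEquivariantForm g)
    simp only [pullForm, comp_one_apply] at h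
    change A.form (Q.act p g) ![_] + t • toP Q η (Q.act p g) ![_] =
      Ad EG g⁻¹ (A.form p ![v] + t • toP Q η p ![v])
    rw [A.equivariant, h, map_add, map_smul]
    rfl

theorem Connection.horLift_shift (A : Connection Q) {η : P → E [⋀^Fin 1]→L[ℝ] EG}
    (hη : IsAdForm Q η) (t : ℝ) (p : P) (u : E) :
    horLift Q (A.form + t • toP Q η) p u =
      horLift Q A.form p u + (-t) • Q.vert p (η p ![u]) := by
  refine ((A.shift hη t).horLift_unique ?_ ?_).symm
  · rw [map_add, map_smul, A.dproj_horLift, Q.dproj_vert, smul_zero, add_zero]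
  · rw [map_add, map_smul, (A.shift hη t).lin_vert]
    have h1 : (A.shift hη t).lin p (horLift Q A.form p u) =
        A.lin p (horLift Q A.form p u) + t • toP Q η p ![horLift Q A.form p u] := by
      rw [Connection.lin_apply, Connection.lin_apply]; rfl
    rw [h1, A.lin_horLift, toP, comp_one_apply]
    have h2 : (tmap Q.proj p (horLift Q A.form p u) : E) = u := A.dproj_horLift p u
    rw [h2, zero_add, neg_smul, add_neg_cancel]

/-- The curvature of `A + t η` is a polynomial in `t`, with linear term `t d_A η`. -/
theorem Connection.exists_curvature_shift (A : Connection Q) {η : P → E [⋀^Fin 1]→L[ℝ] EG}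
    (hη : IsAdForm Q η) : ∃ a b : P → E [⋀^Fin 2]→L[ℝ] EG, IsAdForm Q a ∧ IsAdForm Q b ∧
      ∀ t : ℝ, curvature Q (A.form + t • toP Q η) =
        curvature Q A.form + t • covD Q A.form η + t ^ 2 • a + t ^ 3 • b := by
  let F : ℝ → P → E [⋀^Fin 2]→L[ℝ] EG := fun t => curvature Q (A.form + t • toP Q η)
  have hF : ∀ t, IsAdForm Q (F t) := fun t => (A.shift hη t).isAdForm_curvature
  have hF0 : F 0 = curvature Q A.form := by simp [F]
  -- On a pair of vectors, expand `d(A + t η)` on the shifted horizontal lifts `U - t η(u)`,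
  -- `V - t η(v)`. The mixed terms of `dA` vanish, so the linear term is `d_A η`.
  have key : ∀ (p : P) (u v : E), ∃ x y : EG, ∀ t : ℝ, F t p ![u, v] =
      curvature Q A.form p ![u, v] + t • covD Q A.form η p ![u, v] + t ^ 2 • x + t ^ 3 • y := by
    intro p u v
    set α := extD A.form p with hα
    set β := extD (toP Q η) p with hβ
    set U := horLift Q A.form p u with hU
    set V := horLift Q A.form p v with hV
    set U' := Q.vert p (η p ![u]) with hU'
    set V' := Q.vert p (η p ![v]) with hV'
    have h1 : α ![U', V] = 0 := A.extD_vert_horizontal (A.lin_horLift _ _) _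
    have h2 : α ![U, V'] = 0 := by
      rw [form_two_swap, A.extD_vert_horizontal (A.lin_horLift _ _), neg_zero]
    refine ⟨α ![U', V'] - β ![U', V] - β ![U, V'], β ![U', V'], fun t => ?_⟩
    have h3 : F t p ![u, v] = (α + t • β) ![U + (-t) • U', V + (-t) • V'] := by
      refine (comp_two_apply _ _ u v).trans ?_
      rw [A.horLift_shift hη, A.horLift_shift hη,
        extD_add (isSmoothForm_iff.1 A.smooth p) ((isSmoothForm_iff.1 hη.smooth p).smul t),
        extD_smul]
    have h4 : curvature Q A.form p ![u, v] = α ![U, V] := comp_two_apply _ _ _ _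
    have h5 : covD Q A.form η p ![u, v] = β ![U, V] := comp_two_apply _ _ _ _
    rw [h3, h4, h5]
    exact form_two_shift h1 h2 t
  have hD := hη.covD A
  have hlin : ∀ (f g : P → E [⋀^Fin 2]→L[ℝ] EG) (r s : ℝ), IsAdForm Q f → IsAdForm Q g →
      IsAdForm Q (r • f + s • g) := by
    intro f g r s hf hg
    refine ⟨fun p h v => ?_, isSmoothForm_iff.2 fun p => ?_⟩
    · simp only [Pi.add_apply, Pi.smul_apply, ContinuousAlternatingMap.add_apply,
        ContinuousAlternatingMap.smul_apply, hf.equivariant, hg.equivariant, map_add, map_smul]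
    · exact ((isSmoothForm_iff.1 hf.smooth p).smul r).add ((isSmoothForm_iff.1 hg.smooth p).smul s)
  -- The higher coefficients are combinations of the curvatures at `t = -1, 0, 1` and of `d_A η`,
  -- which shows that they are smooth `Ad`-valued forms.
  refine ⟨(1 : ℝ) • ((1 / 2 : ℝ) • F 1 + (1 / 2 : ℝ) • F (-1)) + (-1 : ℝ) • F 0,
    (1 : ℝ) • ((1 / 2 : ℝ) • F 1 + (-1 / 2 : ℝ) • F (-1)) + (-1 : ℝ) • covD Q A.form η,
    hlin _ _ _ _ (hlin _ _ _ _ (hF 1) (hF (-1))) (hF 0),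
    hlin _ _ _ _ (hlin _ _ _ _ (hF 1) (hF (-1))) hD, fun t => ?_⟩
  ext1 p
  refine form_two_ext fun u v => ?_
  obtain ⟨x, y, h⟩ := key p u v
  change F t p ![u, v] = _
  simp only [Pi.add_apply, Pi.smul_apply, ContinuousAlternatingMap.add_apply,
    ContinuousAlternatingMap.smul_apply, h]
  module

end Sections

/-! ### Contractions of forms with a matrix -/

section Contraction

open Filter Topology

variable {V : Type*} [NormedAddCommGroup V] [NormedSpace ℝ V] [FiniteDimensional ℝ V]
  {V' : Type*} [NormedAddCommGroup V'] [NormedSpace ℝ V'] [FiniteDimensional ℝ V']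
  {W₁ W₂ W₃ : Type*} [NormedAddCommGroup W₁] [NormedSpace ℝ W₁] [FiniteDimensional ℝ W₁]
  [NormedAddCommGroup W₂] [NormedSpace ℝ W₂] [FiniteDimensional ℝ W₂] [NormedAddCommGroup W₃] [NormedSpace ℝ W₃]
  {ι ι' : Type*} [Fintype ι] [Fintype ι'] {k : ℕ}

/-- The contraction `H^{i₁ j₁} ⋯ H^{i_k j_k} b(α_{i₁ … i_k}, β_{j₁ … j_k})` of two forms with a
bilinear pairing `b` of their values. -/
def contr (e : Module.Basis ι ℝ V) (H : Matrix ι ι ℝ) (b : W₁ →L[ℝ] W₂ →L[ℝ] W₃)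
    (α : V [⋀^Fin k]→L[ℝ] W₁) (β : V [⋀^Fin k]→L[ℝ] W₂) : W₃ :=
  ∑ I : Fin k → ι, ∑ J : Fin k → ι, (∏ l, H (I l) (J l)) •
    b (α fun l => e (I l)) (β fun l => e (J l))

theorem prod_mul_mul_transpose [DecidableEq ι] [DecidableEq ι'] (c c' : Matrix ι' ι ℝ)
    (H : Matrix ι ι ℝ) (I J : Fin k → ι') :
    ∏ l, (c * H * c'.transpose) (I l) (J l) = ∑ A : Fin k → ι, ∑ D : Fin k → ι,
      (∏ l, H (A l) (D l)) * ((∏ l, c (I l) (A l)) * ∏ l, c' (J l) (D l)) := by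
  have h : ∀ l, (c * H * c'.transpose) (I l) (J l) =
      ∑ q : ι × ι, H q.1 q.2 * (c (I l) q.1 * c' (J l) q.2) := by
    intro l
    rw [Fintype.sum_prod_type]
    simp only [Matrix.mul_apply, Finset.sum_mul, Matrix.transpose_apply]
    rw [Finset.sum_comm]
    exact Finset.sum_congr rfl fun _ _ => Finset.sum_congr rfl fun _ _ => by ring
  simp_rw [h]
  rw [Finset.prod_univ_sum, Fintype.piFinset_univ, ← Fintype.sum_prod_type',
    ← (Equiv.arrowProdEquivProdArrow (Fin k) (fun _ => ι) (fun _ => ι)).sum_comp]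
  refine Finset.sum_congr rfl fun x _ => ?_
  simp [Equiv.arrowProdEquivProdArrow, Finset.prod_mul_distrib]

/-- Contractions of pull-backs. -/
theorem contr_comp [DecidableEq ι] [DecidableEq ι'] (e : Module.Basis ι ℝ V)
    (e' : Module.Basis ι' ℝ V') (H : Matrix ι ι ℝ)
    (b : W₁ →L[ℝ] W₂ →L[ℝ] W₃) (C C' : V →L[ℝ] V') (α : V' [⋀^Fin k]→L[ℝ] W₁)
    (β : V' [⋀^Fin k]→L[ℝ] W₂) :
    contr e H b (α.compContinuousLinearMap C) (β.compContinuousLinearMap C') =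
      contr e' (LinearMap.toMatrix e e' C.toLinearMap * H *
        (LinearMap.toMatrix e e' C'.toLinearMap).transpose) b α β := by
  have hα : ∀ I : Fin k → ι, α.compContinuousLinearMap C (fun l => e (I l)) =
      ∑ A : Fin k → ι', (∏ l, LinearMap.toMatrix e e' C.toLinearMap (A l) (I l)) •
        α fun l => e' (A l) := fun I => by
    refine (form_apply_eq_sum e' α fun l => C (e (I l))).trans ?_
    simp [LinearMap.toMatrix_apply]
  have hβ : ∀ I : Fin k → ι, β.compContinuousLinearMap C' (fun l => e (I l)) =
      ∑ A : Fin k → ι', (∏ l, LinearMap.toMatrix e e' C'.toLinearMap (A l) (I l)) •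
        β fun l => e' (A l) := fun I => by
    refine (form_apply_eq_sum e' β fun l => C' (e (I l))).trans ?_
    simp [LinearMap.toMatrix_apply]
  simp only [contr, hα, hβ, prod_mul_mul_transpose, map_sum, sum_apply,
    map_smul, smul_apply, Finset.smul_sum, Finset.sum_smul, smul_smul]
  simp only [← Fintype.sum_prod_type']
  refine Fintype.sum_equiv
    { toFun := fun x => ⟨x.2.2.2, x.2.2.1, x.1, x.2.1⟩
      invFun := fun x => ⟨x.2.2.1, x.2.2.2, x.2.1, x.1⟩
      left_inv := fun _ => rfl, right_inv := fun _ => rfl } _ _ fun x => ?_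
  simp only [Equiv.coe_fn_mk]
  congr 1
  ring

theorem contr_zero (e : Module.Basis ι ℝ V) (H : Matrix ι ι ℝ) (b : W₁ →L[ℝ] W₂ →L[ℝ] W₃)
    (α : V [⋀^Fin 0]→L[ℝ] W₁) (β : V [⋀^Fin 0]→L[ℝ] W₂) : contr e H b α β = b (α 0) (β 0) := by
  simp only [contr, Finset.univ_unique, Finset.sum_singleton, Finset.univ_eq_empty,
    Finset.prod_empty, one_smul]
  congr 2 <;> · congr 1; exact Subsingleton.elim _ _

theorem contr_one (e : Module.Basis ι ℝ V) (H : Matrix ι ι ℝ) (b : W₁ →L[ℝ] W₂ →L[ℝ] W₃)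
    (α : V [⋀^Fin 1]→L[ℝ] W₁) (β : V [⋀^Fin 1]→L[ℝ] W₂) :
    contr e H b α β = ∑ i, ∑ j, H i j • b (α ![e i]) (β ![e j]) := by
  rw [contr, ← (Equiv.funUnique (Fin 1) ι).symm.sum_comp]
  refine Finset.sum_congr rfl fun i _ => ?_
  rw [← (Equiv.funUnique (Fin 1) ι).symm.sum_comp]
  refine Finset.sum_congr rfl fun j _ => ?_
  simp only [Finset.univ_unique, Finset.prod_singleton]
  congr 1
  congr 2 <;> · congr 1; ext l; fin_cases l; rfl

theorem contr_two (e : Module.Basis ι ℝ V) (H : Matrix ι ι ℝ) (b : W₁ →L[ℝ] W₂ →L[ℝ] W₃)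
    (α : V [⋀^Fin 2]→L[ℝ] W₁) (β : V [⋀^Fin 2]→L[ℝ] W₂) :
    contr e H b α β = ∑ i, ∑ j, ∑ k, ∑ l, (H i k * H j l) •
      b (α ![e i, e j]) (β ![e k, e l]) := by
  rw [contr, ← (finTwoArrowEquiv ι).symm.sum_comp, Fintype.sum_prod_type]
  refine Finset.sum_congr rfl fun i _ => Finset.sum_congr rfl fun j _ => ?_
  rw [← (finTwoArrowEquiv ι).symm.sum_comp, Fintype.sum_prod_type]
  refine Finset.sum_congr rfl fun i' _ => Finset.sum_congr rfl fun j' _ => ?_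
  simp only [Fin.prod_univ_two]
  congr 1
  congr 2 <;> · congr 1; ext l; fin_cases l <;> rfl

theorem contr_add_left (e : Module.Basis ι ℝ V) (H : Matrix ι ι ℝ) (b : W₁ →L[ℝ] W₂ →L[ℝ] W₃)
    (α α' : V [⋀^Fin k]→L[ℝ] W₁) (β : V [⋀^Fin k]→L[ℝ] W₂) :
    contr e H b (α + α') β = contr e H b α β + contr e H b α' β := by
  simp [contr, Finset.sum_add_distrib]

theorem contr_smul_left (e : Module.Basis ι ℝ V) (H : Matrix ι ι ℝ) (b : W₁ →L[ℝ] W₂ →L[ℝ] W₃)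
    (c : ℝ) (α : V [⋀^Fin k]→L[ℝ] W₁) (β : V [⋀^Fin k]→L[ℝ] W₂) :
    contr e H b (c • α) β = c • contr e H b α β := by
  simp [contr, Finset.smul_sum, smul_comm _ c]

theorem contr_flip (e : Module.Basis ι ℝ V) (H : Matrix ι ι ℝ) (b : W₁ →L[ℝ] W₂ →L[ℝ] W₃)
    (α : V [⋀^Fin k]→L[ℝ] W₁) (β : V [⋀^Fin k]→L[ℝ] W₂) :
    contr e H b α β = contr e H.transpose b.flip β α := by
  rw [contr, Finset.sum_comm]
  rfl

theorem contDiffAt_contr {Y : Type*} [NormedAddCommGroup Y] [NormedSpace ℝ Y]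
    {n : WithTop ℕ∞} (e : Module.Basis ι ℝ V) {H : Y → Matrix ι ι ℝ} (b : W₁ →L[ℝ] W₂ →L[ℝ] W₃)
    {α : Y → V [⋀^Fin k]→L[ℝ] W₁} {β : Y → V [⋀^Fin k]→L[ℝ] W₂} {y : Y}
    (hH : ∀ i j, ContDiffAt ℝ n (fun z => H z i j) y) (hα : ContDiffAt ℝ n α y)
    (hβ : ContDiffAt ℝ n β y) : ContDiffAt ℝ n (fun z => contr e (H z) b (α z) (β z)) y := by
  refine ContDiffAt.sum fun I _ => ContDiffAt.sum fun J _ =>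
    ContDiffAt.smul (contDiffAt_prod fun l _ => hH _ _) ?_
  refine ContDiffAt.clm_apply (b.contDiff.contDiffAt.comp y ?_) ?_
  · exact (ContinuousAlternatingMap.apply ℝ V W₁ (fun l => e (I l))).contDiff.contDiffAt.comp y hα
  · exact (ContinuousAlternatingMap.apply ℝ V W₂ (fun l => e (J l))).contDiff.contDiffAt.comp y hβ

/-- The contraction with a positive definite matrix is positive semidefinite: in an orthonormal
basis it is a sum of squares. -/
theorem contr_self_nonneg [DecidableEq ι] (e : Module.Basis ι ℝ V) {H : Matrix ι ι ℝ}
    (hH : H.PosDef) (b : W₁ →L[ℝ] W₁ →L[ℝ] ℝ) (hb : ∀ X, 0 ≤ b X X)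
    (α : V [⋀^Fin k]→L[ℝ] W₁) : 0 ≤ contr e H b α α := by
  obtain ⟨c, hc⟩ : ∃ c : Matrix ι ι ℝ, H = c.transpose * 1 * c.transpose.transpose := by
    open scoped MatrixOrder in
    obtain ⟨c, hc⟩ := CStarAlgebra.nonneg_iff_eq_star_mul_self.mp hH.posSemidef.nonneg
    refine ⟨c, ?_⟩
    rw [hc, Matrix.mul_one, Matrix.transpose_transpose, Matrix.star_eq_conjTranspose,
      Matrix.conjTranspose_eq_transpose_of_trivial]
  have h := contr_comp e e 1 b (LinearMap.toContinuousLinearMap (Matrix.toLin e e c.transpose))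
    (LinearMap.toContinuousLinearMap (Matrix.toLin e e c.transpose)) α α
  rw [LinearMap.coe_toContinuousLinearMap, LinearMap.toMatrix_toLin, ← hc] at h
  rw [← h]
  refine Finset.sum_nonneg fun I _ => ?_
  rw [Finset.sum_eq_single_of_mem I (Finset.mem_univ I)]
  · simpa using hb _
  · intro D _ hD
    obtain ⟨l, hl⟩ := Function.ne_iff.1 hD.symm
    have h0 : (∏ l, (1 : Matrix ι ι ℝ) (I l) (D l)) = 0 :=
      Finset.prod_eq_zero (Finset.mem_univ l) (Matrix.one_apply_ne hl)
    rw [h0, zero_smul]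

/-- The contraction of a two-form with a bivector. -/
def lam (e : Module.Basis ι ℝ V) (H : Matrix ι ι ℝ) (α : V [⋀^Fin 2]→L[ℝ] W₁) : W₁ :=
  (1 / 2 : ℝ) • ∑ i, ∑ j, H i j • α ![e i, e j]

theorem lam_zero (e : Module.Basis ι ℝ V) (H : Matrix ι ι ℝ) :
    lam e H (0 : V [⋀^Fin 2]→L[ℝ] W₁) = 0 := by simp [lam]

theorem lam_add (e : Module.Basis ι ℝ V) (H : Matrix ι ι ℝ) (α β : V [⋀^Fin 2]→L[ℝ] W₁) :
    lam e H (α + β) = lam e H α + lam e H β := by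
  simp [lam, Finset.sum_add_distrib]

theorem lam_smul (e : Module.Basis ι ℝ V) (H : Matrix ι ι ℝ) (c : ℝ) (α : V [⋀^Fin 2]→L[ℝ] W₁) :
    lam e H (c • α) = c • lam e H α := by
  simp [lam, Finset.smul_sum, smul_comm _ c]

theorem contDiffAt_lam {Y : Type*} [NormedAddCommGroup Y] [NormedSpace ℝ Y]
    {n : WithTop ℕ∞} (e : Module.Basis ι ℝ V) {H : Y → Matrix ι ι ℝ}
    {α : Y → V [⋀^Fin 2]→L[ℝ] W₁} {y : Y}
    (hH : ∀ i j, ContDiffAt ℝ n (fun z => H z i j) y) (hα : ContDiffAt ℝ n α y) :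
    ContDiffAt ℝ n (fun z => lam e (H z) (α z)) y := by
  refine contDiffAt_const.smul (ContDiffAt.sum fun i _ => ContDiffAt.sum fun j _ =>
    ContDiffAt.smul (hH i j) ?_)
  exact (ContinuousAlternatingMap.apply ℝ V W₁ ![e i, e j]).contDiff.contDiffAt.comp y hα

/-- The contraction with a real two-form is the contraction with a bivector. -/
theorem half_contr_lsmul (e : Module.Basis ι ℝ V) [DecidableEq ι] {H Z : Matrix ι ι ℝ}
    (hH : H.IsSymm) {φ : V [⋀^Fin 2]→L[ℝ] ℝ} (hφ : ∀ i j, φ ![e i, e j] = Z i j)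
    (α : V [⋀^Fin 2]→L[ℝ] W₁) :
    (1 / 2 : ℝ) • contr e H (ContinuousLinearMap.lsmul ℝ ℝ) φ α = lam e (H * Z * H) α := by
  rw [contr_two, lam]
  congr 1
  have h : ∀ k l, (H * Z * H) k l = ∑ i, ∑ j, H i k * H j l * Z i j := by
    intro k l
    simp only [Matrix.mul_apply, Finset.sum_mul]
    rw [Finset.sum_comm]
    refine Finset.sum_congr rfl fun i _ => Finset.sum_congr rfl fun j _ => ?_
    rw [hH.apply i k]
    ring
  simp only [h, hφ, ContinuousLinearMap.lsmul_apply, smul_smul, Finset.sum_smul]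
  simp only [← Fintype.sum_prod_type']
  refine Fintype.sum_equiv
    { toFun := fun x => ⟨x.2.2.1, x.2.2.2, x.1, x.2.1⟩
      invFun := fun x => ⟨x.2.2.1, x.2.2.2, x.1, x.2.1⟩
      left_inv := fun _ => rfl, right_inv := fun _ => rfl } _ _ fun x => ?_
  rfl

end Contraction

/-! ### Linear algebra of the Kähler metric -/

section KahlerAlgebra

open Filter Topology

variable {E : Type*} [NormedAddCommGroup E] [NormedSpace ℂ E] [FiniteDimensional ℂ E]
  {M : Type*} [TopologicalSpace M] [ChartedSpace E M] [IsManifold 𝓘(ℂ, E) ω M]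

instance finiteDimensional_real : FiniteDimensional ℝ E := FiniteDimensional.complexToReal E

theorem mulC_apply (z : ℂ) (v : E) : mulC z v = z • v := rfl

/-- The matrix of the complex structure. -/
def cplx (E : Type*) [NormedAddCommGroup E] [NormedSpace ℂ E] [FiniteDimensional ℂ E] :
    Matrix (Fin (Module.finrank ℝ E)) (Fin (Module.finrank ℝ E)) ℝ :=
  LinearMap.toMatrix (realBasis E) (realBasis E) (mulC Complex.I : E →L[ℝ] E).toLinearMap

/-- The Gram matrix of a Hermitian inner product. -/
structure IsHermGram (H : Matrix (Fin (Module.finrank ℝ E)) (Fin (Module.finrank ℝ E)) ℝ) :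
    Prop where
  posDef : H.PosDef
  skew : (cplx E).transpose * H = -(H * cplx E)

theorem cplx_mul_self : cplx E * cplx E = -1 := by
  rw [cplx, ← LinearMap.toMatrix_comp, ← LinearMap.toMatrix_id (realBasis E), ← map_neg]
  congr 1
  ext v
  simp [mulC_apply, smul_smul]

/-- The Poisson bivector of the Kähler form, in terms of the Gram matrix. -/
def bivec (H : Matrix (Fin (Module.finrank ℝ E)) (Fin (Module.finrank ℝ E)) ℝ) :
    Matrix (Fin (Module.finrank ℝ E)) (Fin (Module.finrank ℝ E)) ℝ :=
  H⁻¹ * (cplx E).transpose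

variable {H : Matrix (Fin (Module.finrank ℝ E)) (Fin (Module.finrank ℝ E)) ℝ}

theorem IsHermGram.det_pos (h : IsHermGram (E := E) H) : 0 < H.det := h.posDef.det_pos

theorem IsHermGram.isUnit (h : IsHermGram (E := E) H) : IsUnit H.det := h.det_pos.ne'.isUnit

theorem IsHermGram.symm (h : IsHermGram (E := E) H) : H.IsSymm := by
  have := h.posDef.isHermitian
  rwa [Matrix.IsHermitian, Matrix.conjTranspose_eq_transpose_of_trivial] at this

theorem IsHermGram.inv_symm (h : IsHermGram (E := E) H) : H⁻¹.IsSymm := by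
  rw [Matrix.IsSymm, Matrix.transpose_nonsing_inv, h.symm]

/-- The complex structure is skew with respect to the metric on covectors. -/
theorem IsHermGram.cplx_mul_inv (h : IsHermGram (E := E) H) :
    cplx E * H⁻¹ = -bivec (E := E) H := by
  have := congrArg (fun X => H⁻¹ * X * H⁻¹) h.skew
  simp only [Matrix.mul_neg, Matrix.neg_mul] at this
  rw [← Matrix.mul_assoc H⁻¹ H, Matrix.nonsing_inv_mul _ h.isUnit, Matrix.one_mul,
    ← Matrix.mul_assoc, Matrix.mul_assoc, Matrix.mul_nonsing_inv _ h.isUnit, Matrix.mul_one] at this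
  rw [bivec, this, neg_neg]

theorem IsHermGram.bivec_transpose (h : IsHermGram (E := E) H) :
    (bivec (E := E) H).transpose = -bivec (E := E) H := by
  rw [← h.cplx_mul_inv, bivec, Matrix.transpose_mul, Matrix.transpose_transpose, h.inv_symm]

theorem IsHermGram.bivec_antisymm (h : IsHermGram (E := E) H) (i j) :
    bivec (E := E) H i j = -bivec (E := E) H j i :=
  congrFun (congrFun h.bivec_transpose j) i

/-- The bivector is minus the inverse of the matrix of the Kähler form. -/
theorem IsHermGram.form_mul_bivec (h : IsHermGram (E := E) H) :
    ((cplx E).transpose * H) * bivec (E := E) H = -1 := by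
  rw [bivec, Matrix.mul_assoc, ← Matrix.mul_assoc H, Matrix.mul_nonsing_inv _ h.isUnit,
    Matrix.one_mul, ← Matrix.transpose_mul, cplx_mul_self]
  simp

theorem IsHermGram.bivec_mul_form (h : IsHermGram (E := E) H) :
    bivec (E := E) H * ((cplx E).transpose * H) = -1 := by
  have := h.form_mul_bivec
  rw [← neg_eq_iff_eq_neg, ← Matrix.neg_mul, mul_eq_one_comm] at this
  rw [← this]; simp

variable {W : Type*} [NormedAddCommGroup W] [NormedSpace ℝ W] [FiniteDimensional ℝ W] {k : ℕ}

theorem IsHermGram.lam_eq (h : IsHermGram (E := E) H) {φ : E [⋀^Fin 2]→L[ℝ] ℝ}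
    (hφ : ∀ i j, φ ![realBasis E i, realBasis E j] = ((cplx E).transpose * H) i j)
    (α : E [⋀^Fin 2]→L[ℝ] W) :
    (1 / 2 : ℝ) • contr (realBasis E) H⁻¹ (ContinuousLinearMap.lsmul ℝ ℝ) φ α =
      lam (realBasis E) (bivec (E := E) H) α := by
  rw [half_contr_lsmul _ h.inv_symm hφ, bivec, Matrix.mul_assoc, Matrix.mul_assoc,
    Matrix.mul_nonsing_inv _ h.isUnit, Matrix.mul_one]

theorem isHermGram_of_bilin (h : E →L[ℝ] E →L[ℝ] ℝ) (hs : ∀ v w, h v w = h w v)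
    (hp : ∀ v, v ≠ 0 → 0 < h v v)
    (hJ : ∀ v w, h (mulC Complex.I v) w = -h v (mulC Complex.I w)) :
    IsHermGram (E := E) (Matrix.of fun i j => h (realBasis E i) (realBasis E j)) := by
  have hm : ∀ i, mulC Complex.I (realBasis E i) = ∑ k, cplx E k i • realBasis E k := fun i => by
    conv_lhs => rw [← (realBasis E).sum_repr (mulC Complex.I (realBasis E i))]
    simp [cplx, LinearMap.toMatrix_apply]
  refine ⟨Matrix.PosDef.of_dotProduct_mulVec_pos ?_ fun x hx => ?_, ?_⟩
  · exact Matrix.IsHermitian.ext fun i j => hs _ _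
  · have h1 : (∑ i, x i • realBasis E i) ≠ 0 := fun h0 => hx <| by
      ext i
      exact Fintype.linearIndependent_iff.1 (realBasis E).linearIndependent x h0 i
    refine (hp _ h1).trans_eq ?_
    simp only [dotProduct, Matrix.mulVec, Matrix.of_apply, map_sum, sum_apply, map_smul,
      smul_apply, smul_eq_mul, star_trivial, Finset.mul_sum]
    rw [Finset.sum_comm]
    exact Finset.sum_congr rfl fun i _ => Finset.sum_congr rfl fun j _ => by
      rw [hs]; ring
  · ext i j
    have := hJ (realBasis E i) (realBasis E j)
    rw [hm, hm] at this
    simp only [map_sum, sum_apply, map_smul, smul_apply, smul_eq_mul] at this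
    simp only [Matrix.mul_apply, Matrix.transpose_apply, Matrix.of_apply, Matrix.neg_apply, this]
    simp only [mul_comm]

variable (K : KahlerStructure E M)

/-- The metric on the tangent space at `x`, as a bilinear form on the model space. -/
def metricForm (x : M) : E →L[ℝ] E →L[ℝ] ℝ := K.metric.inner x

theorem metricForm_symm (x : M) (v w : E) : metricForm K x v w = metricForm K x w v :=
  K.metric.symm x v w

theorem metricForm_pos (x : M) {v : E} (hv : v ≠ 0) : 0 < metricForm K x v v :=
  K.metric.pos x v hv

theorem form_eq_metricForm (x : M) (v w : E) :
    K.form x ![v, w] = metricForm K x (mulC Complex.I v) w := K.form_apply x v w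

theorem metricForm_mulC_left (x : M) (v w : E) :
    metricForm K x (mulC Complex.I v) w = -metricForm K x v (mulC Complex.I w) := by
  rw [← form_eq_metricForm, form_two_swap, form_eq_metricForm, metricForm_symm]

/-- The expression of the metric in the preferred chart at `x`. -/
def chartMetric (x : M) (y : E) : E →L[ℝ] E →L[ℝ] ℝ :=
  (metricForm K ((extChartAt 𝓘(ℝ, E) x).symm y)).bilinearComp (chartSymmDeriv x y)
    (chartSymmDeriv x y)

theorem chartGram_eq (x : M) (y : E) : chartGram K x y =
    Matrix.of fun i j => chartMetric K x y (realBasis E i) (realBasis E j) := rfl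

theorem isHermGram_gram (x : M) : IsHermGram (E := E) (gram K x) :=
  isHermGram_of_bilin (metricForm K x) (metricForm_symm K x) (fun _ => metricForm_pos K x)
    (metricForm_mulC_left K x)

/-- The differential of a chart and of its inverse are inverse to each other. -/
theorem tmap_chart_comp_chartSymmDeriv {x : M} {y : E} (hy : y ∈ (extChartAt 𝓘(ℝ, E) x).target) :
    (tmap (extChartAt 𝓘(ℝ, E) x) ((extChartAt 𝓘(ℝ, E) x).symm y) : E →L[ℝ] E).comp
      (chartSymmDeriv x y) = ContinuousLinearMap.id ℝ E := by
  have hs := (extChartAt 𝓘(ℝ, E) x).map_target hy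
  have h := tmap_comp (x := y) (f := (extChartAt 𝓘(ℝ, E) x).symm) (g := extChartAt 𝓘(ℝ, E) x)
    (smoothNear_extChartAt hs).mdifferentiableAt (smoothNear_extChartAt_symm hy).mdifferentiableAt
  rw [tmap_eq_id (extChartAt_comp_symm_self hy)] at h
  exact h.symm

theorem chartSymmDeriv_comp_tmap_chart {x : M} {y : E} (hy : y ∈ (extChartAt 𝓘(ℝ, E) x).target) :
    (chartSymmDeriv x y).comp (tmap (extChartAt 𝓘(ℝ, E) x) ((extChartAt 𝓘(ℝ, E) x).symm y)) =
      ContinuousLinearMap.id ℝ E := by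
  have h := tmap_chart_comp_chartSymmDeriv hy
  have h2 := congrArg ContinuousLinearMap.toLinearMap h
  have := (LinearMap.comp_eq_id_comm ℝ E).1 h2
  ext v
  exact LinearMap.congr_fun this v

theorem chartSymmDeriv_injective {x : M} {y : E} (hy : y ∈ (extChartAt 𝓘(ℝ, E) x).target) :
    Function.Injective (chartSymmDeriv x y : E → E) :=
  Function.LeftInverse.injective fun v =>
    DFunLike.congr_fun (tmap_chart_comp_chartSymmDeriv hy) v

/-- The differentials of holomorphic charts are complex linear. -/
theorem chartSymmDeriv_mulC {x : M} {y : E} (hy : y ∈ (extChartAt 𝓘(ℝ, E) x).target) (z : ℂ)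
    (v : E) : chartSymmDeriv x y (mulC z v) = mulC z (chartSymmDeriv x y v) := by
  set q := (extChartAt 𝓘(ℝ, E) x).symm y with hq
  have h1 : chartSymmDeriv x y = fderiv ℝ (extChartAt 𝓘(ℝ, E) q ∘ (extChartAt 𝓘(ℝ, E) x).symm) y := by
    have h := tmap_comp (x := y) (f := (extChartAt 𝓘(ℝ, E) x).symm) (g := extChartAt 𝓘(ℝ, E) q)
      (smoothNear_extChartAt (mem_extChartAt_source q)).mdifferentiableAt
      (smoothNear_extChartAt_symm hy).mdifferentiableAt
    rw [← hq, tmap_extChartAt_self, tmap_eq_fderiv] at h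
    rw [h]
    rfl
  have h2 : DifferentiableAt ℂ (extChartAt 𝓘(ℝ, E) q ∘ (extChartAt 𝓘(ℝ, E) x).symm) y := by
    have ha : ContMDiffAt 𝓘(ℂ, E) 𝓘(ℂ, E) ω (extChartAt 𝓘(ℂ, E) q) q := contMDiffAt_extChartAt
    have hb : ContMDiffAt 𝓘(ℂ, E) 𝓘(ℂ, E) ω (extChartAt 𝓘(ℂ, E) x).symm y :=
      (contMDiffOn_extChartAt_symm x).contMDiffAt ((isOpen_extChartAt_target x).mem_nhds hy)
    have hc := (ContMDiffAt.comp y (g := extChartAt 𝓘(ℂ, E) q) ha hb).contDiffAt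
    exact hc.differentiableAt (by simp)
  rw [h1, h2.fderiv_restrictScalars ℝ, mulC_apply, mulC_apply]
  exact map_smul (fderiv ℂ (extChartAt 𝓘(ℝ, E) q ∘ (extChartAt 𝓘(ℝ, E) x).symm) y) z v

theorem isHermGram_chartGram {x : M} {y : E} (hy : y ∈ (extChartAt 𝓘(ℝ, E) x).target) :
    IsHermGram (E := E) (chartGram K x y) := by
  have hc : ∀ v w, chartMetric K x y v w = metricForm K ((extChartAt 𝓘(ℝ, E) x).symm y)
    (chartSymmDeriv x y v) (chartSymmDeriv x y w) := fun _ _ => rfl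
  rw [chartGram_eq]
  refine isHermGram_of_bilin (chartMetric K x y) (fun v w => ?_) (fun v hv => ?_) fun v w => ?_
  · rw [hc, hc, metricForm_symm]
  · rw [hc]
    exact metricForm_pos K _ fun h => hv (chartSymmDeriv_injective hy (h.trans (map_zero _).symm))
  · rw [hc, hc, chartSymmDeriv_mulC hy, chartSymmDeriv_mulC hy, metricForm_mulC_left]

theorem chartGram_self (x : M) : chartGram K x (extChartAt 𝓘(ℝ, E) x x) = gram K x := by
  ext i j
  rw [chartGram_eq, chartMetric, chartSymmDeriv_self, extChartAt_to_inv]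
  rfl

/-- The change of basis for the Gram matrix. -/
theorem gramOf_comp (h : E →L[ℝ] E →L[ℝ] ℝ) (C : E →L[ℝ] E) :
    (Matrix.of fun i j => h (C (realBasis E i)) (C (realBasis E j))) =
      (LinearMap.toMatrix (realBasis E) (realBasis E) C.toLinearMap).transpose *
        (Matrix.of fun i j => h (realBasis E i) (realBasis E j)) *
        LinearMap.toMatrix (realBasis E) (realBasis E) C.toLinearMap := by
  have hm : ∀ i, C (realBasis E i) = ∑ k,
      LinearMap.toMatrix (realBasis E) (realBasis E) C.toLinearMap k i • realBasis E k := fun i => by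
    conv_lhs => rw [← (realBasis E).sum_repr (C (realBasis E i))]
    simp [LinearMap.toMatrix_apply]
  ext i j
  simp only [Matrix.mul_apply, Matrix.transpose_apply, Matrix.of_apply]
  rw [hm, hm]
  simp only [map_sum, sum_apply, map_smul, smul_apply, smul_eq_mul, Finset.sum_mul, Finset.mul_sum]
  refine Finset.sum_congr rfl fun i _ => Finset.sum_congr rfl fun j _ => by ring

theorem contr_gram_eq {W₁ W₂ W₃ : Type*} [NormedAddCommGroup W₁] [NormedSpace ℝ W₁]
    [FiniteDimensional ℝ W₁] [NormedAddCommGroup W₂] [NormedSpace ℝ W₂] [FiniteDimensional ℝ W₂]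
    [NormedAddCommGroup W₃] [NormedSpace ℝ W₃] (b : W₁ →L[ℝ] W₂ →L[ℝ] W₃)
    {x : M} {y : E} (hy : y ∈ (extChartAt 𝓘(ℝ, E) x).target)
    (α : E [⋀^Fin k]→L[ℝ] W₁) (β : E [⋀^Fin k]→L[ℝ] W₂) :
    contr (realBasis E) (gram K ((extChartAt 𝓘(ℝ, E) x).symm y))⁻¹ b α β =
      contr (realBasis E) (chartGram K x y)⁻¹ b (α.compContinuousLinearMap (chartSymmDeriv x y))
        (β.compContinuousLinearMap (chartSymmDeriv x y)) := by
  rw [contr_comp (realBasis E) (realBasis E)]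
  congr 1
  set c := LinearMap.toMatrix (realBasis E) (realBasis E)
    (chartSymmDeriv x y).toLinearMap with hc
  set d := LinearMap.toMatrix (realBasis E) (realBasis E)
    (tmap (extChartAt 𝓘(ℝ, E) x) ((extChartAt 𝓘(ℝ, E) x).symm y) : E →L[ℝ] E).toLinearMap with hd
  have hcd : c * d = 1 := by
    rw [hc, hd, ← LinearMap.toMatrix_comp, ← LinearMap.toMatrix_id (realBasis E)]
    congr 1
    exact congrArg ContinuousLinearMap.toLinearMap (chartSymmDeriv_comp_tmap_chart hy)
  have hG : chartGram K x y = c.transpose * gram K ((extChartAt 𝓘(ℝ, E) x).symm y) * c :=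
    gramOf_comp (metricForm K ((extChartAt 𝓘(ℝ, E) x).symm y)) (chartSymmDeriv x y)
  have hc' : IsUnit c.det := by
    refine IsUnit.of_mul_eq_one d.det ?_
    rw [← Matrix.det_mul, hcd, Matrix.det_one]
  have hcT : IsUnit c.transpose.det := by rwa [Matrix.det_transpose]
  rw [hG, Matrix.mul_inv_rev, Matrix.mul_inv_rev, ← Matrix.mul_assoc, Matrix.mul_nonsing_inv _ hc',
    Matrix.one_mul, Matrix.mul_assoc, Matrix.nonsing_inv_mul _ hcT, Matrix.mul_one]

end KahlerAlgebra

/-! ### Inner products and contractions in a chart -/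

section ChartMetric

open Filter Topology

variable {E EG M G : Type*} [NormedAddCommGroup E] [NormedSpace ℂ E] [FiniteDimensional ℂ E]
  [NormedAddCommGroup EG] [NormedSpace ℝ EG] [FiniteDimensional ℝ EG]
  [TopologicalSpace M] [ChartedSpace E M] [IsManifold 𝓘(ℂ, E) ω M]
  [TopologicalSpace G] [ChartedSpace EG G] [Group G] {k : ℕ}
  (K : KahlerStructure E M) (B : AdInvariantInner EG G)

/-- The coordinate vector fields of a chart are smooth sections of the tangent bundle. -/
theorem contMDiffAt_chartFrame {x z : M} (hz : z ∈ (extChartAt 𝓘(ℝ, E) x).source) (v : E) :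
    ContMDiffAt 𝓘(ℝ, E) (𝓘(ℝ, E).prod 𝓘(ℝ, E)) ∞
      (fun m => Bundle.TotalSpace.mk' E (E := fun x : M => TangentSpace 𝓘(ℝ, E) x) m
        (chartSymmDeriv x (extChartAt 𝓘(ℝ, E) x m) v)) z := by
  have hz' : z ∈ (chartAt E x).source := by rwa [extChartAt_source] at hz
  set e := trivializationAt E (fun x : M => TangentSpace 𝓘(ℝ, E) x) x with he
  have hb : e.baseSet = (chartAt E x).source := rfl
  have h1 : ContMDiffAt 𝓘(ℝ, E) (𝓘(ℝ, E).prod 𝓘(ℝ, E)) ∞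
      (fun m => e.toOpenPartialHomeomorph.symm (m, v)) z := by
    have h2 := (e.contMDiffOn_symm (IB := 𝓘(ℝ, E)) (n := ∞)).contMDiffAt (x := (z, v))
      (e.open_target.mem_nhds (by rw [e.mem_target]; exact hz'))
    exact h2.comp (x := z) (f := fun m : M => (m, v)) (contMDiffAt_id.prodMk contMDiffAt_const)
  refine h1.congr_of_eventuallyEq ?_
  filter_upwards [(chartAt E x).open_source.mem_nhds hz'] with m hm
  rw [← e.mk_symm (by rwa [hb])]
  have h3 := TangentBundle.symmL_trivializationAt (I := 𝓘(ℝ, E)) hm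
  have h4 := DFunLike.congr_fun h3 v
  rw [e.symmL_apply (by rwa [hb])] at h4
  rw [he, h4, chartSymmDeriv, ModelWithCorners.range_eq_univ, mfderivWithin_univ]
  rfl

/-- The coefficients of the metric are smooth functions of the coordinates. -/
theorem contDiffAt_chartMetric {x : M} {y : E} (hy : y ∈ (extChartAt 𝓘(ℝ, E) x).target) (v w : E) :
    ContDiffAt ℝ ∞ (fun y => chartMetric K x y v w) y := by
  have hs := (extChartAt 𝓘(ℝ, E) x).map_target hy
  have h1 : ContMDiffAt 𝓘(ℝ, E) (𝓘(ℝ, E).prod 𝓘(ℝ, ℝ)) ∞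
      (fun m => Bundle.TotalSpace.mk' ℝ (E := Bundle.Trivial M ℝ) m
        (K.metric.inner m (chartSymmDeriv x (extChartAt 𝓘(ℝ, E) x m) v)
          (chartSymmDeriv x (extChartAt 𝓘(ℝ, E) x m) w))) ((extChartAt 𝓘(ℝ, E) x).symm y) :=
    ContMDiffAt.clm_bundle_apply₂ (n := ∞) (F₁ := E) (F₂ := E)
      (K.metric.contMDiff ((extChartAt 𝓘(ℝ, E) x).symm y))
      (contMDiffAt_chartFrame hs v) (contMDiffAt_chartFrame hs w)
  have h2 := (Bundle.contMDiffAt_totalSpace.1 h1).2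
  have h3 := (h2.comp (x := y) (f := (extChartAt 𝓘(ℝ, E) x).symm)
    (smoothNear_extChartAt_symm hy).contMDiffAt).contDiffAt
  refine h3.congr_of_eventuallyEq ?_
  filter_upwards [(isOpen_extChartAt_target x).mem_nhds hy] with z hz
  simp only [Function.comp, (extChartAt 𝓘(ℝ, E) x).right_inv hz]
  rfl

theorem contDiffAt_chartGram {x : M} {y : E} (hy : y ∈ (extChartAt 𝓘(ℝ, E) x).target) (i j) :
    ContDiffAt ℝ ∞ (fun y => chartGram K x y i j) y := contDiffAt_chartMetric K hy _ _

theorem contDiffAt_det_chartGram {x : M} {y : E} (hy : y ∈ (extChartAt 𝓘(ℝ, E) x).target) :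
    ContDiffAt ℝ ∞ (fun y => (chartGram K x y).det) y := by
  simp only [Matrix.det_apply']
  exact ContDiffAt.sum fun s _ => contDiffAt_const.mul
    (contDiffAt_prod fun i _ => contDiffAt_chartGram K hy _ _)

theorem contDiffAt_inv_chartGram {x : M} {y : E} (hy : y ∈ (extChartAt 𝓘(ℝ, E) x).target) (i j) :
    ContDiffAt ℝ ∞ (fun y => (chartGram K x y)⁻¹ i j) y := by
  simp only [Matrix.inv_def, Matrix.smul_apply, Ring.inverse_eq_inv', smul_eq_mul,
    Matrix.adjugate_apply]
  refine ((contDiffAt_det_chartGram K hy).inv (isHermGram_chartGram K hy).det_pos.ne').mul ?_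
  simp only [Matrix.det_apply']
  refine ContDiffAt.sum fun s _ => contDiffAt_const.mul (contDiffAt_prod fun l _ => ?_)
  simp only [Matrix.updateRow_apply]
  split_ifs
  · exact contDiffAt_const
  · exact contDiffAt_chartGram K hy _ _

theorem contDiffAt_bivec {x : M} {y : E} (hy : y ∈ (extChartAt 𝓘(ℝ, E) x).target) (i j) :
    ContDiffAt ℝ ∞ (fun y => bivec (E := E) (chartGram K x y) i j) y := by
  simp only [bivec, Matrix.mul_apply]
  exact ContDiffAt.sum fun l _ => (contDiffAt_inv_chartGram K hy _ _).mul contDiffAt_const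

theorem form_basis (h : E →L[ℝ] E →L[ℝ] ℝ) (i j) :
    h (mulC Complex.I (realBasis E i)) (realBasis E j) =
      ((cplx E).transpose * Matrix.of fun i j => h (realBasis E i) (realBasis E j)) i j := by
  conv_lhs => rw [← (realBasis E).sum_repr (mulC Complex.I (realBasis E i)), map_sum, sum_apply]
  simp [cplx, LinearMap.toMatrix_apply, Matrix.mul_apply]

theorem form_gram (x : M) (i j) : K.form x ![realBasis E i, realBasis E j] =
    ((cplx E).transpose * gram K x) i j :=
  (form_eq_metricForm K _ _ _).trans (form_basis (metricForm K x) i j)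

theorem chartForm_form_apply {x : M} {y : E} (hy : y ∈ (extChartAt 𝓘(ℝ, E) x).target) (v w : E) :
    chartForm K.form x y ![v, w] = chartMetric K x y (mulC Complex.I v) w := by
  refine (comp_two_apply _ _ _ _).trans ?_
  rw [form_eq_metricForm, ← chartSymmDeriv_mulC hy]
  rfl

theorem chartForm_form_gram {x : M} {y : E} (hy : y ∈ (extChartAt 𝓘(ℝ, E) x).target) (i j) :
    chartForm K.form x y ![realBasis E i, realBasis E j] =
      ((cplx E).transpose * chartGram K x y) i j :=
  (chartForm_form_apply K hy _ _).trans (form_basis (chartMetric K x y) i j)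

theorem isSmoothForm_form : IsSmoothForm K.form := fun x y hy => by
  refine ContDiffAt.contDiffWithinAt (contDiffAt_form fun v => ?_)
  refine (contDiffAt_chartMetric K hy (mulC Complex.I (v 0)) (v 1)).congr_of_eventuallyEq ?_
  filter_upwards [(isOpen_extChartAt_target x).mem_nhds hy] with z hz
  rw [← chartForm_form_apply K hz]
  congr 1
  ext l
  fin_cases l <;> rfl

theorem formInner_eq (x : M) (α β : E [⋀^Fin k]→L[ℝ] EG) : formInner K B x α β =
    (k.factorial : ℝ)⁻¹ * contr (realBasis E) (gram K x)⁻¹ B.inner α β := rfl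

theorem lefschetzLambda_eq (x : M) (α : E [⋀^Fin 2]→L[ℝ] EG) :
    lefschetzLambda K x α = lam (realBasis E) (bivec (E := E) (gram K x)) α := by
  rw [← (isHermGram_gram K x).lam_eq (form_gram K x), lefschetzLambda, contr]
  simp only [mul_smul]
  rfl

theorem formInner_chart {x : M} {y : E} (hy : y ∈ (extChartAt 𝓘(ℝ, E) x).target)
    (α β : E [⋀^Fin k]→L[ℝ] EG) : formInner K B ((extChartAt 𝓘(ℝ, E) x).symm y) α β =
    (k.factorial : ℝ)⁻¹ * contr (realBasis E) (chartGram K x y)⁻¹ B.inner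
      (α.compContinuousLinearMap (chartSymmDeriv x y))
      (β.compContinuousLinearMap (chartSymmDeriv x y)) := by
  rw [formInner_eq, contr_gram_eq K B.inner hy]

/-- The contraction with the Kähler form, in coordinates. -/
theorem lam_chart {W : Type*} [NormedAddCommGroup W] [NormedSpace ℝ W] [FiniteDimensional ℝ W]
    {x : M} {y : E} (hy : y ∈ (extChartAt 𝓘(ℝ, E) x).target)
    (α : E [⋀^Fin 2]→L[ℝ] W) :
    lam (realBasis E) (bivec (E := E) (gram K ((extChartAt 𝓘(ℝ, E) x).symm y))) α =
      lam (realBasis E) (bivec (E := E) (chartGram K x y))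
        (α.compContinuousLinearMap (chartSymmDeriv x y)) := by
  rw [← (isHermGram_gram K _).lam_eq (form_gram K _), contr_gram_eq K _ hy,
    ← (isHermGram_chartGram K hy).lam_eq (chartForm_form_gram K hy)]
  rfl

theorem lefschetzLambda_chart {x : M} {y : E} (hy : y ∈ (extChartAt 𝓘(ℝ, E) x).target)
    (α : E [⋀^Fin 2]→L[ℝ] EG) : lefschetzLambda K ((extChartAt 𝓘(ℝ, E) x).symm y) α =
      lam (realBasis E) (bivec (E := E) (chartGram K x y))
        (α.compContinuousLinearMap (chartSymmDeriv x y)) := by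
  rw [lefschetzLambda_eq, lam_chart K hy]

end ChartMetric

/-! ### Index identities for closed two-forms -/

section IndexIdentities

variable {ι : Type*} [Fintype ι]

/-- The contraction of an antisymmetric bivector with a closed two-form: `u a b i j k` stands for
`P^{ab} S_{ijk}` with `P` antisymmetric and `S_{ijk} = ∂_i S_{jk}`. -/
theorem sum_cyclic (u : ι → ι → ι → ι → ι → ℝ) (h1 : ∀ a b i j k, u a b i j k = -u b a i j k)
    (h2 : ∀ a b i j k, u a b i j k = -u a b i k j)
    (h3 : ∀ a b i j k, u a b i j k + u a b j k i + u a b k i j = 0) (i : ι) :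
    1 / 2 * ∑ a, ∑ b, u a b i a b + ∑ a, ∑ b, u a b a b i = 0 := by
  have h4 : ∑ a, ∑ b, u a b a b i = ∑ a, ∑ b, u a b b i a := by
    rw [Finset.sum_comm]
    refine Finset.sum_congr rfl fun a _ => Finset.sum_congr rfl fun b _ => ?_
    rw [h1, h2, neg_neg]
  have h5 : ∑ a, ∑ b, u a b i a b + ∑ a, ∑ b, u a b a b i + ∑ a, ∑ b, u a b b i a = 0 := by
    simp only [← Finset.sum_add_distrib, h3, Finset.sum_const_zero]
  linarith

/-- The derivative of the inverse of a two-form with derivative `T`. -/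
def dInv (P : ι → ι → ℝ) (T : ι → ι → ι → ℝ) (i j l : ι) : ℝ :=
  ∑ a, ∑ b, P j a * T i a b * P b l

/-- The index computation behind the Kähler identity. Here `P` is the inverse of the Kähler form
up to sign, `T i a b = ∂_i ω_ab`, and, for a bilinear pairing `b`, `u k a b = b(γ_k, F_ab)`,
`v k i a b = b(γ_k, ∂_i F_ab)` and `w i k a b = b(∂_i γ_k, F_ab)`. The hypotheses `hT'` and `hv'`
say that `ω` and `F` are closed. -/
theorem kahler_index_identity {P : ι → ι → ℝ} (hP : ∀ a b, P a b = -P b a)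
    {T : ι → ι → ι → ℝ} (hT : ∀ i a b, T i a b = -T i b a)
    (hT' : ∀ i a b, T i a b + T a b i + T b i a = 0)
    {u : ι → ι → ι → ℝ} (hu : ∀ k a b, u k a b = -u k b a)
    {v : ι → ι → ι → ι → ℝ} (hv : ∀ k i a b, v k i a b = -v k i b a)
    (hv' : ∀ k i a b, v k i a b + v k a b i + v k b i a = 0)
    {w : ι → ι → ι → ι → ℝ} (hw : ∀ i k a b, w i k a b = -w i k b a) :
    ∑ i, ∑ k, P i k * (1 / 2 * ∑ a, ∑ b, P a b * w i k a b
        + 1 / 2 * ∑ a, ∑ b, (dInv P T i a b * u k a b + P a b * v k i a b)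
        - ∑ j, ∑ l, (dInv P T i j l * u j k l + P j l * w i j k l + P j l * v j i k l)) =
      1 / 2 * ∑ i, ∑ k, ∑ a, ∑ b, P i k * P a b * w i k a b
        - 1 / 2 * ∑ i, ∑ j, ∑ k, ∑ l, P i k * P j l * (w i j k l - w j i k l) := by
  have hA : ∑ i, ∑ j, ∑ k, ∑ l, P i k * P j l * w j i k l =
      -∑ i, ∑ j, ∑ k, ∑ l, P i k * P j l * w i j k l := by
    simp only [← Finset.sum_neg_distrib, ← Fintype.sum_prod_type']
    refine Fintype.sum_equiv
      { toFun := fun x => ⟨x.2.1, x.1, x.2.2.2, x.2.2.1⟩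
        invFun := fun x => ⟨x.2.1, x.1, x.2.2.2, x.2.2.1⟩
        left_inv := fun _ => rfl, right_inv := fun _ => rfl } _ _ fun x => ?_
    simp only [Equiv.coe_fn_mk]
    rw [hw x.2.1]
    ring
  have hA' : ∑ i, ∑ k, P i k * ∑ j, ∑ l, P j l * w i j k l =
      ∑ i, ∑ j, ∑ k, ∑ l, P i k * P j l * w i j k l := by
    simp only [Finset.mul_sum, mul_assoc]
    exact Finset.sum_congr rfl fun i _ => Finset.sum_comm
  -- the terms with derivatives of `F` cancel
  have hB : ∑ i, ∑ k, P i k * (1 / 2 * ∑ a, ∑ b, P a b * v k i a b) -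
      ∑ i, ∑ k, P i k * ∑ j, ∑ l, P j l * v j i k l = 0 := by
    have h1 : ∑ i, ∑ k, P i k * ∑ j, ∑ l, P j l * v j i k l =
        -∑ i, ∑ k, P i k * ∑ a, ∑ b, P a b * v k a b i := by
      simp only [Finset.mul_sum, ← Finset.sum_neg_distrib, ← Fintype.sum_prod_type']
      refine Fintype.sum_equiv
        { toFun := fun x => ⟨x.2.2.2, x.2.2.1, x.1, x.2.1⟩
          invFun := fun x => ⟨x.2.2.1, x.2.2.2, x.2.1, x.1⟩
          left_inv := fun _ => rfl, right_inv := fun _ => rfl } _ _ fun x => ?_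
      simp only [Equiv.coe_fn_mk]
      rw [hP x.2.2.1]
      ring
    rw [h1, sub_neg_eq_add, ← Finset.sum_add_distrib]
    refine Finset.sum_eq_zero fun i _ => ?_
    rw [← Finset.sum_add_distrib]
    refine Finset.sum_eq_zero fun k _ => ?_
    rw [← mul_add, sum_cyclic (fun a b i j l => P a b * v k i j l)
      (fun a b i j l => by rw [hP a]; ring) (fun a b i j l => by rw [hv k i]; ring)
      (fun a b i j l => by rw [← mul_add, ← mul_add, hv', mul_zero]), mul_zero]
  -- the terms with derivatives of `ω` cancel
  have hC : ∑ i, ∑ k, P i k * (1 / 2 * ∑ a, ∑ b, dInv P T i a b * u k a b) -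
      ∑ i, ∑ k, P i k * ∑ j, ∑ l, dInv P T i j l * u j k l = 0 := by
    let R : ι → ι → ι → ℝ := fun k c d => ∑ a, ∑ b, P a c * P d b * u k a b
    have hR : ∀ k c d, R k c d = -R k d c := fun k c d => by
      simp only [R, ← Finset.sum_neg_distrib]
      rw [Finset.sum_comm]
      refine Finset.sum_congr rfl fun a _ => Finset.sum_congr rfl fun b _ => ?_
      rw [hu, hP b, hP d]
      ring
    have h0 : ∀ i k, ∑ a, ∑ b, dInv P T i a b * u k a b = ∑ c, ∑ d, R k c d * T i c d := by
      intro i k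
      simp only [dInv, R, Finset.sum_mul, ← Fintype.sum_prod_type']
      refine Fintype.sum_equiv
        { toFun := fun x => ⟨x.2.2.1, x.2.2.2, x.1, x.2.1⟩
          invFun := fun x => ⟨x.2.2.1, x.2.2.2, x.1, x.2.1⟩
          left_inv := fun _ => rfl, right_inv := fun _ => rfl } _ _ fun x => ?_
      simp only [Equiv.coe_fn_mk]
      ring
    have h1 : ∑ i, ∑ k, P i k * ∑ j, ∑ l, dInv P T i j l * u j k l =
        -∑ i, ∑ k, P i k * ∑ c, ∑ d, R k c d * T c d i := by
      simp only [dInv, R, Finset.mul_sum, Finset.sum_mul, ← Finset.sum_neg_distrib,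
        ← Fintype.sum_prod_type']
      refine Fintype.sum_equiv
        { toFun := fun x => ⟨x.2.2.2.2.1, x.2.2.1, x.1, x.2.2.2.2.2, x.2.1, x.2.2.2.1⟩
          invFun := fun x => ⟨x.2.2.1, x.2.2.2.2.1, x.2.1, x.2.2.2.2.2, x.1, x.2.2.2.1⟩
          left_inv := fun _ => rfl, right_inv := fun _ => rfl } _ _ fun x => ?_
      simp only [Equiv.coe_fn_mk]
      rw [hP x.1, hP x.2.2.1, hT x.1]
      ring
    simp only [h0]
    rw [h1, sub_neg_eq_add, ← Finset.sum_add_distrib]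
    refine Finset.sum_eq_zero fun i _ => ?_
    rw [← Finset.sum_add_distrib]
    refine Finset.sum_eq_zero fun k _ => ?_
    rw [← mul_add, sum_cyclic (fun a b i j l => R k a b * T i j l)
      (fun a b i j l => by rw [hR]; ring) (fun a b i j l => by rw [hT i]; ring)
      (fun a b i j l => by rw [← mul_add, ← mul_add, hT', mul_zero]), mul_zero]
  have hD : ∑ i, ∑ k, P i k * (1 / 2 * ∑ a, ∑ b, P a b * w i k a b) =
      1 / 2 * ∑ i, ∑ k, ∑ a, ∑ b, P i k * P a b * w i k a b := by
    simp only [Finset.mul_sum]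
    refine Finset.sum_congr rfl fun i _ => Finset.sum_congr rfl fun k _ =>
      Finset.sum_congr rfl fun a _ => Finset.sum_congr rfl fun b _ => by ring
  have hE : ∑ i, ∑ j, ∑ k, ∑ l, P i k * P j l * (w i j k l - w j i k l) =
      2 * ∑ i, ∑ k, P i k * ∑ j, ∑ l, P j l * w i j k l := by
    simp only [mul_sub, Finset.sum_sub_distrib, hA, hA']
    ring
  rw [hE, ← hD]
  simp only [Finset.sum_add_distrib, mul_add, mul_sub, Finset.sum_sub_distrib] at hB hC ⊢
  linarith

end IndexIdentities

/-! ### The Kähler form and the volume density in a chart -/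

section ChartIdentities

open Filter Topology

/-- Jacobi's formula at an invertible matrix, in one direction. -/
theorem hasDerivAt_det_add_smul {ι : Type*} [Fintype ι] [DecidableEq ι] {A : Matrix ι ι ℝ}
    (hA : IsUnit A.det) (D : Matrix ι ι ℝ) :
    HasDerivAt (fun t : ℝ => (A + t • D).det) (A.det * (A⁻¹ * D).trace) 0 := by
  have h : ∀ t : ℝ, (A + t • D).det = A.det * (1 + (A⁻¹ * D).trace * t +
      ((1 + (Polynomial.X : Polynomial ℝ) • (A⁻¹ * D).map Polynomial.C).det.divX.divX).eval t
        * t ^ 2) := fun t => by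
    rw [← Matrix.det_one_add_smul, ← Matrix.det_mul, Matrix.mul_add, Matrix.mul_one,
      Matrix.mul_smul, ← Matrix.mul_assoc, Matrix.mul_nonsing_inv _ hA, Matrix.one_mul]
  simp only [h]
  have h1 := (((hasDerivAt_id (0 : ℝ)).const_mul (A⁻¹ * D).trace).const_add 1).add
    (((1 + (Polynomial.X : Polynomial ℝ) • (A⁻¹ * D).map Polynomial.C).det.divX.divX.hasDerivAt
      0).mul (hasDerivAt_pow 2 (0 : ℝ)))
  simpa using h1.const_mul A.det

/-- Jacobi's formula for the derivative of a determinant. -/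
theorem fderiv_det {V ι : Type*} [NormedAddCommGroup V] [NormedSpace ℝ V] [Fintype ι]
    [DecidableEq ι] {A : V → Matrix ι ι ℝ} {y : V}
    (hA : ∀ i j, DifferentiableAt ℝ (fun z => A z i j) y) (hu : IsUnit (A y).det) (v : V) :
    fderiv ℝ (fun z => (A z).det) y v = (A y).det *
      ((A y)⁻¹ * Matrix.of fun i j => fderiv ℝ (fun z => A z i j) y v).trace := by
  let d : (ι → ι → ℝ) → ℝ := fun X => (Matrix.of X).det
  let X : V → ι → ι → ℝ := fun z i j => A z i j
  have hd : ContDiff ℝ 1 d := by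
    simp only [d, Matrix.det_apply']
    refine ContDiff.sum fun s _ => contDiff_const.mul (contDiff_prod fun i _ => ?_)
    exact contDiff_apply_apply _ _ _ _
  have hX : HasFDerivAt X (ContinuousLinearMap.pi fun i => ContinuousLinearMap.pi fun j =>
      fderiv ℝ (fun z => A z i j) y) y :=
    hasFDerivAt_pi.2 fun i => hasFDerivAt_pi.2 fun j => (hA i j).hasFDerivAt
  have hd1 := (hd.differentiable one_ne_zero (X y)).hasFDerivAt
  have h1 := (hd1.comp y hX).fderiv
  have h2 := (hd1.hasLineDerivAt fun i j => fderiv ℝ (fun z => A z i j) y v)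
  have h3 := hasDerivAt_det_add_smul hu (Matrix.of fun i j => fderiv ℝ (fun z => A z i j) y v)
  have h4 := HasDerivAt.unique h2 h3
  rw [← h4]
  exact DFunLike.congr_fun h1 v

variable {E M : Type*} [NormedAddCommGroup E] [NormedSpace ℂ E] [FiniteDimensional ℂ E]
  [TopologicalSpace M] [ChartedSpace E M] [IsManifold 𝓘(ℂ, E) ω M]
  (K : KahlerStructure E M) {x : M} {y : E}

/-- The derivatives `∂_i ω_{ab}` of the coefficients of the Kähler form in a chart. -/
def dForm (x : M) (y : E) (i a b : Fin (Module.finrank ℝ E)) : ℝ :=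
  fderiv ℝ (fun z => ((cplx E).transpose * chartGram K x z) a b) y (realBasis E i)

/-- The Poisson bivector in the preferred chart at `x`. -/
abbrev chartBivec (x : M) (y : E) :
    Matrix (Fin (Module.finrank ℝ E)) (Fin (Module.finrank ℝ E)) ℝ :=
  bivec (E := E) (chartGram K x y)

theorem contDiffAt_chartForm_coeff (hy : y ∈ (extChartAt 𝓘(ℝ, E) x).target) (a b) :
    ContDiffAt ℝ ∞ (fun z => ((cplx E).transpose * chartGram K x z) a b) y := by
  simp only [Matrix.mul_apply]
  exact ContDiffAt.sum fun l _ => contDiffAt_const.mul (contDiffAt_chartGram K hy _ _)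

theorem dForm_eq (hy : y ∈ (extChartAt 𝓘(ℝ, E) x).target) (i a b) : dForm K x y i a b =
    fderiv ℝ (fun z => chartForm K.form x z ![realBasis E a, realBasis E b]) y (realBasis E i) := by
  rw [dForm]
  congr 1
  refine EventuallyEq.fderiv_eq ?_
  filter_upwards [(isOpen_extChartAt_target x).mem_nhds hy] with z hz
  rw [chartForm_form_gram K hz]

theorem dForm_antisymm (hy : y ∈ (extChartAt 𝓘(ℝ, E) x).target) (i a b) :
    dForm K x y i a b = -dForm K x y i b a := by
  rw [dForm_eq K hy, dForm_eq K hy]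
  simp_rw [fun z => form_two_swap (chartForm K.form x z) (realBasis E a) (realBasis E b)]
  rw [fderiv_fun_neg]
  rfl

theorem dForm_cyclic (hy : y ∈ (extChartAt 𝓘(ℝ, E) x).target) (i a b) :
    dForm K x y i a b + dForm K x y a b i + dForm K x y b i a = 0 := by
  have h := chartForm_extD (isSmoothForm_form K) x hy
  have h0 : chartForm (extD K.form) x y = 0 := by
    rw [chartForm, K.closed]
    ext v; rfl
  rw [h0] at h
  have hd : DifferentiableAt ℝ (chartForm K.form x) y :=
    ((isSmoothForm_form K x).contDiffAt
      ((isOpen_extChartAt_target x).mem_nhds hy)).differentiableAt (by simp)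
  have h1 := extDeriv_two_apply hd (realBasis E i) (realBasis E a) (realBasis E b)
  rw [← h, ← dForm_eq K hy, ← dForm_eq K hy, ← dForm_eq K hy, dForm_antisymm K hy a i b] at h1
  have h2 : (0 : E [⋀^Fin (2 + 1)]→L[ℝ] ℝ) ![realBasis E i, realBasis E a, realBasis E b] = 0 := rfl
  linarith

/-- The derivative of the inverse Kähler form, from differentiating `P Z = -1`, where `Z` is the
matrix of the Kähler form. -/
theorem fderiv_chartBivec (hy : y ∈ (extChartAt 𝓘(ℝ, E) x).target) (i j l) :
    fderiv ℝ (fun z => chartBivec K x z j l) y (realBasis E i) =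
      dInv (chartBivec K x y) (dForm K x y) i j l := by
  set P := chartBivec K x y with hP
  set Z := (cplx E).transpose * chartGram K x y with hZ
  let dP : Matrix (Fin (Module.finrank ℝ E)) (Fin (Module.finrank ℝ E)) ℝ :=
    Matrix.of fun j l => fderiv ℝ (fun z => chartBivec K x z j l) y (realBasis E i)
  let T : Matrix (Fin (Module.finrank ℝ E)) (Fin (Module.finrank ℝ E)) ℝ :=
    Matrix.of fun j l => dForm K x y i j l
  have h1 : dP * Z + P * T = 0 := by
    ext j b
    have hc : (fun z => ∑ a, chartBivec K x z j a * ((cplx E).transpose * chartGram K x z) a b)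
        =ᶠ[𝓝 y] fun _ => (-1 : Matrix (Fin (Module.finrank ℝ E)) (Fin (Module.finrank ℝ E)) ℝ) j b := by
      filter_upwards [(isOpen_extChartAt_target x).mem_nhds hy] with z hz
      rw [← Matrix.mul_apply, chartBivec, (isHermGram_chartGram K hz).bivec_mul_form]
    have h2 := DFunLike.congr_fun (hc.fderiv_eq (𝕜 := ℝ)) (realBasis E i)
    have hdf : ∀ a ∈ Finset.univ, DifferentiableAt ℝ (fun z => chartBivec K x z j a *
        ((cplx E).transpose * chartGram K x z) a b) y := fun a _ =>
      ((contDiffAt_bivec K hy _ _).mul (contDiffAt_chartForm_coeff K hy _ _)).differentiableAt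
        (by simp)
    rw [fderiv_fun_sum hdf] at h2
    rw [sum_apply, fderiv_fun_const] at h2
    rw [Matrix.add_apply, Matrix.mul_apply, Matrix.mul_apply, ← Finset.sum_add_distrib,
      Matrix.zero_apply]
    refine Eq.trans (Finset.sum_congr rfl fun a _ => ?_) h2
    rw [fderiv_fun_mul ((contDiffAt_bivec K hy _ _).differentiableAt (by simp))
      ((contDiffAt_chartForm_coeff K hy _ _).differentiableAt (by simp))]
    simp only [add_apply, smul_apply, smul_eq_mul, dP, T, Matrix.of_apply, dForm, Z, P]
    ring
  have h2 : dP = P * T * P := by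
    have h3 := congrArg (fun X => X * P) h1
    simp only [Matrix.add_mul, Matrix.zero_mul] at h3
    rw [Matrix.mul_assoc dP, hZ, hP, (isHermGram_chartGram K hy).form_mul_bivec, ← hP,
      Matrix.mul_neg, Matrix.mul_one] at h3
    rw [← sub_eq_zero, ← neg_eq_zero, ← h3]
    abel
  have h3 := congrFun (congrFun h2 j) l
  simp only [dP, Matrix.of_apply] at h3
  rw [h3, Matrix.mul_assoc, Matrix.mul_apply]
  refine Finset.sum_congr rfl fun a _ => ?_
  rw [Matrix.mul_apply, Finset.mul_sum]
  exact Finset.sum_congr rfl fun b _ => by simp only [T, Matrix.of_apply]; ring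

/-- The logarithmic derivative of the volume density. -/
theorem fderiv_sqrt_det (hy : y ∈ (extChartAt 𝓘(ℝ, E) x).target) (i) :
    fderiv ℝ (fun z => √(chartGram K x z).det) y (realBasis E i) =
      √(chartGram K x y).det * (1 / 2 * ∑ a, ∑ b, chartBivec K x y a b * dForm K x y i a b) := by
  have hG := isHermGram_chartGram K hy
  have hd := fderiv_det (A := chartGram K x) (y := y) (fun i j =>
    (contDiffAt_chartGram K hy i j).differentiableAt (by simp)) hG.isUnit (realBasis E i)
  rw [fderiv_sqrt ((contDiffAt_det_chartGram K hy).differentiableAt (by simp)) hG.det_pos.ne',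
    smul_apply, hd]
  set D : Matrix (Fin (Module.finrank ℝ E)) (Fin (Module.finrank ℝ E)) ℝ :=
    Matrix.of fun a b => fderiv ℝ (fun z => chartGram K x z a b) y (realBasis E i) with hD
  have hT : ∀ a b, dForm K x y i a b = ((cplx E).transpose * D) a b := by
    intro a b
    simp only [dForm, Matrix.mul_apply]
    rw [fderiv_fun_sum fun l _ => (contDiffAt_const.mul
      (contDiffAt_chartGram K hy _ _)).differentiableAt (by simp), sum_apply]
    refine Finset.sum_congr rfl fun l _ => ?_
    rw [fderiv_const_mul ((contDiffAt_chartGram K hy _ _).differentiableAt (by simp))]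
    rfl
  have h1 : (chartGram K x y)⁻¹ * D =
      -(chartBivec K x y * ((cplx E).transpose * D)) := by
    rw [chartBivec, bivec, Matrix.mul_assoc, ← Matrix.mul_assoc (cplx E).transpose,
      ← Matrix.transpose_mul, cplx_mul_self]
    simp
  have h2 : ((chartGram K x y)⁻¹ * D).trace =
      ∑ a, ∑ b, chartBivec K x y a b * dForm K x y i a b := by
    rw [h1, Matrix.trace_neg, Matrix.trace, ← Finset.sum_neg_distrib]
    refine Finset.sum_congr rfl fun a _ => ?_
    rw [Matrix.diag_apply, Matrix.mul_apply, ← Finset.sum_neg_distrib]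
    refine Finset.sum_congr rfl fun b _ => ?_
    rw [← hT, dForm_antisymm K hy i a b]
    ring
  rw [h2]
  have hs : √(chartGram K x y).det ≠ 0 := (Real.sqrt_pos.2 hG.det_pos).ne'
  have hs2 : (chartGram K x y).det = √(chartGram K x y).det * √(chartGram K x y).det :=
    (Real.mul_self_sqrt hG.det_pos.le).symm
  rw [smul_eq_mul]
  nth_rewrite 2 [hs2]
  field_simp

/-- The Poisson bivector is divergence free. -/
theorem sum_fderiv_sqrt_det_mul_bivec (hy : y ∈ (extChartAt 𝓘(ℝ, E) x).target) (j) :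
    ∑ i, fderiv ℝ (fun z => √(chartGram K x z).det * chartBivec K x z i j) y (realBasis E i) = 0 := by
  have hG := isHermGram_chartGram K hy
  set P := chartBivec K x y with hP
  set T := dForm K x y with hT
  have h1 : ∀ i, fderiv ℝ (fun z => √(chartGram K x z).det * chartBivec K x z i j) y (realBasis E i)
      = √(chartGram K x y).det * (dInv P T i i j + P i j * (1 / 2 * ∑ a, ∑ b, P a b * T i a b)) := by
    intro i
    rw [fderiv_fun_mul (((contDiffAt_det_chartGram K hy).sqrt hG.det_pos.ne').differentiableAt
      (by simp)) ((contDiffAt_bivec K hy _ _).differentiableAt (by simp)), add_apply, smul_apply,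
      smul_apply, fderiv_chartBivec K hy, fderiv_sqrt_det K hy, smul_eq_mul, smul_eq_mul]
    ring
  have hPa : ∀ a b, P a b = -P b a := hG.bivec_antisymm
  have h2 : ∑ i, dInv P T i i j = ∑ i, P i j * ∑ a, ∑ b, P a b * T a b i := by
    simp only [dInv, Finset.mul_sum, ← Fintype.sum_prod_type']
    refine Fintype.sum_equiv
      { toFun := fun x => ⟨x.2.2, x.1, x.2.1⟩
        invFun := fun x => ⟨x.2.1, x.2.2, x.1⟩
        left_inv := fun _ => rfl, right_inv := fun _ => rfl } _ _ fun x => ?_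
    simp only [Equiv.coe_fn_mk]
    ring
  rw [Finset.sum_congr rfl fun i _ => h1 i, ← Finset.mul_sum, Finset.sum_add_distrib, h2,
    ← Finset.sum_add_distrib, Finset.sum_eq_zero, mul_zero]
  intro i _
  rw [← mul_add, add_comm, sum_cyclic (fun a b i j l => P a b * T i j l)
    (fun a b i j l => by rw [hPa a]; ring) (fun a b i j l => by rw [hT, dForm_antisymm K hy i]; ring)
    (fun a b i j l => by rw [← mul_add, ← mul_add, hT, dForm_cyclic K hy, mul_zero]), mul_zero]

end ChartIdentities

/-! ### The Kähler identities at a point of a chart -/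

section PointwiseIdentities

open Filter Topology

section Flat

variable {V ι : Type*} [NormedAddCommGroup V] [NormedSpace ℝ V] [FiniteDimensional ℝ V] [Fintype ι]
  {W W₁ W₂ : Type*} [NormedAddCommGroup W] [NormedSpace ℝ W] [FiniteDimensional ℝ W]
  [NormedAddCommGroup W₁] [NormedSpace ℝ W₁] [FiniteDimensional ℝ W₁]
  [NormedAddCommGroup W₂] [NormedSpace ℝ W₂] [FiniteDimensional ℝ W₂]
  (e : Module.Basis ι ℝ V) {y : V}

theorem differentiableAt_form_apply {k : ℕ} {f : V → V [⋀^Fin k]→L[ℝ] W}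
    (hf : DifferentiableAt ℝ f y) (v : Fin k → V) : DifferentiableAt ℝ (fun z => f z v) y :=
  (ContinuousAlternatingMap.apply ℝ V W v).differentiableAt.comp y hf

theorem lam_extDeriv {P : Matrix ι ι ℝ} (hP : ∀ a b, P a b = -P b a)
    {θ : V → V [⋀^Fin 1]→L[ℝ] W} (hθ : DifferentiableAt ℝ θ y) :
    lam e P (extDeriv θ y) = ∑ i, ∑ k, P i k • fderiv ℝ (fun z => θ z ![e k]) y (e i) := by
  have h1 : ∀ i k, P i k • extDeriv θ y ![e i, e k] =
      P i k • fderiv ℝ (fun z => θ z ![e k]) y (e i) +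
        P k i • fderiv ℝ (fun z => θ z ![e i]) y (e k) := fun i k => by
    rw [extDeriv_one_apply hθ, hP k i, smul_sub, neg_smul, sub_eq_add_neg]
  have h2 : lam e P (extDeriv θ y) = (1 / 2 : ℝ) • ∑ i, ∑ k, P i k • extDeriv θ y ![e i, e k] := rfl
  rw [h2]
  simp only [h1, Finset.sum_add_distrib]
  rw [Finset.sum_comm (f := fun i k => P k i • fderiv ℝ (fun z => θ z ![e i]) y (e k)),
    ← two_smul ℝ, smul_smul]
  norm_num

/-- Leibniz rule for the pairing of a section with a one-form. -/
theorem lam_extDeriv_pairing {P : Matrix ι ι ℝ} (hP : ∀ a b, P a b = -P b a)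
    (b : W₁ →L[ℝ] W₂ →L[ℝ] ℝ) {f : V → V [⋀^Fin 0]→L[ℝ] W₁} {η : V → V [⋀^Fin 1]→L[ℝ] W₂}
    {θ : V → V [⋀^Fin 1]→L[ℝ] ℝ} (hf : DifferentiableAt ℝ f y) (hη : DifferentiableAt ℝ η y)
    (hθ : DifferentiableAt ℝ θ y) (h : ∀ᶠ z in 𝓝 y, ∀ v, θ z ![v] = b (f z 0) (η z ![v])) :
    lam e P (extDeriv θ y) = ∑ i, ∑ k, P i k * b (extDeriv f y ![e i]) (η y ![e k]) +
      b (f y 0) (lam e P (extDeriv η y)) := by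
  have h1 : ∀ i k, fderiv ℝ (fun z => θ z ![e k]) y (e i) = b (extDeriv f y ![e i]) (η y ![e k]) +
      b (f y 0) (fderiv ℝ (fun z => η z ![e k]) y (e i)) := fun i k => by
    have h2 : (fun z => θ z ![e k]) =ᶠ[𝓝 y] fun z => b (f z 0) (η z ![e k]) := by
      filter_upwards [h] with z hz using hz _
    have hb : DifferentiableAt ℝ (fun z => b (f z 0)) y :=
      b.differentiableAt.comp y (differentiableAt_form_apply hf 0)
    rw [h2.fderiv_eq, fderiv_clm_apply hb (differentiableAt_form_apply hη _),
      extDeriv_zero_apply hf, add_comm]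
    simp only [add_apply, ContinuousLinearMap.comp_apply, ContinuousLinearMap.flip_apply]
    congr 1
    have h3 := (b.hasFDerivAt.comp y (differentiableAt_form_apply hf 0).hasFDerivAt).fderiv
    exact congrArg (fun L : V →L[ℝ] W₂ →L[ℝ] ℝ => L (e i) (η y ![e k])) h3
  rw [lam_extDeriv e hP hθ, lam_extDeriv e hP hη]
  simp only [h1, smul_eq_mul, mul_add, Finset.sum_add_distrib, map_sum, map_smul]

theorem fderiv_bilin (b : W₁ →L[ℝ] W₂ →L[ℝ] ℝ) {f : V → W₁} {g : V → W₂}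
    (hf : DifferentiableAt ℝ f y) (hg : DifferentiableAt ℝ g y) (v : V) :
    fderiv ℝ (fun z => b (f z) (g z)) y v = b (fderiv ℝ f y v) (g y) + b (f y) (fderiv ℝ g y v) := by
  have h3 := (b.hasFDerivAt.comp y hf.hasFDerivAt)
  have h4 := (h3.clm_apply hg.hasFDerivAt).fderiv
  have h5 := DFunLike.congr_fun h4 v
  refine Eq.trans h5 ?_
  simp [add_comm]

theorem contr_extDeriv_one (P : Matrix ι ι ℝ) (b : W₁ →L[ℝ] W₂ →L[ℝ] ℝ)
    {γ : V → V [⋀^Fin 1]→L[ℝ] W₁} (hγ : DifferentiableAt ℝ γ y) (β : V [⋀^Fin 2]→L[ℝ] W₂) :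
    contr e P b (extDeriv γ y : V [⋀^Fin 2]→L[ℝ] W₁) β =
      ∑ i, ∑ j, ∑ k, ∑ l, P i k * P j l *
        (b (fderiv ℝ (fun z => γ z ![e j]) y (e i)) (β ![e k, e l]) -
          b (fderiv ℝ (fun z => γ z ![e i]) y (e j)) (β ![e k, e l])) := by
  rw [contr_two]
  refine Finset.sum_congr rfl fun i _ => Finset.sum_congr rfl fun j _ => ?_
  have h := extDeriv_one_apply hγ (e i) (e j)
  refine Finset.sum_congr rfl fun k _ => Finset.sum_congr rfl fun l _ => ?_
  refine (congrArg (fun q => (P i k * P j l) • b q (β ![e k, e l])) h).trans ?_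
  rw [map_sub, sub_apply, smul_eq_mul]

theorem bilin_lam (P : Matrix ι ι ℝ) (b : W₁ →L[ℝ] W₂ →L[ℝ] ℝ) (X : ι → ι → W₁)
    (β : V [⋀^Fin 2]→L[ℝ] W₂) :
    b (∑ i, ∑ k, P i k • X i k) (lam e P β) =
      1 / 2 * ∑ i, ∑ k, ∑ a, ∑ d, P i k * P a d * b (X i k) (β ![e a, e d]) := by
  simp only [lam, map_sum, sum_apply, map_smul, smul_apply, smul_eq_mul, Finset.mul_sum,
    ← Fintype.sum_prod_type']
  refine Fintype.sum_equiv
    { toFun := fun x => ⟨x.2.1, x.2.2, x.1.1, x.1.2⟩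
      invFun := fun x => ⟨(x.2.2.1, x.2.2.2), x.1, x.2.1⟩
      left_inv := fun _ => rfl, right_inv := fun _ => rfl } _ _ fun x => ?_
  simp only [Equiv.coe_fn_mk]
  ring

end Flat

variable {E M : Type*} [NormedAddCommGroup E] [NormedSpace ℂ E] [FiniteDimensional ℂ E]
  [TopologicalSpace M] [ChartedSpace E M] [IsManifold 𝓘(ℂ, E) ω M]
  {W₁ W₂ : Type*} [NormedAddCommGroup W₁] [NormedSpace ℝ W₁] [FiniteDimensional ℝ W₁]
  [NormedAddCommGroup W₂] [NormedSpace ℝ W₂] [FiniteDimensional ℝ W₂]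
  (K : KahlerStructure E M) {x : M} {y : E}

/-- The contraction of `dθ` with the Kähler form is the divergence of a vector field. -/
theorem sqrt_det_mul_lam_extDeriv (hy : y ∈ (extChartAt 𝓘(ℝ, E) x).target)
    {θ : E → E [⋀^Fin 1]→L[ℝ] ℝ} (hθ : DifferentiableAt ℝ θ y) :
    √(chartGram K x y).det * lam (realBasis E) (chartBivec K x y) (extDeriv θ y) =
      ∑ i, fderiv ℝ (fun z => ∑ k, √(chartGram K x z).det * chartBivec K x z i k *
        θ z ![realBasis E k]) y (realBasis E i) := by
  have hG := isHermGram_chartGram K hy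
  have hd : ∀ i k, DifferentiableAt ℝ (fun z => √(chartGram K x z).det * chartBivec K x z i k) y :=
    fun i k => (((contDiffAt_det_chartGram K hy).sqrt hG.det_pos.ne').mul
      (contDiffAt_bivec K hy i k)).differentiableAt (by simp)
  have h1 : ∀ i, fderiv ℝ (fun z => ∑ k, √(chartGram K x z).det * chartBivec K x z i k *
        θ z ![realBasis E k]) y (realBasis E i) =
      ∑ k, (√(chartGram K x y).det * (chartBivec K x y i k *
        fderiv ℝ (fun z => θ z ![realBasis E k]) y (realBasis E i)) +
        θ y ![realBasis E k] * fderiv ℝ (fun z => √(chartGram K x z).det * chartBivec K x z i k) y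
          (realBasis E i)) := fun i => by
    have hm : ∀ k ∈ Finset.univ, DifferentiableAt ℝ (fun z => √(chartGram K x z).det *
        chartBivec K x z i k * θ z ![realBasis E k]) y := fun k _ =>
      (hd i k).mul (differentiableAt_form_apply hθ _)
    rw [fderiv_fun_sum hm, sum_apply]
    refine Finset.sum_congr rfl fun k _ => ?_
    rw [fderiv_fun_mul (hd i k) (differentiableAt_form_apply hθ _)]
    simp only [add_apply, smul_apply, smul_eq_mul]
    ring
  rw [Finset.sum_congr rfl fun i _ => h1 i, lam_extDeriv _ hG.bivec_antisymm hθ]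
  simp only [Finset.sum_add_distrib, smul_eq_mul, ← Finset.mul_sum]
  rw [Finset.sum_comm (f := fun i k => θ y ![realBasis E k] *
    fderiv ℝ (fun z => √(chartGram K x z).det * chartBivec K x z i k) y (realBasis E i))]
  simp only [← Finset.mul_sum, sum_fderiv_sqrt_det_mul_bivec K hy]
  simp

theorem fderiv_lam_chart (hy : y ∈ (extChartAt 𝓘(ℝ, E) x).target)
    {F : E → E [⋀^Fin 2]→L[ℝ] W₂} (hF : DifferentiableAt ℝ F y) (i) :
    fderiv ℝ (fun z => lam (realBasis E) (chartBivec K x z) (F z)) y (realBasis E i) =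
      (1 / 2 : ℝ) • ∑ a, ∑ b, (dInv (chartBivec K x y) (dForm K x y) i a b •
        F y ![realBasis E a, realBasis E b] + chartBivec K x y a b •
          fderiv ℝ (fun z => F z ![realBasis E a, realBasis E b]) y (realBasis E i)) := by
  have hd : ∀ a b, DifferentiableAt ℝ (fun z => chartBivec K x z a b •
      F z ![realBasis E a, realBasis E b]) y := fun a b =>
    ((contDiffAt_bivec K hy a b).differentiableAt (by simp)).smul
      (differentiableAt_form_apply hF _)
  simp only [lam]
  rw [fderiv_fun_const_smul (DifferentiableAt.fun_sum fun a _ => DifferentiableAt.fun_sum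
    fun b _ => hd a b), smul_apply, fderiv_fun_sum fun a _ => DifferentiableAt.fun_sum
    fun b _ => hd a b, sum_apply]
  congr 1
  refine Finset.sum_congr rfl fun a _ => ?_
  rw [fderiv_fun_sum fun b _ => hd a b, sum_apply]
  refine Finset.sum_congr rfl fun b _ => ?_
  rw [fderiv_fun_smul ((contDiffAt_bivec K hy a b).differentiableAt (by simp))
    (differentiableAt_form_apply hF _), ← fderiv_chartBivec K hy]
  simp [add_comm]

set_option maxHeartbeats 1000000 in
/-- The pointwise form of the Kähler identity. For the one-form `θ` obtained from `γ` and `F`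
(the `crossForm` below), `Λ dθ` is `⟨Λ dγ, Λ F⟩` minus the inner product of `dγ` with `F ∘ J`. The
terms in which `F` or the Kähler form is differentiated cancel because both are closed
(`kahler_index_identity`). -/
theorem lam_extDeriv_kahler (hy : y ∈ (extChartAt 𝓘(ℝ, E) x).target)
    (b : W₁ →L[ℝ] W₂ →L[ℝ] ℝ) {γ : E → E [⋀^Fin 1]→L[ℝ] W₁} {F : E → E [⋀^Fin 2]→L[ℝ] W₂}
    {θ : E → E [⋀^Fin 1]→L[ℝ] ℝ} (hγ : DifferentiableAt ℝ γ y) (hF : DifferentiableAt ℝ F y)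
    (hθ : DifferentiableAt ℝ θ y) (hdF : extDeriv F y = 0)
    (h : ∀ᶠ z in 𝓝 y, ∀ v, θ z ![v] =
      b (γ z ![v]) (lam (realBasis E) (chartBivec K x z) (F z)) -
        ∑ j, ∑ l, chartBivec K x z j l * b (γ z ![realBasis E j]) (F z ![v, realBasis E l])) :
    lam (realBasis E) (chartBivec K x y) (extDeriv θ y) =
      b (lam (realBasis E) (chartBivec K x y) (extDeriv γ y))
        (lam (realBasis E) (chartBivec K x y) (F y)) -
      1 / 2 * contr (realBasis E) (chartBivec K x y) b (extDeriv γ y : E [⋀^Fin 2]→L[ℝ] W₁)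
        (F y) := by
  have hG := isHermGram_chartGram K hy
  set e := realBasis E with he
  set P := chartBivec K x y with hP
  set T := dForm K x y with hT
  have hPd : ∀ j l, DifferentiableAt ℝ (fun z => chartBivec K x z j l) y := fun j l =>
    (contDiffAt_bivec K hy j l).differentiableAt (by simp)
  have hlam : DifferentiableAt ℝ (fun z => lam e (chartBivec K x z) (F z)) y :=
    (DifferentiableAt.fun_sum fun a _ => DifferentiableAt.fun_sum fun b _ =>
      (hPd a b).smul (differentiableAt_form_apply hF _)).const_smul _
  have hterm : ∀ k j l, DifferentiableAt ℝ (fun z => b (γ z ![e j]) (F z ![e k, e l])) y :=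
    fun k j l => (b.differentiableAt.comp y (differentiableAt_form_apply hγ _)).clm_apply
      (differentiableAt_form_apply hF _)
  have h1 : ∀ i k, fderiv ℝ (fun z => θ z ![e k]) y (e i) =
      1 / 2 * ∑ a, ∑ d, P a d * b (fderiv ℝ (fun z => γ z ![e k]) y (e i)) (F y ![e a, e d])
        + 1 / 2 * ∑ a, ∑ d, (dInv P T i a d * b (γ y ![e k]) (F y ![e a, e d]) +
          P a d * b (γ y ![e k]) (fderiv ℝ (fun z => F z ![e a, e d]) y (e i)))
        - ∑ j, ∑ l, (dInv P T i j l * b (γ y ![e j]) (F y ![e k, e l]) +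
          P j l * b (fderiv ℝ (fun z => γ z ![e j]) y (e i)) (F y ![e k, e l]) +
          P j l * b (γ y ![e j]) (fderiv ℝ (fun z => F z ![e k, e l]) y (e i))) := fun i k => by
    have h2 : (fun z => θ z ![e k]) =ᶠ[𝓝 y] fun z =>
        b (γ z ![e k]) (lam e (chartBivec K x z) (F z)) -
          ∑ j, ∑ l, chartBivec K x z j l * b (γ z ![e j]) (F z ![e k, e l]) := by
      filter_upwards [h] with z hz using hz _
    have hs : ∀ j, DifferentiableAt ℝ (fun z => ∑ l, chartBivec K x z j l *
        b (γ z ![e j]) (F z ![e k, e l])) y := fun j =>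
      DifferentiableAt.fun_sum fun l _ => (hPd j l).mul (hterm k j l)
    have hb : DifferentiableAt ℝ (fun z => b (γ z ![e k]) (lam e (chartBivec K x z) (F z))) y :=
      (b.differentiableAt.comp y (differentiableAt_form_apply hγ _)).clm_apply hlam
    have hm : ∀ j l, DifferentiableAt ℝ (fun z => chartBivec K x z j l *
        b (γ z ![e j]) (F z ![e k, e l])) y := fun j l => (hPd j l).mul (hterm k j l)
    rw [h2.fderiv_eq, fderiv_fun_sub hb (DifferentiableAt.fun_sum fun j _ => hs j), sub_apply, fderiv_bilin b (differentiableAt_form_apply hγ _) hlam, fderiv_lam_chart K hy hF,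
      fderiv_fun_sum fun j _ => hs j, sum_apply]
    congr 1
    · congr 1
      · simp only [lam, map_smul, map_sum, smul_eq_mul]
        rfl
      · simp only [map_smul, map_sum, map_add, smul_eq_mul]
        rfl
    · refine Finset.sum_congr rfl fun j _ => ?_
      rw [fderiv_fun_sum fun l _ => hm j l, sum_apply]
      refine Finset.sum_congr rfl fun l _ => ?_
      rw [fderiv_fun_mul (hPd j l) (hterm k j l), add_apply, smul_apply, smul_apply,
        fderiv_bilin b (differentiableAt_form_apply hγ _) (differentiableAt_form_apply hF _),
        fderiv_chartBivec K hy]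
      simp only [smul_eq_mul]
      ring
  have hFs : ∀ i a d, fderiv ℝ (fun z => F z ![e a, e d]) y (e i) =
      -fderiv ℝ (fun z => F z ![e d, e a]) y (e i) := fun i a d => by
    simp_rw [fun z => form_two_swap (F z) (e a) (e d)]
    rw [fderiv_fun_neg]
    rfl
  have hFc : ∀ i a d, fderiv ℝ (fun z => F z ![e a, e d]) y (e i) +
      fderiv ℝ (fun z => F z ![e d, e i]) y (e a) + fderiv ℝ (fun z => F z ![e i, e a]) y (e d) = 0 :=
    fun i a d => by
    have := extDeriv_two_apply hF (e i) (e a) (e d)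
    rw [hdF, hFs a i d] at this
    rw [sub_neg_eq_add] at this
    exact this.symm
  have key := kahler_index_identity (P := fun i j => P i j) hG.bivec_antisymm (T := T)
    (dForm_antisymm K hy) (dForm_cyclic K hy)
    (u := fun k a d => b (γ y ![e k]) (F y ![e a, e d]))
    (fun k a d => by rw [form_two_swap, map_neg])
    (v := fun k i a d => b (γ y ![e k]) (fderiv ℝ (fun z => F z ![e a, e d]) y (e i)))
    (fun k i a d => by rw [hFs, map_neg])
    (fun k i a d => by rw [← map_add, ← map_add, hFc, map_zero])
    (w := fun i k a d => b (fderiv ℝ (fun z => γ z ![e k]) y (e i)) (F y ![e a, e d]))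
    (fun i k a d => by rw [form_two_swap, map_neg])
  rw [contr_extDeriv_one e P b hγ, lam_extDeriv e hG.bivec_antisymm hθ,
    lam_extDeriv e hG.bivec_antisymm hγ, bilin_lam]
  simp only [h1, smul_eq_mul]
  exact key

end PointwiseIdentities

/-! ### The Riemannian volume measure -/

section Volume

open Filter Topology MeasureTheory

variable {E M : Type*} [NormedAddCommGroup E] [NormedSpace ℂ E] [FiniteDimensional ℂ E]
  [TopologicalSpace M] [ChartedSpace E M] [IsManifold 𝓘(ℂ, E) ω M]
  [MeasurableSpace E] [BorelSpace E] [MeasurableSpace M] [BorelSpace M]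
  (K : KahlerStructure E M)

/-- The volume density in the preferred chart at `x`. -/
def chartDensity (x : M) (y : E) : ENNReal := ENNReal.ofReal √(chartGram K x y).det

theorem measurableSet_target (x : M) : MeasurableSet (extChartAt 𝓘(ℝ, E) x).target :=
  (isOpen_extChartAt_target x).measurableSet

theorem aemeasurable_chart_symm (x : M) : AEMeasurable (extChartAt 𝓘(ℝ, E) x).symm
    (((realBasis E).addHaar.restrict (extChartAt 𝓘(ℝ, E) x).target).withDensity
      (chartDensity K x)) :=
  ((continuousOn_extChartAt_symm x).aemeasurable (measurableSet_target x)).mono_ac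
    (withDensity_absolutelyContinuous _ _)

theorem continuousOn_chartDensity (x : M) :
    ContinuousOn (chartDensity K x) (extChartAt 𝓘(ℝ, E) x).target := fun _ hy =>
  ContinuousAt.continuousWithinAt <| ENNReal.continuous_ofReal.continuousAt.comp
    (Real.continuous_sqrt.continuousAt.comp (contDiffAt_det_chartGram K hy).continuousAt)

theorem chartVolume_apply (x : M) {s : Set M} (hs : MeasurableSet s) :
    chartVolume K x s = ∫⁻ y in (extChartAt 𝓘(ℝ, E) x).target ∩ (extChartAt 𝓘(ℝ, E) x).symm ⁻¹' s,
      chartDensity K x y ∂(realBasis E).addHaar := by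
  refine (Measure.map_apply_of_aemeasurable (aemeasurable_chart_symm K x) hs).trans ?_
  rw [withDensity_apply', Measure.restrict_restrict' (measurableSet_target x), Set.inter_comm]

theorem measurableSet_chart_inter_preimage (x : M) {s : Set M} (hs : MeasurableSet s) :
    MeasurableSet ((extChartAt 𝓘(ℝ, E) x).target ∩ (extChartAt 𝓘(ℝ, E) x).symm ⁻¹' s) := by
  have h : Measurable fun y : (extChartAt 𝓘(ℝ, E) x).target => (extChartAt 𝓘(ℝ, E) x).symm y :=
    (continuousOn_iff_continuous_domRestrict.1 (continuousOn_extChartAt_symm x)).measurable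
  convert (measurableSet_target x).subtype_image (h hs) using 1
  ext y
  simp [and_comm]

theorem chartVolume_compl_source (x : M) : chartVolume K x (extChartAt 𝓘(ℝ, E) x).sourceᶜ = 0 := by
  rw [chartVolume_apply K x (isOpen_extChartAt_source x).measurableSet.compl]
  have : (extChartAt 𝓘(ℝ, E) x).target ∩ (extChartAt 𝓘(ℝ, E) x).symm ⁻¹'
      (extChartAt 𝓘(ℝ, E) x).sourceᶜ = ∅ := by
    ext y
    simp only [Set.mem_inter_iff, Set.mem_preimage, Set.mem_compl_iff, Set.mem_empty_iff_false,
      iff_false, not_and, not_not]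
    exact fun hy => (extChartAt 𝓘(ℝ, E) x).map_target hy
  rw [this]
  simp

/-- The transformation rule of the volume density `√(det g)` under a change of charts. -/
theorem chartMetric_change {x x' : M} {y : E} (hy : y ∈ (extChartAt 𝓘(ℝ, E) x).target)
    (hy' : (extChartAt 𝓘(ℝ, E) x).symm y ∈ (extChartAt 𝓘(ℝ, E) x').source) :
    √(chartGram K x y).det =
      |(fderiv ℝ (extChartAt 𝓘(ℝ, E) x' ∘ (extChartAt 𝓘(ℝ, E) x).symm) y).det| *
        √(chartGram K x' (extChartAt 𝓘(ℝ, E) x' ((extChartAt 𝓘(ℝ, E) x).symm y))).det := by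
  set z := (extChartAt 𝓘(ℝ, E) x).symm y with hz
  set y' := extChartAt 𝓘(ℝ, E) x' z with hyd
  have hy'' : y' ∈ (extChartAt 𝓘(ℝ, E) x').target := (extChartAt 𝓘(ℝ, E) x').map_source hy'
  have hback : (extChartAt 𝓘(ℝ, E) x').symm y' = z := (extChartAt 𝓘(ℝ, E) x').left_inv hy'
  set f := extChartAt 𝓘(ℝ, E) x' ∘ (extChartAt 𝓘(ℝ, E) x).symm with hf
  have h1 : fderiv ℝ f y = (tmap (extChartAt 𝓘(ℝ, E) x') z : E →L[ℝ] E).comp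
      (chartSymmDeriv x y) := by
    rw [← tmap_eq_fderiv, hf]
    exact tmap_comp (x := y) (f := (extChartAt 𝓘(ℝ, E) x).symm) (g := extChartAt 𝓘(ℝ, E) x')
      (smoothNear_extChartAt hy').mdifferentiableAt (smoothNear_extChartAt_symm hy).mdifferentiableAt
  have h2 : (chartSymmDeriv x' y').comp (fderiv ℝ f y) = chartSymmDeriv x y := by
    have h3 := chartSymmDeriv_comp_tmap_chart hy''
    rw [hback] at h3
    rw [h1, ← ContinuousLinearMap.comp_assoc, h3, ContinuousLinearMap.id_comp]
  have h4 : chartGram K x y = Matrix.of fun i j => chartMetric K x' y'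
      (fderiv ℝ f y (realBasis E i)) (fderiv ℝ f y (realBasis E j)) := by
    rw [chartGram_eq, chartMetric, chartMetric, hback, ← h2]
    rfl
  rw [h4, gramOf_comp, Matrix.det_mul, Matrix.det_mul, Matrix.det_transpose,
    LinearMap.det_toMatrix, ← chartGram_eq]
  have h5 : LinearMap.det (fderiv ℝ f y).toLinearMap * (chartGram K x' y').det *
      LinearMap.det (fderiv ℝ f y).toLinearMap =
      (fderiv ℝ f y).det ^ 2 * (chartGram K x' y').det := by
    rw [ContinuousLinearMap.det]; ring
  rw [h5, Real.sqrt_mul (sq_nonneg _), Real.sqrt_sq_eq_abs]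

theorem chartVolume_eq_of_subset (x x' : M) {s : Set M} (hs : MeasurableSet s)
    (h : s ⊆ (extChartAt 𝓘(ℝ, E) x).source) (h' : s ⊆ (extChartAt 𝓘(ℝ, E) x').source) :
    chartVolume K x s = chartVolume K x' s := by
  rw [chartVolume_apply K x hs, chartVolume_apply K x' hs]
  set t := (extChartAt 𝓘(ℝ, E) x).target ∩ (extChartAt 𝓘(ℝ, E) x).symm ⁻¹' s with ht
  have htm : MeasurableSet t := measurableSet_chart_inter_preimage x hs
  have himg : (extChartAt 𝓘(ℝ, E) x').target ∩ (extChartAt 𝓘(ℝ, E) x').symm ⁻¹' s =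
      (extChartAt 𝓘(ℝ, E) x' ∘ (extChartAt 𝓘(ℝ, E) x).symm) '' t := by
    ext w
    constructor
    · rintro ⟨hw, hws⟩
      refine ⟨extChartAt 𝓘(ℝ, E) x ((extChartAt 𝓘(ℝ, E) x').symm w), ⟨?_, ?_⟩, ?_⟩
      · exact (extChartAt 𝓘(ℝ, E) x).map_source (h hws)
      · rw [Set.mem_preimage, (extChartAt 𝓘(ℝ, E) x).left_inv (h hws)]; exact hws
      · rw [Function.comp, (extChartAt 𝓘(ℝ, E) x).left_inv (h hws),
          (extChartAt 𝓘(ℝ, E) x').right_inv hw]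
    · rintro ⟨y, ⟨hy, hys⟩, rfl⟩
      refine ⟨(extChartAt 𝓘(ℝ, E) x').map_source (h' hys), ?_⟩
      rw [Set.mem_preimage, Function.comp, (extChartAt 𝓘(ℝ, E) x').left_inv (h' hys)]
      exact hys
  rw [himg, lintegral_image_eq_lintegral_abs_det_fderiv_mul _ htm
    (f' := fun y => fderiv ℝ (extChartAt 𝓘(ℝ, E) x' ∘ (extChartAt 𝓘(ℝ, E) x).symm) y)]
  · refine setLIntegral_congr_fun htm fun y hy => ?_
    simp only [chartDensity, Function.comp]
    rw [← ENNReal.ofReal_mul (abs_nonneg _), ← chartMetric_change K hy.1 (h' hy.2)]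
  · intro y hy
    refine HasFDerivAt.hasFDerivWithinAt (DifferentiableAt.hasFDerivAt ?_)
    exact (SmoothNear.comp (V' := E) (smoothNear_extChartAt (h' hy.2))
      (smoothNear_extChartAt_symm hy.1)).contDiffAt.differentiableAt (by simp)
  · intro y hy z hz hyz
    have h1 := (extChartAt 𝓘(ℝ, E) x').injOn (h' hy.2) (h' hz.2) hyz
    exact (extChartAt 𝓘(ℝ, E) x).symm.injOn hy.1 hz.1 h1

/-- On the overlap of two charts the two chart measures agree, so that a chart measure exceeds
another one only outside the domain of the latter. This bounds the supremum defining the volume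
measure on a chart domain. -/
theorem chartVolume_le (x i : M) :
    chartVolume K i ≤ chartVolume K x +
      (volumeMeasure K).restrict (extChartAt 𝓘(ℝ, E) x).sourceᶜ := by
  refine Measure.le_intro fun s hs _ => ?_
  set U := (extChartAt 𝓘(ℝ, E) x).source with hU
  have hUm : MeasurableSet U := (isOpen_extChartAt_source x).measurableSet
  have hUi : MeasurableSet (extChartAt 𝓘(ℝ, E) i).source :=
    (isOpen_extChartAt_source i).measurableSet
  rw [Measure.add_apply, Measure.restrict_apply hs, ← measure_inter_add_sdiff s hUm]
  refine add_le_add ?_ ?_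
  · have h1 : chartVolume K i (s ∩ U) = chartVolume K i (s ∩ U ∩ (extChartAt 𝓘(ℝ, E) i).source) := by
      rw [← measure_inter_add_sdiff (s ∩ U) hUi]
      have h2 : chartVolume K i ((s ∩ U) \ (extChartAt 𝓘(ℝ, E) i).source) = 0 :=
        measure_mono_null (fun z hz => hz.2) (chartVolume_compl_source K i)
      rw [h2, add_zero]
    rw [h1, chartVolume_eq_of_subset K i x ((hs.inter hUm).inter hUi) Set.inter_subset_right
      fun z hz => hz.1.2]
    exact measure_mono fun z hz => hz.1.1
  · rw [Set.sdiff_eq]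
    exact Measure.le_iff.1 (le_iSup (chartVolume K) i) _ (hs.inter hUm.compl)

/-- The volume measure restricts to each of the chart measures. -/
theorem volumeMeasure_restrict_source (x : M) :
    (volumeMeasure K).restrict (extChartAt 𝓘(ℝ, E) x).source = chartVolume K x := by
  set U := (extChartAt 𝓘(ℝ, E) x).source with hU
  have hUm : MeasurableSet U := (isOpen_extChartAt_source x).measurableSet
  have hle : volumeMeasure K ≤ chartVolume K x + (volumeMeasure K).restrict Uᶜ :=
    iSup_le fun i => chartVolume_le K x i
  ext s hs
  rw [Measure.restrict_apply hs]
  apply le_antisymm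
  · refine (Measure.le_iff.1 hle _ (hs.inter hUm)).trans ?_
    rw [Measure.add_apply, Measure.restrict_apply (hs.inter hUm), Set.inter_assoc,
      Set.inter_compl_self, Set.inter_empty, measure_empty, add_zero]
    exact measure_mono Set.inter_subset_left
  · rw [← measure_inter_add_sdiff s hUm]
    have h2 : chartVolume K x (s \ U) = 0 :=
      measure_mono_null (fun z hz => hz.2) (chartVolume_compl_source K x)
    rw [h2, add_zero]
    exact Measure.le_iff.1 (le_iSup (chartVolume K) x) _ (hs.inter hUm)

theorem setIntegral_source {h : M → ℝ} (hh : Continuous h) (x : M) :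
    ∫ z in (extChartAt 𝓘(ℝ, E) x).source, h z ∂(volumeMeasure K) =
      ∫ y in (extChartAt 𝓘(ℝ, E) x).target,
        √(chartGram K x y).det * h ((extChartAt 𝓘(ℝ, E) x).symm y) ∂(realBasis E).addHaar := by
  rw [volumeMeasure_restrict_source]
  refine (integral_map (aemeasurable_chart_symm K x) hh.aestronglyMeasurable).trans ?_
  rw [integral_withDensity_eq_integral_toReal_smul₀
    ((continuousOn_chartDensity K x).aemeasurable (measurableSet_target x))
    (Eventually.of_forall fun y => ENNReal.ofReal_lt_top)]
  refine integral_congr_ae (Eventually.of_forall fun y => ?_)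
  simp only [chartDensity, ENNReal.toReal_ofReal (Real.sqrt_nonneg _), smul_eq_mul]

instance isLocallyFiniteMeasure_volumeMeasure : IsLocallyFiniteMeasure (volumeMeasure K) := by
  refine ⟨fun x => ?_⟩
  have : ProperSpace E := FiniteDimensional.proper ℝ E
  set φ := extChartAt 𝓘(ℝ, E) x with hφ
  have hx : φ x ∈ φ.target := mem_extChartAt_target x
  obtain ⟨C, hC, hCc, hCt⟩ := exists_compact_subset (isOpen_extChartAt_target x) hx
  refine ⟨φ.source ∩ φ ⁻¹' interior C, ?_, ?_⟩
  · refine inter_mem (extChartAt_source_mem_nhds x) ?_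
    exact (continuousAt_extChartAt x).preimage_mem_nhds (isOpen_interior.mem_nhds hCc)
  · have ho : IsOpen (φ.source ∩ φ ⁻¹' interior C) :=
      (continuousOn_extChartAt x).isOpen_inter_preimage (isOpen_extChartAt_source x) isOpen_interior
    have h1 : volumeMeasure K (φ.source ∩ φ ⁻¹' interior C) =
        chartVolume K x (φ.source ∩ φ ⁻¹' interior C) := by
      rw [← volumeMeasure_restrict_source, Measure.restrict_apply ho.measurableSet,
        Set.inter_eq_left.2 Set.inter_subset_left]
    rw [h1, chartVolume_apply K x ho.measurableSet]
    refine lt_of_le_of_lt (lintegral_mono_set (t := C) ?_) ?_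
    · rintro y ⟨hy, hy2, hy3⟩
      rw [Set.mem_preimage, φ.right_inv hy] at hy3
      exact interior_subset hy3
    · obtain ⟨R, hR⟩ := hC.bddAbove_image (f := fun y => √(chartGram K x y).det)
        fun y hy => (Real.continuous_sqrt.continuousAt.comp
          (contDiffAt_det_chartGram K (hCt hy)).continuousAt).continuousWithinAt
      refine lt_of_le_of_lt (setLIntegral_mono' (g := fun _ => ENNReal.ofReal R) hC.measurableSet
        fun y hy => ENNReal.ofReal_le_ofReal (hR ⟨y, hy, rfl⟩)) ?_
      rw [setLIntegral_const]
      exact ENNReal.mul_lt_top ENNReal.ofReal_lt_top hC.measure_lt_top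

theorem integrable_of_continuous [CompactSpace M] {h : M → ℝ} (hh : Continuous h) :
    Integrable h (volumeMeasure K) :=
  hh.integrable_of_hasCompactSupport (HasCompactSupport.of_compactSpace h)

end Volume

/-! ### The divergence theorem -/

section Stokes

open Filter Topology MeasureTheory

variable {E M : Type*} [NormedAddCommGroup E] [NormedSpace ℂ E] [FiniteDimensional ℂ E]
  [TopologicalSpace M] [ChartedSpace E M] [IsManifold 𝓘(ℂ, E) ω M]
  (K : KahlerStructure E M)

theorem continuous_of_chart {h : M → ℝ}
    (H : ∀ x : M, ContinuousAt (fun y => h ((extChartAt 𝓘(ℝ, E) x).symm y))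
      (extChartAt 𝓘(ℝ, E) x x)) : Continuous h := by
  refine continuous_iff_continuousAt.2 fun x => ?_
  have h1 := ContinuousAt.comp (f := extChartAt 𝓘(ℝ, E) x) (x := x) (H x)
    (continuousAt_extChartAt (I := 𝓘(ℝ, E)) x)
  refine h1.congr ?_
  filter_upwards [extChartAt_source_mem_nhds (I := 𝓘(ℝ, E)) x] with z hz
  simp only [Function.comp, (extChartAt 𝓘(ℝ, E) x).left_inv hz]

theorem extD_zero {k : ℕ} {W : Type*} [NormedAddCommGroup W] [NormedSpace ℝ W]
    [FiniteDimensional ℝ W] (x : M) : extD (0 : M → E [⋀^Fin k]→L[ℝ] W) x = 0 := by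
  have h1 := extD_smul (0 : M → E [⋀^Fin k]→L[ℝ] W) 0 x
  rwa [zero_smul, zero_smul] at h1

/-- The contraction of `dθ` with the Kähler form. -/
def contrD (θ : M → E [⋀^Fin 1]→L[ℝ] ℝ) (x : M) : ℝ :=
  lam (realBasis E) (bivec (E := E) (gram K x)) (extD θ x)

theorem contrD_chart {θ : M → E [⋀^Fin 1]→L[ℝ] ℝ} (hθ : IsSmoothForm θ) {x : M} {y : E}
    (hy : y ∈ (extChartAt 𝓘(ℝ, E) x).target) :
    contrD K θ ((extChartAt 𝓘(ℝ, E) x).symm y) =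
      lam (realBasis E) (chartBivec K x y) (extDeriv (chartForm θ x) y) := by
  rw [contrD, lam_chart K hy, ← chartForm_extD hθ x hy]
  rfl

theorem continuous_contrD {θ : M → E [⋀^Fin 1]→L[ℝ] ℝ} (hθ : IsSmoothForm θ) :
    Continuous (contrD K θ) := by
  refine continuous_of_chart (E := E) fun x => ?_
  have hx := mem_extChartAt_target (I := 𝓘(ℝ, E)) x
  have h1 : ContDiffAt ℝ ∞ (fun y => lam (realBasis E) (chartBivec K x y)
      (extDeriv (chartForm θ x) y)) (extChartAt 𝓘(ℝ, E) x x) :=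
    contDiffAt_lam _ (contDiffAt_bivec K hx) (contDiffAt_extDeriv (isSmoothForm_iff.1 hθ x))
  refine h1.continuousAt.congr ?_
  filter_upwards [(isOpen_extChartAt_target x).mem_nhds hx] with y hy
  rw [contrD_chart K hθ hy]

theorem contrD_sum {ι : Type*} (s : Finset ι) (θ : ι → M → E [⋀^Fin 1]→L[ℝ] ℝ)
    (hθ : ∀ i, IsSmoothForm (θ i)) (x : M) :
    contrD K (fun x => ∑ i ∈ s, θ i x) x = ∑ i ∈ s, contrD K (θ i) x := by
  classical
  have hs : ∀ s : Finset ι, SmoothFormAt (fun x => ∑ i ∈ s, θ i x) x := fun s => by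
    have h : chartForm (fun x => ∑ i ∈ s, θ i x) x = fun y => ∑ i ∈ s, chartForm (θ i) x y := by
      ext y v
      simp [chartForm]
    rw [SmoothFormAt, h]
    exact ContDiffAt.sum fun i _ => isSmoothForm_iff.1 (hθ i) x
  induction s using Finset.induction_on with
  | empty =>
    have h0 : (fun x => ∑ i ∈ (∅ : Finset ι), θ i x) = 0 := by ext; simp
    rw [h0, Finset.sum_empty, contrD, extD_zero]
    exact lam_zero _ _
  | insert i s hi ih =>
    rw [Finset.sum_insert hi, ← ih]
    have h0 : (fun x => ∑ j ∈ insert i s, θ j x) = θ i + fun x => ∑ j ∈ s, θ j x := by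
      ext1 z
      rw [Finset.sum_insert hi]
      rfl
    rw [contrD, h0, extD_add (isSmoothForm_iff.1 (hθ i) x) (hs s)]
    exact lam_add _ _ _ _

theorem chartForm_smul_fun (ρ : M → ℝ) (θ : M → E [⋀^Fin 1]→L[ℝ] ℝ) (x : M) (y : E) :
    chartForm (fun z => ρ z • θ z) x y = ρ ((extChartAt 𝓘(ℝ, E) x).symm y) • chartForm θ x y := by
  ext v; rfl

theorem isSmoothForm_smul {ρ : M → ℝ} (hρ : ContMDiff 𝓘(ℝ, E) 𝓘(ℝ, ℝ) ∞ ρ)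
    {θ : M → E [⋀^Fin 1]→L[ℝ] ℝ} (hθ : IsSmoothForm θ) : IsSmoothForm fun z => ρ z • θ z := by
  intro x y hy
  refine ContDiffAt.contDiffWithinAt ?_
  simp only [funext fun y => chartForm_smul_fun ρ θ x y]
  exact (hρ.contMDiffAt.comp y (smoothNear_extChartAt_symm hy).contMDiffAt).contDiffAt.smul
    ((hθ x).contDiffAt ((isOpen_extChartAt_target x).mem_nhds hy))

variable [MeasurableSpace E] [BorelSpace E] [MeasurableSpace M] [BorelSpace M]

/-- The integral of a derivative of a compactly supported function vanishes. -/
theorem integral_fderiv_eq_zero {X : E → ℝ} (hX : ContDiff ℝ 1 X) (hc : HasCompactSupport X)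
    (v : E) : ∫ y, fderiv ℝ X y v ∂(realBasis E).addHaar = 0 := by
  have h1 : Continuous fun y => fderiv ℝ X y v :=
    (hX.continuous_fderiv one_ne_zero).clm_apply continuous_const
  have h2 : HasCompactSupport fun y => fderiv ℝ X y v := hc.fderiv_apply ℝ v
  have h := integral_mul_fderiv_eq_neg_fderiv_mul_of_integrable (μ := (realBasis E).addHaar)
    (𝕜 := ℝ) (f := fun _ => (1 : ℝ)) (g := X) (v := v) (by simp)
    (by simpa using h1.integrable_of_hasCompactSupport h2)
    (by simpa using hX.continuous.integrable_of_hasCompactSupport hc)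
    (fun x _ => differentiableAt_const _) (fun x _ => hX.differentiable one_ne_zero x)
  simpa using h

variable [CompactSpace M] [T2Space M]

/-- The divergence theorem for a form supported in a chart. -/
theorem integral_contrD_of_support {θ : M → E [⋀^Fin 1]→L[ℝ] ℝ} (hθ : IsSmoothForm θ) (x : M)
    {C : Set M} (hC : IsClosed C) (hCs : C ⊆ (extChartAt 𝓘(ℝ, E) x).source)
    (h0 : ∀ z ∉ C, θ z = 0) : ∫ z, contrD K θ z ∂(volumeMeasure K) = 0 := by
  classical
  set φ := extChartAt 𝓘(ℝ, E) x with hφ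
  set T := φ.target with hT
  have h1 : ∀ z ∉ C, contrD K θ z = 0 := fun z hz => by
    have h2 : θ =ᶠ[𝓝 z] fun _ => 0 := by
      filter_upwards [hC.isOpen_compl.mem_nhds hz] with w hw using h0 w hw
    rw [contrD, (extD_congr h2).trans (extD_zero z)]
    exact lam_zero _ _
  have h2 : ∫ z, contrD K θ z ∂(volumeMeasure K) = ∫ z in φ.source, contrD K θ z ∂(volumeMeasure K) := by
    rw [setIntegral_eq_integral_of_forall_compl_eq_zero]
    exact fun z hz => h1 z fun hzC => hz (hCs hzC)
  rw [h2, setIntegral_source K (continuous_contrD K hθ)]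
  -- `X` is the vector field `√(det g) P^{ik} θ_k`, extended by zero outside the chart; the density
  -- times `Λ dθ` is its coordinate divergence.
  let X : Fin (Module.finrank ℝ E) → E → ℝ := fun i => T.indicator fun y =>
    ∑ k, √(chartGram K x y).det * chartBivec K x y i k * chartForm θ x y ![realBasis E k]
  have hCc : IsCompact (φ '' C) :=
    (hC.isCompact).image_of_continuousOn ((continuousOn_extChartAt x).mono hCs)
  have hX0 : ∀ i, ∀ y ∉ φ '' C, X i y = 0 := fun i y hy => by
    by_cases hyT : y ∈ T
    · simp only [X, Set.indicator_of_mem hyT]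
      refine Finset.sum_eq_zero fun k _ => ?_
      have h3 : chartForm θ x y = 0 := by
        rw [chartForm, h0]
        · ext; rfl
        · exact fun h => hy ⟨_, h, φ.right_inv hyT⟩
      rw [h3]
      exact mul_zero _
    · simp only [X, Set.indicator_of_notMem hyT]
  have hXT : ∀ i, ∀ y ∈ T, X i =ᶠ[𝓝 y] fun y =>
      ∑ k, √(chartGram K x y).det * chartBivec K x y i k * chartForm θ x y ![realBasis E k] :=
    fun i y hy => by
      filter_upwards [(isOpen_extChartAt_target x).mem_nhds hy] with z hz
      simp only [X, Set.indicator_of_mem (show z ∈ T from hz)]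
  have hXs : ∀ i, ContDiff ℝ 1 (X i) := fun i => contDiff_iff_contDiffAt.2 fun y => by
    by_cases hy : y ∈ φ '' C
    · have hyT : y ∈ T := by
        obtain ⟨z, hz, rfl⟩ := hy
        exact φ.map_source (hCs hz)
      refine ContDiffAt.congr_of_eventuallyEq ?_ (hXT i y hyT)
      refine ContDiffAt.of_le (n := ∞) (ContDiffAt.sum fun k _ => ?_) (by simp)
      refine (((contDiffAt_det_chartGram K hyT).sqrt
        (isHermGram_chartGram K hyT).det_pos.ne').mul (contDiffAt_bivec K hyT i k)).mul ?_
      exact (ContinuousAlternatingMap.apply ℝ E ℝ ![realBasis E k]).contDiff.contDiffAt.comp y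
        ((hθ x).contDiffAt ((isOpen_extChartAt_target x).mem_nhds hyT))
    · have : X i =ᶠ[𝓝 y] fun _ => 0 := by
        filter_upwards [hCc.isClosed.isOpen_compl.mem_nhds hy] with z hz using hX0 i z hz
      exact contDiffAt_const.congr_of_eventuallyEq this
  have hXc : ∀ i, HasCompactSupport (X i) := fun i => HasCompactSupport.intro hCc (hX0 i)
  have h3 : ∀ y ∈ T, √(chartGram K x y).det * contrD K θ (φ.symm y) =
      ∑ i, fderiv ℝ (X i) y (realBasis E i) := fun y hy => by
    rw [contrD_chart K hθ hy, sqrt_det_mul_lam_extDeriv K hy (((hθ x).contDiffAt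
      ((isOpen_extChartAt_target x).mem_nhds hy)).differentiableAt (by simp))]
    exact Finset.sum_congr rfl fun i _ => by rw [(hXT i y hy).fderiv_eq]
  have h4 : ∫ y in T, √(chartGram K x y).det * contrD K θ (φ.symm y) ∂(realBasis E).addHaar =
      ∫ y in T, ∑ i, fderiv ℝ (X i) y (realBasis E i) ∂(realBasis E).addHaar :=
    setIntegral_congr_fun (measurableSet_target x) h3
  rw [h4, setIntegral_eq_integral_of_forall_compl_eq_zero, integral_finsetSum]
  · exact Finset.sum_eq_zero fun i _ => integral_fderiv_eq_zero (hXs i) (hXc i) _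
  · intro i _
    exact (((hXs i).continuous_fderiv one_ne_zero).clm_apply
      continuous_const).integrable_of_hasCompactSupport ((hXc i).fderiv_apply ℝ _)
  · intro y hy
    refine Finset.sum_eq_zero fun i _ => ?_
    have : X i =ᶠ[𝓝 y] fun _ => 0 := by
      have hyC : y ∉ φ '' C := fun ⟨z, hz, hzy⟩ => hy (hzy ▸ φ.map_source (hCs hz))
      filter_upwards [hCc.isClosed.isOpen_compl.mem_nhds hyC] with z hz using hX0 i z hz
    rw [this.fderiv_eq]
    simp

/-- The divergence theorem: the contraction of an exact two-form with the Kähler form has mean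
value zero. -/
theorem integral_contrD {θ : M → E [⋀^Fin 1]→L[ℝ] ℝ} (hθ : IsSmoothForm θ) :
    ∫ z, contrD K θ z ∂(volumeMeasure K) = 0 := by
  obtain ⟨ρ, hρ⟩ := SmoothPartitionOfUnity.exists_isSubordinate_chartAt_source 𝓘(ℝ, E) M
  have hfin : {i | (Function.support (ρ i)).Nonempty}.Finite :=
    ρ.locallyFinite.finite_nonempty_of_compact
  let s := hfin.toFinset
  have h1 : θ = fun z => ∑ i ∈ s, ρ i z • θ z := by
    ext1 z
    rw [← Finset.sum_smul]
    have h2 := ρ.sum_eq_one (Set.mem_univ z)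
    rw [finsum_eq_sum_of_support_subset (s := s)] at h2
    · rw [h2, one_smul]
    · intro i hi
      simp only [s, Set.Finite.coe_toFinset]
      exact ⟨z, hi⟩
  have hs : ∀ i, IsSmoothForm fun z => ρ i z • θ z := fun i => isSmoothForm_smul (ρ i).contMDiff hθ
  have h2 : ∀ z, contrD K θ z = ∑ i ∈ s, contrD K (fun z => ρ i z • θ z) z := fun z => by
    conv_lhs => rw [h1]
    rw [contrD_sum K s (fun i z => ρ i z • θ z) hs]
  simp only [h2]
  rw [integral_finsetSum]
  · refine Finset.sum_eq_zero fun i _ => integral_contrD_of_support K (hs i) i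
      (isClosed_tsupport (ρ i)) ?_ fun z hz => ?_
    · rw [extChartAt_source]; exact hρ i
    · rw [image_eq_zero_of_notMem_tsupport hz, zero_smul]
  · exact fun i _ => integrable_of_continuous K (continuous_contrD K (hs i))

end Stokes

/-! ### Operations on `Ad P`-valued forms -/

section AdForms

open Filter Topology

variable {E EP EG M P G : Type*}
  [NormedAddCommGroup E] [NormedSpace ℂ E] [FiniteDimensional ℂ E]
  [NormedAddCommGroup EP] [NormedSpace ℝ EP] [FiniteDimensional ℝ EP]
  [NormedAddCommGroup EG] [NormedSpace ℝ EG] [FiniteDimensional ℝ EG]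
  [TopologicalSpace M] [ChartedSpace E M] [IsManifold 𝓘(ℂ, E) ω M]
  [TopologicalSpace P] [ChartedSpace EP P] [IsManifold 𝓘(ℝ, EP) ∞ P]
  [TopologicalSpace G] [ChartedSpace EG G] [Group G] [LieGroup 𝓘(ℝ, EG) ∞ G]
  {Q : PrincipalBundle E EP EG M P G} {k : ℕ}

/-- `G` acts transitively on the fibres. -/
theorem PrincipalBundle.exists_act_eq (Q : PrincipalBundle E EP EG M P G) {p q : P}
    (h : Q.proj p = Q.proj q) : ∃ g, Q.act p g = q := by
  obtain ⟨U, e, -, hx, hs, -, -, -, he⟩ := Q.locally_trivial (Q.proj p)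
  have hp : p ∈ e.source := by rw [hs]; exact hx
  have hq : q ∈ e.source := by rw [hs, Set.mem_preimage, ← h]; exact hx
  refine ⟨(e p).2⁻¹ * (e q).2, e.injOn ?_ hq ?_⟩
  · rw [hs, Set.mem_preimage, Q.proj_act]; exact hx
  · rw [(he p hp).2, mul_inv_cancel_left]
    exact Prod.ext ((he p hp).1.trans (h.trans (he q hq).1.symm)) rfl

theorem PrincipalBundle.proj_pt (Q : PrincipalBundle E EP EG M P G) (x : M) :
    Q.proj (Q.pt x) = x := Function.surjInv_eq Q.surjective x

theorem IsAdForm.act_eq {α : P → E [⋀^Fin k]→L[ℝ] EG} (h : IsAdForm Q α) (p : P) (g : G) :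
    α (Q.act p g) = (Ad EG g⁻¹).compContinuousAlternatingMap (α p) := by
  ext v
  exact h.equivariant p g v

theorem IsAdForm.add {α β : P → E [⋀^Fin k]→L[ℝ] EG} (hα : IsAdForm Q α) (hβ : IsAdForm Q β) :
    IsAdForm Q (α + β) where
  equivariant p g v := by
    rw [Pi.add_apply, Pi.add_apply, ContinuousAlternatingMap.add_apply,
      ContinuousAlternatingMap.add_apply, hα.equivariant, hβ.equivariant, map_add]
  smooth := isSmoothForm_iff.2 fun p =>
    (isSmoothForm_iff.1 hα.smooth p).add (isSmoothForm_iff.1 hβ.smooth p)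

theorem IsAdForm.smul {α : P → E [⋀^Fin k]→L[ℝ] EG} (hα : IsAdForm Q α) (c : ℝ) :
    IsAdForm Q (c • α) where
  equivariant p g v := by
    rw [Pi.smul_apply, Pi.smul_apply, ContinuousAlternatingMap.smul_apply,
      ContinuousAlternatingMap.smul_apply, hα.equivariant, map_smul]
  smooth := isSmoothForm_iff.2 fun p => (isSmoothForm_iff.1 hα.smooth p).smul c

theorem isAdForm_zero : IsAdForm Q (0 : P → E [⋀^Fin k]→L[ℝ] EG) where
  equivariant _ g _ := (map_zero (Ad EG g⁻¹)).symm
  smooth := isSmoothForm_iff.2 fun _ => contDiffAt_const (c := 0)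

theorem covD_add {α β : P → E [⋀^Fin k]→L[ℝ] EG} (hα : IsAdForm Q α) (hβ : IsAdForm Q β)
    (A : P → EP [⋀^Fin 1]→L[ℝ] EG) : covD Q A (α + β) = covD Q A α + covD Q A β := by
  ext1 p
  have h : toP Q (α + β) = toP Q α + toP Q β := rfl
  rw [covD, h, extD_add (isSmoothForm_iff.1 hα.smooth p) (isSmoothForm_iff.1 hβ.smooth p)]
  rfl

theorem covD_smul (α : P → E [⋀^Fin k]→L[ℝ] EG) (c : ℝ)
    (A : P → EP [⋀^Fin 1]→L[ℝ] EG) : covD Q A (c • α) = c • covD Q A α := by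
  ext1 p
  have h : toP Q (c • α) = c • toP Q α := rfl
  rw [covD, h, extD_smul]
  rfl

/-- The form `(v₁, …, v_k) ↦ α(z v₁, …, z v_k)`. -/
def pullR (z : ℂ) (α : P → E [⋀^Fin k]→L[ℝ] EG) (p : P) : E [⋀^Fin k]→L[ℝ] EG :=
  (α p).compContinuousLinearMap (mulC z)

theorem IsAdForm.pullR {α : P → E [⋀^Fin k]→L[ℝ] EG} (hα : IsAdForm Q α) (z : ℂ) :
    IsAdForm Q (pullR z α) where
  equivariant p g v := hα.equivariant p g _
  smooth := isSmoothForm_iff.2 fun p => by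
    obtain ⟨c⟩ := AdaptedCoord.nonempty Q p
    refine c.smoothFormAt ?_
    have h1 := c.contDiffAt_loc (isSmoothForm_iff.1 hα.smooth p)
    refine (contDiffAt_form_comp h1 (contDiffAt_const (c := mulC z))).congr_of_eventuallyEq ?_
    have h2 : ∀ᶠ y in 𝓝 (Q.base p), y ∈ (extChartAt 𝓘(ℝ, E) (Q.proj p)).target :=
      (isOpen_extChartAt_target (Q.proj p)).mem_nhds (mem_extChartAt_target (Q.proj p))
    filter_upwards [(continuous_fst.tendsto (Q.base p, (0 : EG))).eventually h2] with y hy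
    ext v
    exact congrArg (α (c.toFun y)) (funext fun i => (chartSymmDeriv_mulC hy z (v i)).symm)

variable (K : KahlerStructure E M) (B : AdInvariantInner EG G)

/-- The section of `Ad P` obtained by contracting a two-form with the Kähler form. -/
def lamForm (Q : PrincipalBundle E EP EG M P G) (F : P → E [⋀^Fin 2]→L[ℝ] EG) (p : P) :
    E [⋀^Fin 0]→L[ℝ] EG :=
  ContinuousAlternatingMap.constOfIsEmpty ℝ E (Fin 0) (lefschetzLambda K (Q.proj p) (F p))

theorem lamForm_apply (F : P → E [⋀^Fin 2]→L[ℝ] EG) (p : P) (v : Fin 0 → E) :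
    lamForm K Q F p v = lefschetzLambda K (Q.proj p) (F p) := rfl

theorem lam_comp {V W W' ι : Type*} [NormedAddCommGroup V] [NormedSpace ℝ V]
    [FiniteDimensional ℝ V] [NormedAddCommGroup W] [NormedSpace ℝ W] [FiniteDimensional ℝ W]
    [NormedAddCommGroup W'] [NormedSpace ℝ W'] [FiniteDimensional ℝ W'] [Fintype ι]
    (e : Module.Basis ι ℝ V) (H : Matrix ι ι ℝ) (L : W →L[ℝ] W') (α : V [⋀^Fin 2]→L[ℝ] W) :
    lam e H (L.compContinuousAlternatingMap α) = L (lam e H α) := by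
  simp [lam]

theorem IsAdForm.lamForm {F : P → E [⋀^Fin 2]→L[ℝ] EG} (hF : IsAdForm Q F) :
    IsAdForm Q (lamForm K Q F) where
  equivariant p g v := by
    rw [lamForm_apply, lamForm_apply, Q.proj_act, hF.act_eq, lefschetzLambda_eq, lam_comp,
      lefschetzLambda_eq]
  smooth := isSmoothForm_iff.2 fun p => by
    obtain ⟨c⟩ := AdaptedCoord.nonempty Q p
    refine c.smoothFormAt (contDiffAt_form fun v => ?_)
    have h1 := c.contDiffAt_loc (isSmoothForm_iff.1 hF.smooth p)
    have hx := mem_extChartAt_target (I := 𝓘(ℝ, E)) (Q.proj p)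
    have hP : ∀ i j, ContDiffAt ℝ ∞ (fun z : E × EG => chartBivec K (Q.proj p) z.1 i j)
        (Q.base p, 0) := fun i j =>
      ContDiffAt.comp (g := fun y => chartBivec K (Q.proj p) y i j) (f := Prod.fst)
        (Q.base p, (0 : EG)) (contDiffAt_bivec K hx i j) contDiffAt_fst
    refine (contDiffAt_lam (realBasis E) hP h1).congr_of_eventuallyEq ?_
    have h2 : ∀ᶠ y in 𝓝 (Q.base p), y ∈ (extChartAt 𝓘(ℝ, E) (Q.proj p)).target :=
      (isOpen_extChartAt_target (Q.proj p)).mem_nhds hx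
    filter_upwards [(continuous_fst.tendsto (Q.base p, (0 : EG))).eventually h2,
      c.proj_toFun] with z hz hp
    refine (congrArg (fun x => lefschetzLambda K x (F (c.toFun z))) hp).trans ?_
    exact lefschetzLambda_chart K hz _

/-! ### Invariance of the pointwise inner products -/

theorem contr_compCLM {V W W' ι : Type*} [NormedAddCommGroup V] [NormedSpace ℝ V]
    [FiniteDimensional ℝ V] [NormedAddCommGroup W] [NormedSpace ℝ W] [FiniteDimensional ℝ W]
    [NormedAddCommGroup W'] [NormedSpace ℝ W'] [FiniteDimensional ℝ W'] [Fintype ι]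
    (e : Module.Basis ι ℝ V) (H : Matrix ι ι ℝ) (L : W →L[ℝ] W') (b : W' →L[ℝ] W' →L[ℝ] ℝ)
    (b' : W →L[ℝ] W →L[ℝ] ℝ) (h : ∀ X Y, b (L X) (L Y) = b' X Y) (α β : V [⋀^Fin k]→L[ℝ] W) :
    contr e H b (L.compContinuousAlternatingMap α) (L.compContinuousAlternatingMap β) =
      contr e H b' α β := by
  simp [contr, h]

theorem IsAdForm.formInner_eq {α β : P → E [⋀^Fin k]→L[ℝ] EG} (hα : IsAdForm Q α)
    (hβ : IsAdForm Q β) (x : M) {p q : P} (h : Q.proj p = Q.proj q) :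
    formInner K B x (α p) (β p) = formInner K B x (α q) (β q) := by
  obtain ⟨g, rfl⟩ := Q.exists_act_eq h
  rw [hα.act_eq, hβ.act_eq, KahlerYM.formInner_eq, KahlerYM.formInner_eq,
    contr_compCLM _ _ _ _ _ (B.invariant g⁻¹)]

theorem IsAdForm.formInner_pt {α β : P → E [⋀^Fin k]→L[ℝ] EG} (hα : IsAdForm Q α)
    (hβ : IsAdForm Q β) (p : P) :
    formInner K B (Q.proj p) (α (Q.pt (Q.proj p))) (β (Q.pt (Q.proj p))) =
      formInner K B (Q.proj p) (α p) (β p) :=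
  hα.formInner_eq K B hβ _ (Q.proj_pt _)

theorem continuous_formInner {α β : P → E [⋀^Fin k]→L[ℝ] EG} (hα : IsAdForm Q α)
    (hβ : IsAdForm Q β) : Continuous fun x => formInner K B x (α (Q.pt x)) (β (Q.pt x)) := by
  refine continuous_of_chart (E := E) fun x => ?_
  obtain ⟨p, rfl⟩ := Q.surjective x
  obtain ⟨σ⟩ := LocalSection.nonempty (Q := Q) p
  have hx := mem_extChartAt_target (I := 𝓘(ℝ, E)) (Q.proj p)
  have h1 : ContinuousAt (fun y => (k.factorial : ℝ)⁻¹ * contr (realBasis E)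
      (chartGram K (Q.proj p) y)⁻¹ B.inner (σ.loc α y) (σ.loc β y)) (Q.base p) :=
    (contDiffAt_const.mul (contDiffAt_contr _ B.inner (contDiffAt_inv_chartGram K hx)
      (σ.contDiffAt_loc hα) (σ.contDiffAt_loc hβ))).continuousAt
  refine h1.congr ?_
  filter_upwards [(isOpen_extChartAt_target (Q.proj p)).mem_nhds hx, σ.proj_toFun] with y hy hp
  rw [LocalSection.loc, LocalSection.loc, ← formInner_chart K B hy, ← hp, hα.formInner_pt K B hβ]

section Bilinear

variable (x : M) (α α' β β' : E [⋀^Fin k]→L[ℝ] EG) (c : ℝ)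

theorem formInner_add_left : formInner K B x (α + α') β =
    formInner K B x α β + formInner K B x α' β := by
  simp only [formInner_eq, contr_add_left, mul_add]

theorem formInner_smul_left : formInner K B x (c • α) β = c * formInner K B x α β := by
  simp only [formInner_eq, contr_smul_left, smul_eq_mul]
  ring

theorem formInner_symm : formInner K B x α β = formInner K B x β α := by
  rw [formInner_eq, formInner_eq, contr_flip, (isHermGram_gram K x).inv_symm]
  congr 2
  ext X Y
  exact B.symm Y X

theorem formInner_self_nonneg : 0 ≤ formInner K B x α α := by
  rw [formInner_eq]
  refine mul_nonneg (by positivity) (contr_self_nonneg _ (isHermGram_gram K x).posDef.inv _ ?_ _)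
  intro X
  by_cases h : X = 0
  · simp [h]
  · exact (B.pos X h).le

theorem formInner_zero (α β : E [⋀^Fin 0]→L[ℝ] EG) :
    formInner K B x α β = B.inner (α 0) (β 0) := by
  simp [formInner_eq, contr_zero]

theorem contr_mulC (C C' : E →L[ℝ] E) (α β : E [⋀^Fin k]→L[ℝ] EG)
    (H H' : Matrix (Fin (Module.finrank ℝ E)) (Fin (Module.finrank ℝ E)) ℝ)
    (h : LinearMap.toMatrix (realBasis E) (realBasis E) C.toLinearMap * H *
      (LinearMap.toMatrix (realBasis E) (realBasis E) C'.toLinearMap).transpose = H') :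
    contr (realBasis E) H B.inner (α.compContinuousLinearMap C) (β.compContinuousLinearMap C') =
      contr (realBasis E) H' B.inner α β := by
  rw [contr_comp (realBasis E) (realBasis E), h]

theorem formInner_comp_I : formInner K B x α (β.compContinuousLinearMap (mulC Complex.I)) =
    (k.factorial : ℝ)⁻¹ * contr (realBasis E) (bivec (E := E) (gram K x)) B.inner α β := by
  rw [formInner_eq]
  congr 1
  refine Eq.trans ?_ (contr_mulC B (ContinuousLinearMap.id ℝ E) (mulC Complex.I) α β
    (gram K x)⁻¹ _ ?_)
  · congr 1
  · rw [bivec, ContinuousLinearMap.coe_id, LinearMap.toMatrix_id, Matrix.one_mul]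
    rfl

theorem formInner_neg_I_comp :
    formInner K B x (α.compContinuousLinearMap (mulC (-Complex.I))) β =
      formInner K B x α (β.compContinuousLinearMap (mulC Complex.I)) := by
  rw [formInner_comp_I, formInner_eq]
  congr 1
  refine Eq.trans ?_ (contr_mulC B (mulC (-Complex.I)) (ContinuousLinearMap.id ℝ E) α β
    (gram K x)⁻¹ _ ?_)
  · congr 1
  · have h : (mulC (-Complex.I) : E →L[ℝ] E) = -mulC Complex.I := by
      ext v
      simp [mulC_apply]
    rw [ContinuousLinearMap.coe_id, LinearMap.toMatrix_id, Matrix.transpose_one, Matrix.mul_one, h]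
    have h2 : LinearMap.toMatrix (realBasis E) (realBasis E)
        (-mulC Complex.I : E →L[ℝ] E).toLinearMap = -cplx E := by
      rw [cplx, ← map_neg]
      rfl
    rw [h2, Matrix.neg_mul, (isHermGram_gram K x).cplx_mul_inv, neg_neg]

end Bilinear

end AdForms

/-! ### Two integration by parts formulas on a Kähler manifold -/

section Parts

open Filter Topology

section CrossForm

variable {V ι : Type*} [NormedAddCommGroup V] [NormedSpace ℝ V] [FiniteDimensional ℝ V] [Fintype ι]
  {W W₁ W₂ : Type*} [NormedAddCommGroup W] [NormedSpace ℝ W] [FiniteDimensional ℝ W]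
  [NormedAddCommGroup W₁] [NormedSpace ℝ W₁] [FiniteDimensional ℝ W₁]
  [NormedAddCommGroup W₂] [NormedSpace ℝ W₂] [FiniteDimensional ℝ W₂]

/-- The one-form `v ↦ b(γ(v), P ⌟ F) - P^{jl} b(γ_j, F(v, e_l))` built from a bivector `P`, a
one-form `γ` and a two-form `F`. -/
def crossForm (e : Module.Basis ι ℝ V) (P : Matrix ι ι ℝ) (b : W₁ →L[ℝ] W₂ →L[ℝ] ℝ)
    (γ : V [⋀^Fin 1]→L[ℝ] W₁) (F : V [⋀^Fin 2]→L[ℝ] W₂) : V [⋀^Fin 1]→L[ℝ] ℝ :=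
  ContinuousAlternatingMap.ofSubsingleton ℝ V ℝ (0 : Fin 1)
    ((b.flip (lam e P F)).comp ((ContinuousAlternatingMap.ofSubsingleton ℝ V W₁ (0 : Fin 1)).symm γ)
      - ∑ j, ∑ l, P j l • (b (γ ![e j])).comp
        ((ContinuousAlternatingMap.apply ℝ V W₂ ![e l]).comp F.curryLeft))

theorem ofSubsingleton_symm_apply (γ : V [⋀^Fin 1]→L[ℝ] W) (v : V) :
    (ContinuousAlternatingMap.ofSubsingleton ℝ V W (0 : Fin 1)).symm γ v = γ ![v] :=
  congrArg γ (funext fun i => by fin_cases i; rfl)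

theorem crossForm_apply (e : Module.Basis ι ℝ V) (P : Matrix ι ι ℝ) (b : W₁ →L[ℝ] W₂ →L[ℝ] ℝ)
    (γ : V [⋀^Fin 1]→L[ℝ] W₁) (F : V [⋀^Fin 2]→L[ℝ] W₂) (v : V) :
    crossForm e P b γ F ![v] = b (γ ![v]) (lam e P F) -
      ∑ j, ∑ l, P j l * b (γ ![e j]) (F ![v, e l]) := by
  have h : crossForm e P b γ F ![v] = ((b.flip (lam e P F)).comp
      ((ContinuousAlternatingMap.ofSubsingleton ℝ V W₁ (0 : Fin 1)).symm γ)
      - ∑ j, ∑ l, P j l • (b (γ ![e j])).comp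
        ((ContinuousAlternatingMap.apply ℝ V W₂ ![e l]).comp F.curryLeft)) v := rfl
  rw [h, sub_apply, ContinuousLinearMap.comp_apply, ofSubsingleton_symm_apply]
  simp only [sum_apply, smul_apply, smul_eq_mul]
  rfl

theorem crossForm_compCLM (e : Module.Basis ι ℝ V) (P : Matrix ι ι ℝ) (L : W →L[ℝ] W₁)
    (b : W₁ →L[ℝ] W₁ →L[ℝ] ℝ) (b' : W →L[ℝ] W →L[ℝ] ℝ) (h : ∀ X Y, b (L X) (L Y) = b' X Y)
    (γ : V [⋀^Fin 1]→L[ℝ] W) (F : V [⋀^Fin 2]→L[ℝ] W) :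
    crossForm e P b (L.compContinuousAlternatingMap γ) (L.compContinuousAlternatingMap F) =
      crossForm e P b' γ F :=
  form_one_ext fun v => by
    rw [crossForm_apply, crossForm_apply, lam_comp]
    simp only [ContinuousLinearMap.compContinuousAlternatingMap_coe, Function.comp_apply, h]

end CrossForm

variable {E EP EG M P G : Type*}
  [NormedAddCommGroup E] [NormedSpace ℂ E] [FiniteDimensional ℂ E]
  [NormedAddCommGroup EP] [NormedSpace ℝ EP] [FiniteDimensional ℝ EP]
  [NormedAddCommGroup EG] [NormedSpace ℝ EG] [FiniteDimensional ℝ EG]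
  [TopologicalSpace M] [ChartedSpace E M] [IsManifold 𝓘(ℂ, E) ω M]
  [TopologicalSpace P] [ChartedSpace EP P] [IsManifold 𝓘(ℝ, EP) ∞ P]
  [TopologicalSpace G] [ChartedSpace EG G] [Group G] [LieGroup 𝓘(ℝ, EG) ∞ G]
  {Q : PrincipalBundle E EP EG M P G} {k : ℕ}
  (K : KahlerStructure E M) (B : AdInvariantInner EG G)

section Bivector

variable {W₁ W₂ W₃ : Type*} [NormedAddCommGroup W₁] [NormedSpace ℝ W₁]
  [FiniteDimensional ℝ W₁] [NormedAddCommGroup W₂] [NormedSpace ℝ W₂] [FiniteDimensional ℝ W₂]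
  [NormedAddCommGroup W₃] [NormedSpace ℝ W₃]

theorem contr_bivec (H : Matrix (Fin (Module.finrank ℝ E)) (Fin (Module.finrank ℝ E)) ℝ)
    (b : W₁ →L[ℝ] W₂ →L[ℝ] W₃) (α : E [⋀^Fin k]→L[ℝ] W₁) (β : E [⋀^Fin k]→L[ℝ] W₂) :
    contr (realBasis E) (bivec (E := E) H) b α β =
      contr (realBasis E) H⁻¹ b α (β.compContinuousLinearMap (mulC Complex.I)) := by
  have h := contr_comp (realBasis E) (realBasis E) H⁻¹ b (ContinuousLinearMap.id ℝ E)
    (mulC Complex.I) α β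
  rw [ContinuousLinearMap.coe_id, LinearMap.toMatrix_id, Matrix.one_mul] at h
  exact h.symm

/-- Contractions with the Poisson bivector do not depend on the coordinates. -/
theorem contr_bivec_chart (b : W₁ →L[ℝ] W₂ →L[ℝ] W₃) {x : M} {y : E}
    (hy : y ∈ (extChartAt 𝓘(ℝ, E) x).target)
    (α : E [⋀^Fin k]→L[ℝ] W₁) (β : E [⋀^Fin k]→L[ℝ] W₂) :
    contr (realBasis E) (bivec (E := E) (gram K ((extChartAt 𝓘(ℝ, E) x).symm y))) b α β =
      contr (realBasis E) (chartBivec K x y) b (α.compContinuousLinearMap (chartSymmDeriv x y))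
        (β.compContinuousLinearMap (chartSymmDeriv x y)) := by
  rw [contr_bivec, contr_bivec, contr_gram_eq K b hy]
  congr 1
  ext v
  exact congrArg β (funext fun i => (chartSymmDeriv_mulC hy Complex.I (v i)).symm)

theorem crossForm_chart (b : W₁ →L[ℝ] W₂ →L[ℝ] ℝ) {x : M} {y : E}
    (hy : y ∈ (extChartAt 𝓘(ℝ, E) x).target)
    (γ : E [⋀^Fin 1]→L[ℝ] W₁) (F : E [⋀^Fin 2]→L[ℝ] W₂) :
    (crossForm (realBasis E) (bivec (E := E) (gram K ((extChartAt 𝓘(ℝ, E) x).symm y))) b γ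
        F).compContinuousLinearMap (chartSymmDeriv x y) =
      crossForm (realBasis E) (chartBivec K x y) b
        (γ.compContinuousLinearMap (chartSymmDeriv x y))
        (F.compContinuousLinearMap (chartSymmDeriv x y)) := by
  refine form_one_ext fun v => ?_
  rw [comp_one_apply, crossForm_apply, crossForm_apply, lam_chart K hy, comp_one_apply]
  congr 1
  have h1 : ∀ (H : Matrix (Fin (Module.finrank ℝ E)) (Fin (Module.finrank ℝ E)) ℝ)
      (γ : E [⋀^Fin 1]→L[ℝ] W₁) (F : E [⋀^Fin 2]→L[ℝ] W₂) (u : E),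
      ∑ j, ∑ l, H j l * b (γ ![realBasis E j]) (F ![u, realBasis E l]) =
        contr (realBasis E) H b γ (F.curryLeft u) := fun H γ F u => by
    rw [contr_one]
    rfl
  rw [h1, h1, contr_bivec_chart K b hy, ContinuousAlternatingMap.curryLeft_compContinuousLinearMap]

end Bivector

/-- A form on `M` given by a family of forms which is constant along the fibres of `P`, in the
preferred chart. -/
theorem LocalSection.chartForm_pt {W : Type*} [NormedAddCommGroup W] [NormedSpace ℝ W]
    {Θ : P → E [⋀^Fin k]→L[ℝ] W} (hΘ : ∀ p g, Θ (Q.act p g) = Θ p) {p : P}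
    (σ : LocalSection Q p) : chartForm (fun x => Θ (Q.pt x)) (Q.proj p) =ᶠ[𝓝 (Q.base p)]
      fun y => (Θ (σ.toFun y)).compContinuousLinearMap (chartSymmDeriv (Q.proj p) y) := by
  filter_upwards [σ.proj_toFun] with y hy
  obtain ⟨g, hg⟩ := Q.exists_act_eq ((Q.proj_pt _).trans hy.symm)
  rw [chartForm, ← hg, hΘ]

/-- The pairing of a section of `Ad P` with a one-form. -/
def pairForm (f : P → E [⋀^Fin 0]→L[ℝ] EG) (η : P → E [⋀^Fin 1]→L[ℝ] EG) (p : P) :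
    E [⋀^Fin 1]→L[ℝ] ℝ := (B.inner (f p 0)).compContinuousAlternatingMap (η p)

theorem pairForm_act {f : P → E [⋀^Fin 0]→L[ℝ] EG} {η : P → E [⋀^Fin 1]→L[ℝ] EG}
    (hf : IsAdForm Q f) (hη : IsAdForm Q η) (p : P) (g : G) :
    pairForm B f η (Q.act p g) = pairForm B f η p := by
  ext v
  simp only [pairForm, hf.act_eq, hη.act_eq]
  exact B.invariant g⁻¹ _ _

theorem contDiffAt_pairForm_loc {f : P → E [⋀^Fin 0]→L[ℝ] EG} {η : P → E [⋀^Fin 1]→L[ℝ] EG}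
    (hf : IsAdForm Q f) (hη : IsAdForm Q η) {p : P} (σ : LocalSection Q p) :
    ContDiffAt ℝ ∞ (fun y => (pairForm B f η (σ.toFun y)).compContinuousLinearMap
      (chartSymmDeriv (Q.proj p) y)) (Q.base p) := by
  refine contDiffAt_form fun v => ?_
  have h1 : ContDiffAt ℝ ∞ (fun y => σ.loc f y 0) (Q.base p) :=
    contDiffAt_form_apply (σ.contDiffAt_loc hf) fun _ => contDiffAt_const
  have h2 : ContDiffAt ℝ ∞ (fun y => σ.loc η y v) (Q.base p) :=
    contDiffAt_form_apply (σ.contDiffAt_loc hη) fun _ => contDiffAt_const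
  have h3 : ContDiffAt ℝ ∞ (fun y => B.inner (σ.loc f y 0) (σ.loc η y v)) (Q.base p) :=
    (B.inner.contDiff.contDiffAt.comp (Q.base p) h1).clm_apply h2
  refine h3.congr_of_eventuallyEq (Eventually.of_forall fun y => ?_)
  refine congrArg (fun X => B.inner X (σ.loc η y v)) ?_
  exact congrArg (f (σ.toFun y)) (Subsingleton.elim _ _)

theorem isSmoothForm_pairForm {f : P → E [⋀^Fin 0]→L[ℝ] EG} {η : P → E [⋀^Fin 1]→L[ℝ] EG}
    (hf : IsAdForm Q f) (hη : IsAdForm Q η) : IsSmoothForm fun x => pairForm B f η (Q.pt x) :=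
  isSmoothForm_iff.2 fun x => by
    obtain ⟨p, rfl⟩ := Q.surjective x
    obtain ⟨σ⟩ := LocalSection.nonempty (Q := Q) p
    exact (contDiffAt_pairForm_loc B hf hη σ).congr_of_eventuallyEq
      (σ.chartForm_pt (pairForm_act B hf hη))

theorem contrD_pairForm (A : Connection Q) {f : P → E [⋀^Fin 0]→L[ℝ] EG}
    {η : P → E [⋀^Fin 1]→L[ℝ] EG} (hf : IsAdForm Q f) (hη : IsAdForm Q η) (p : P) :
    contrD K (fun x => pairForm B f η (Q.pt x)) (Q.proj p) =
      formInner K B (Q.proj p) (covD Q A.form f p) (pullR Complex.I η p) +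
        formInner K B (Q.proj p) (f p) (lamForm K Q (covD Q A.form η) p) := by
  obtain ⟨σ, hσ⟩ := A.exists_horizontal p
  have h1 := σ.chartForm_pt (pairForm_act B hf hη)
  have hθ := contDiffAt_pairForm_loc B hf hη σ
  have h2 := lam_extDeriv_pairing (realBasis E) (isHermGram_gram K (Q.proj p)).bivec_antisymm B.inner
    ((σ.contDiffAt_loc hf).differentiableAt (by simp))
    ((σ.contDiffAt_loc hη).differentiableAt (by simp)) (hθ.differentiableAt (by simp))
    (Eventually.of_forall fun y v => by
      refine congrArg₂ (fun X Y => B.inner X Y) ?_ ?_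
      · exact congrArg (f (σ.toFun y)) (Subsingleton.elim _ _)
      · rfl)
  rw [contrD, extD]
  refine (congrArg (lam (realBasis E) (bivec (E := E) (gram K (Q.proj p)))) h1.extDeriv_eq).trans ?_
  refine h2.trans ?_
  rw [hσ.extDeriv_loc hf, hσ.extDeriv_loc hη, σ.loc_base, σ.loc_base, formInner_zero,
    lamForm_apply, lefschetzLambda_eq]
  congr 1
  refine Eq.trans ?_ (formInner_comp_I K B (Q.proj p) _ _).symm
  rw [contr_one]
  simp

/-- The one-form `crossForm` of two `Ad P`-valued forms, for the Poisson bivector of the Kähler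
form. -/
def crossField (γ : P → E [⋀^Fin 1]→L[ℝ] EG) (F : P → E [⋀^Fin 2]→L[ℝ] EG)
    (Q : PrincipalBundle E EP EG M P G) (p : P) : E [⋀^Fin 1]→L[ℝ] ℝ :=
  crossForm (realBasis E) (bivec (E := E) (gram K (Q.proj p))) B.inner (γ p) (F p)

theorem crossField_act {γ : P → E [⋀^Fin 1]→L[ℝ] EG} {F : P → E [⋀^Fin 2]→L[ℝ] EG}
    (hγ : IsAdForm Q γ) (hF : IsAdForm Q F) (p : P) (g : G) :
    crossField K B γ F Q (Q.act p g) = crossField K B γ F Q p := by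
  rw [crossField, crossField, Q.proj_act, hγ.act_eq, hF.act_eq, crossForm_compCLM _ _ _ _ _ (B.invariant g⁻¹)]

theorem crossField_loc (γ : P → E [⋀^Fin 1]→L[ℝ] EG) (F : P → E [⋀^Fin 2]→L[ℝ] EG) {p : P}
    (σ : LocalSection Q p) : (fun y => (crossField K B γ F Q (σ.toFun y)).compContinuousLinearMap
        (chartSymmDeriv (Q.proj p) y)) =ᶠ[𝓝 (Q.base p)]
      fun y => crossForm (realBasis E) (chartBivec K (Q.proj p) y) B.inner (σ.loc γ y)
        (σ.loc F y) := by
  filter_upwards [σ.proj_toFun, (isOpen_extChartAt_target (Q.proj p)).mem_nhds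
    (mem_extChartAt_target (I := 𝓘(ℝ, E)) (Q.proj p))] with y hy hy'
  rw [crossField, hy, crossForm_chart K B.inner hy']
  rfl

theorem contDiffAt_crossForm_loc {γ : P → E [⋀^Fin 1]→L[ℝ] EG} {F : P → E [⋀^Fin 2]→L[ℝ] EG}
    (hγ : IsAdForm Q γ) (hF : IsAdForm Q F) {p : P} (σ : LocalSection Q p) :
    ContDiffAt ℝ ∞ (fun y => crossForm (realBasis E) (chartBivec K (Q.proj p) y) B.inner
      (σ.loc γ y) (σ.loc F y)) (Q.base p) := by
  have hx := mem_extChartAt_target (I := 𝓘(ℝ, E)) (Q.proj p)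
  have hP := contDiffAt_bivec K hx
  have h1 : ∀ v, ContDiffAt ℝ ∞ (fun y => σ.loc γ y v) (Q.base p) := fun v =>
    contDiffAt_form_apply (σ.contDiffAt_loc hγ) fun _ => contDiffAt_const
  have h2 : ∀ v, ContDiffAt ℝ ∞ (fun y => σ.loc F y v) (Q.base p) := fun v =>
    contDiffAt_form_apply (σ.contDiffAt_loc hF) fun _ => contDiffAt_const
  have hB : ∀ {X Y : E → EG}, ContDiffAt ℝ ∞ X (Q.base p) → ContDiffAt ℝ ∞ Y (Q.base p) →
      ContDiffAt ℝ ∞ (fun y => B.inner (X y) (Y y)) (Q.base p) := fun hX hY =>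
    (B.inner.contDiff.contDiffAt.comp (Q.base p) hX).clm_apply hY
  refine contDiffAt_form fun v => ?_
  have hv : v = ![v 0] := by ext i; fin_cases i; rfl
  rw [hv]
  simp only [crossForm_apply]
  exact (hB (h1 _) (contDiffAt_lam _ hP (σ.contDiffAt_loc hF))).sub
    (ContDiffAt.sum fun j _ => ContDiffAt.sum fun l _ => (hP j l).mul (hB (h1 _) (h2 _)))

theorem isSmoothForm_crossField {γ : P → E [⋀^Fin 1]→L[ℝ] EG} {F : P → E [⋀^Fin 2]→L[ℝ] EG}
    (hγ : IsAdForm Q γ) (hF : IsAdForm Q F) : IsSmoothForm fun x => crossField K B γ F Q (Q.pt x) :=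
  isSmoothForm_iff.2 fun x => by
    obtain ⟨p, rfl⟩ := Q.surjective x
    obtain ⟨σ⟩ := LocalSection.nonempty (Q := Q) p
    exact (contDiffAt_crossForm_loc K B hγ hF σ).congr_of_eventuallyEq
      ((σ.chartForm_pt (crossField_act K B hγ hF)).trans (crossField_loc K B γ F σ))

theorem contrD_crossField (A : Connection Q) {γ : P → E [⋀^Fin 1]→L[ℝ] EG}
    {F : P → E [⋀^Fin 2]→L[ℝ] EG} (hγ : IsAdForm Q γ) (hF : IsAdForm Q F)
    (hdF : covD Q A.form F = 0) (p : P) :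
    contrD K (fun x => crossField K B γ F Q (Q.pt x)) (Q.proj p) =
      formInner K B (Q.proj p) (lamForm K Q (covD Q A.form γ) p) (lamForm K Q F p) -
        formInner K B (Q.proj p) (covD Q A.form γ p) (pullR Complex.I F p) := by
  obtain ⟨σ, hσ⟩ := A.exists_horizontal p
  have hx := mem_extChartAt_target (I := 𝓘(ℝ, E)) (Q.proj p)
  have h1 := (σ.chartForm_pt (crossField_act K B hγ hF)).trans (crossField_loc K B γ F σ)
  have hθ := contDiffAt_crossForm_loc K B hγ hF σ
  have h2 := lam_extDeriv_kahler K hx B.inner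
    ((σ.contDiffAt_loc hγ).differentiableAt (by simp))
    ((σ.contDiffAt_loc hF).differentiableAt (by simp)) (hθ.differentiableAt (by simp))
    ((hσ.extDeriv_loc hF).trans (congrFun hdF p))
    (Eventually.of_forall fun y v => crossForm_apply _ _ _ _ _ _)
  rw [contrD, extD]
  refine (congrArg (lam (realBasis E) (bivec (E := E) (gram K (Q.proj p)))) h1.extDeriv_eq).trans ?_
  have hb : extChartAt 𝓘(ℝ, E) (Q.proj p) (Q.proj p) = Q.base p := rfl
  rw [chartBivec, chartGram_self, hb] at h2
  refine h2.trans ?_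
  rw [hσ.extDeriv_loc hγ, σ.loc_base, formInner_zero, lamForm_apply, lamForm_apply,
    lefschetzLambda_eq, lefschetzLambda_eq]
  congr 1
  refine Eq.trans ?_ (formInner_comp_I K B (Q.proj p) _ _).symm
  norm_num [Nat.factorial]

end Parts

/-! ### The `L²` inner product of `Ad P`-valued forms -/

section L2

open Filter Topology MeasureTheory

variable {E EP EG M P G : Type*}
  [NormedAddCommGroup E] [NormedSpace ℂ E] [FiniteDimensional ℂ E]
  [NormedAddCommGroup EP] [NormedSpace ℝ EP] [FiniteDimensional ℝ EP]
  [NormedAddCommGroup EG] [NormedSpace ℝ EG] [FiniteDimensional ℝ EG]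
  [TopologicalSpace M] [ChartedSpace E M] [IsManifold 𝓘(ℂ, E) ω M]
  [TopologicalSpace P] [ChartedSpace EP P] [IsManifold 𝓘(ℝ, EP) ∞ P]
  [TopologicalSpace G] [ChartedSpace EG G] [Group G] [LieGroup 𝓘(ℝ, EG) ∞ G]
  {Q : PrincipalBundle E EP EG M P G} {k : ℕ}

section Pointwise

theorem pullR_I_neg_I (α : P → E [⋀^Fin k]→L[ℝ] EG) :
    pullR Complex.I (pullR (-Complex.I) α) = α := by
  ext p v
  refine congrArg (α p) (funext fun i => ?_)
  simp [mulC_apply, smul_smul]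

theorem pullR_I_I (α : P → E [⋀^Fin 1]→L[ℝ] EG) :
    pullR Complex.I (pullR Complex.I α) = (-1 : ℝ) • α := by
  ext p v
  have h : ∀ w : E, α p ![mulC Complex.I (mulC Complex.I w)] = -α p ![w] := fun w => by
    rw [← ofSubsingleton_symm_apply, ← ofSubsingleton_symm_apply, ← map_neg]
    congr 1
    simp [mulC_apply, smul_smul]
  have hv : v = ![v 0] := by ext i; fin_cases i; rfl
  rw [hv]
  refine Eq.trans ?_ ((h (v 0)).trans (neg_one_smul ℝ _).symm)
  exact congrArg (α p) (funext fun i => by fin_cases i; rfl)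

theorem pullR_zero_form (z : ℂ) (f : P → E [⋀^Fin 0]→L[ℝ] EG) : pullR z f = f := by
  ext p v
  exact congrArg (f p) (Subsingleton.elim _ _)

variable (K : KahlerStructure E M) (B : AdInvariantInner EG G)

theorem lamForm_add (α β : P → E [⋀^Fin 2]→L[ℝ] EG) :
    lamForm K Q (α + β) = lamForm K Q α + lamForm K Q β := by
  ext p v
  simp only [lamForm_apply, Pi.add_apply, ContinuousAlternatingMap.add_apply, lefschetzLambda_eq,
    lam_add]

theorem lamForm_smul (c : ℝ) (α : P → E [⋀^Fin 2]→L[ℝ] EG) :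
    lamForm K Q (c • α) = c • lamForm K Q α := by
  ext p v
  simp only [lamForm_apply, Pi.smul_apply, ContinuousAlternatingMap.smul_apply, lefschetzLambda_eq,
    lam_smul]

/-- The contraction of the Kähler form with itself is the complex dimension. -/
theorem lam_form (x : M) :
    lam (realBasis E) (bivec (E := E) (gram K x)) (K.form x) = Module.finrank ℂ E := by
  have hG := isHermGram_gram K x
  have h2 : ∑ i, ∑ j, bivec (E := E) (gram K x) i j * K.form x ![realBasis E i, realBasis E j] =
      -(bivec (E := E) (gram K x) * ((cplx E).transpose * gram K x)).trace := by
    simp only [Matrix.trace, Matrix.diag_apply, Matrix.mul_apply (M := bivec (E := E) (gram K x)),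
      ← Finset.sum_neg_distrib]
    refine Finset.sum_congr rfl fun i _ => Finset.sum_congr rfl fun j _ => ?_
    rw [form_two_swap, form_gram, mul_neg]
  rw [hG.bivec_mul_form] at h2
  rw [lam]
  simp only [smul_eq_mul, h2]
  simp [finrank_real_of_complex]

theorem formInner_toSpanSingleton (x : M) (X : EG) (α : E [⋀^Fin 2]→L[ℝ] EG) :
    formInner K B x ((ContinuousLinearMap.toSpanSingleton ℝ X).compContinuousAlternatingMap
      (K.form x)) α = B.inner X (lefschetzLambda K x α) := by
  rw [lefschetzLambda_eq, ← (isHermGram_gram K x).lam_eq (form_gram K x), formInner_eq]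
  simp [contr, Finset.mul_sum, Nat.factorial]

/-- The decomposition into primitive part and multiple of the Kähler form is orthogonal, and
`|ω|² = n`. In dimension zero the formula holds with `n⁻¹ = 0`, all two-forms being zero. -/
theorem formInner_primitivePart (F : P → E [⋀^Fin 2]→L[ℝ] EG) (p : P) :
    formInner K B (Q.proj p) (primitivePart K Q F p) (primitivePart K Q F p) =
      formInner K B (Q.proj p) (F p) (F p) - (Module.finrank ℂ E : ℝ)⁻¹ *
        formInner K B (Q.proj p) (lamForm K Q F p) (lamForm K Q F p) := by
  set n : ℝ := (Module.finrank ℂ E : ℝ) with hn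
  set X := lefschetzLambda K (Q.proj p) (F p) with hX
  set β := (ContinuousLinearMap.toSpanSingleton ℝ (n⁻¹ • X)).compContinuousAlternatingMap
    (K.form (Q.proj p)) with hβ
  have h1 : primitivePart K Q F p = F p + (-1 : ℝ) • β := by
    rw [neg_one_smul, ← sub_eq_add_neg]
    rfl
  have h2 : formInner K B (Q.proj p) β (F p) = n⁻¹ * B.inner X X := by
    rw [hβ, formInner_toSpanSingleton, ← hX, map_smul, smul_apply, smul_eq_mul]
  have h3 : formInner K B (Q.proj p) β β = n⁻¹ * B.inner X X := by
    have h4 : lefschetzLambda K (Q.proj p) β = n • n⁻¹ • X := by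
      rw [lefschetzLambda_eq, hβ, lam_comp, lam_form]
      rfl
    have h5 : formInner K B (Q.proj p) β β = B.inner (n⁻¹ • X) (lefschetzLambda K (Q.proj p) β) :=
      formInner_toSpanSingleton K B _ _ _
    rw [h5, h4]
    simp only [map_smul, smul_apply, smul_eq_mul]
    rcases eq_or_ne n 0 with h0 | h0
    · simp [h0]
    · field_simp
  have h6 : formInner K B (Q.proj p) (lamForm K Q F p) (lamForm K Q F p) = B.inner X X := by
    rw [formInner_zero, lamForm_apply]
  rw [h1, formInner_add_left, formInner_smul_left, formInner_symm K B _ (F p),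
    formInner_symm K B _ β, formInner_add_left, formInner_add_left, formInner_smul_left,
    formInner_smul_left, formInner_symm K B _ (F p) β, h2, h3, h6]
  ring

end Pointwise

variable [CompactSpace M] [T2Space M]
  [MeasurableSpace E] [BorelSpace E] [MeasurableSpace M] [BorelSpace M]
  (K : KahlerStructure E M) (B : AdInvariantInner EG G)
  {α α' β β' : P → E [⋀^Fin k]→L[ℝ] EG}

theorem IsAdForm.integrable (hα : IsAdForm Q α) (hβ : IsAdForm Q β) :
    Integrable (fun x => formInner K B x (α (Q.pt x)) (β (Q.pt x))) (volumeMeasure K) :=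
  integrable_of_continuous K (continuous_formInner K B hα hβ)

theorem l2Inner_congr {j : ℕ} {α β : P → E [⋀^Fin k]→L[ℝ] EG} {α' β' : P → E [⋀^Fin j]→L[ℝ] EG}
    (h : ∀ p, formInner K B (Q.proj p) (α p) (β p) = formInner K B (Q.proj p) (α' p) (β' p)) :
    l2Inner K Q B α β = l2Inner K Q B α' β' :=
  integral_congr_ae (Eventually.of_forall fun x => by
    have := h (Q.pt x)
    rwa [Q.proj_pt] at this)

theorem l2Inner_symm (α β : P → E [⋀^Fin k]→L[ℝ] EG) :
    l2Inner K Q B α β = l2Inner K Q B β α := by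
  simp only [l2Inner, formInner_symm K B _ (α _)]

theorem IsAdForm.l2Inner_add_left (hα : IsAdForm Q α) (hα' : IsAdForm Q α') (hβ : IsAdForm Q β) :
    l2Inner K Q B (α + α') β = l2Inner K Q B α β + l2Inner K Q B α' β := by
  rw [l2Inner, l2Inner, l2Inner, ← integral_add (hα.integrable K B hβ) (hα'.integrable K B hβ)]
  simp only [Pi.add_apply, formInner_add_left]

theorem l2Inner_smul_left (c : ℝ) (α β : P → E [⋀^Fin k]→L[ℝ] EG) :
    l2Inner K Q B (c • α) β = c * l2Inner K Q B α β := by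
  rw [l2Inner, l2Inner, ← integral_const_mul]
  simp only [Pi.smul_apply, formInner_smul_left]

theorem IsAdForm.l2Inner_add_right (hα : IsAdForm Q α) (hβ : IsAdForm Q β) (hβ' : IsAdForm Q β') :
    l2Inner K Q B α (β + β') = l2Inner K Q B α β + l2Inner K Q B α β' := by
  rw [l2Inner_symm, hβ.l2Inner_add_left K B hβ' hα, l2Inner_symm K B β, l2Inner_symm K B β']

theorem l2Inner_smul_right (c : ℝ) (α β : P → E [⋀^Fin k]→L[ℝ] EG) :
    l2Inner K Q B α (c • β) = c * l2Inner K Q B α β := by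
  rw [l2Inner_symm, l2Inner_smul_left, l2Inner_symm]

theorem l2Inner_zero_left (β : P → E [⋀^Fin k]→L[ℝ] EG) : l2Inner K Q B 0 β = 0 := by
  have := l2Inner_smul_left (Q := Q) K B 0 0 β
  simpa using this

theorem l2Inner_self_nonneg (α : P → E [⋀^Fin k]→L[ℝ] EG) : 0 ≤ l2Inner K Q B α α :=
  integral_nonneg fun _ => formInner_self_nonneg K B _ _

/-- A form of norm zero is orthogonal to all forms. -/
theorem IsAdForm.l2Inner_eq_zero (hα : IsAdForm Q α) (h0 : l2Inner K Q B α α = 0)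
    (hβ : IsAdForm Q β) : l2Inner K Q B α β = 0 := by
  have h : ∀ t : ℝ, 0 ≤ 2 * t * l2Inner K Q B α β + l2Inner K Q B β β := fun t => by
    have h1 := l2Inner_self_nonneg (Q := Q) K B (t • α + β)
    rw [(hα.smul t).l2Inner_add_left K B hβ ((hα.smul t).add hβ),
      (hα.smul t).l2Inner_add_right K B (hα.smul t) hβ, hβ.l2Inner_add_right K B (hα.smul t) hβ,
      l2Inner_smul_left, l2Inner_smul_left, l2Inner_smul_right, l2Inner_smul_right, h0,
      l2Inner_symm K B β α] at h1
    linarith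
  by_contra hne
  have h2 := h (-(l2Inner K Q B β β + 1) / (2 * l2Inner K Q B α β))
  have h3 : 2 * (-(l2Inner K Q B β β + 1) / (2 * l2Inner K Q B α β)) * l2Inner K Q B α β =
      -(l2Inner K Q B β β + 1) := by field_simp
  linarith

theorem l2Inner_pullR_neg_I_left (α β : P → E [⋀^Fin k]→L[ℝ] EG) :
    l2Inner K Q B (pullR (-Complex.I) α) β = l2Inner K Q B α (pullR Complex.I β) :=
  l2Inner_congr K B fun _ => formInner_neg_I_comp K B _ _ _

/-- Integration by parts for the covariant derivative of a section. -/
theorem Connection.l2Inner_covD_pullR (A : Connection Q) {f : P → E [⋀^Fin 0]→L[ℝ] EG}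
    {η : P → E [⋀^Fin 1]→L[ℝ] EG} (hf : IsAdForm Q f) (hη : IsAdForm Q η) :
    l2Inner K Q B (covD Q A.form f) (pullR Complex.I η) =
      -l2Inner K Q B f (lamForm K Q (covD Q A.form η)) := by
  have h1 := integral_contrD K (isSmoothForm_pairForm B hf hη)
  have h2 : ∀ x, contrD K (fun x => pairForm B f η (Q.pt x)) x =
      formInner K B x (covD Q A.form f (Q.pt x)) (pullR Complex.I η (Q.pt x)) +
        formInner K B x (f (Q.pt x)) (lamForm K Q (covD Q A.form η) (Q.pt x)) := fun x => by
    have := contrD_pairForm K B A hf hη (Q.pt x)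
    rwa [Q.proj_pt] at this
  simp only [h2] at h1
  rw [integral_add ((hf.covD A).integrable K B (hη.pullR _))
    (hf.integrable K B ((hη.covD A).lamForm K))] at h1
  rw [l2Inner, l2Inner]
  linarith

/-- Integration by parts for the covariant derivative of a one-form, paired with a two-form which
satisfies the Bianchi identity. -/
theorem Connection.l2Inner_lamForm_covD (A : Connection Q) {γ : P → E [⋀^Fin 1]→L[ℝ] EG}
    {F : P → E [⋀^Fin 2]→L[ℝ] EG} (hγ : IsAdForm Q γ) (hF : IsAdForm Q F)
    (hdF : covD Q A.form F = 0) :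
    l2Inner K Q B (covD Q A.form γ) (pullR Complex.I F) =
      l2Inner K Q B (lamForm K Q (covD Q A.form γ)) (lamForm K Q F) := by
  have h1 := integral_contrD K (isSmoothForm_crossField K B hγ hF)
  have h2 : ∀ x, contrD K (fun x => crossField K B γ F Q (Q.pt x)) x =
      formInner K B x (lamForm K Q (covD Q A.form γ) (Q.pt x)) (lamForm K Q F (Q.pt x)) -
        formInner K B x (covD Q A.form γ (Q.pt x)) (pullR Complex.I F (Q.pt x)) := fun x => by
    have := contrD_crossField K B A hγ hF hdF (Q.pt x)
    rwa [Q.proj_pt] at this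
  simp only [h2] at h1
  rw [integral_sub (((hγ.covD A).lamForm K).integrable K B (hF.lamForm K))
    ((hγ.covD A).integrable K B (hF.pullR _))] at h1
  rw [l2Inner, l2Inner]
  linarith

/-- The Kähler identity `⟨d_A γ, F ∘ J⟩ = -⟨d_A Λ F, γ ∘ J⟩`. -/
theorem Connection.l2Inner_covD_pullR_closed (A : Connection Q) {γ : P → E [⋀^Fin 1]→L[ℝ] EG}
    {F : P → E [⋀^Fin 2]→L[ℝ] EG} (hγ : IsAdForm Q γ) (hF : IsAdForm Q F)
    (hdF : covD Q A.form F = 0) :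
    l2Inner K Q B (covD Q A.form γ) (pullR Complex.I F) =
      -l2Inner K Q B (covD Q A.form (lamForm K Q F)) (pullR Complex.I γ) := by
  rw [A.l2Inner_lamForm_covD K B hγ hF hdF, A.l2Inner_covD_pullR K B (hF.lamForm K) hγ, neg_neg,
    l2Inner_symm]

theorem l2Inner_primitivePart {F : P → E [⋀^Fin 2]→L[ℝ] EG} (hF : IsAdForm Q F) :
    l2Inner K Q B (primitivePart K Q F) (primitivePart K Q F) =
      l2Inner K Q B F F - (Module.finrank ℂ E : ℝ)⁻¹ *
        l2Inner K Q B (lamForm K Q F) (lamForm K Q F) := by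
  have h1 : ∀ x, formInner K B x (primitivePart K Q F (Q.pt x)) (primitivePart K Q F (Q.pt x)) =
      formInner K B x (F (Q.pt x)) (F (Q.pt x)) - (Module.finrank ℂ E : ℝ)⁻¹ *
        formInner K B x (lamForm K Q F (Q.pt x)) (lamForm K Q F (Q.pt x)) := fun x => by
    have := formInner_primitivePart (Q := Q) K B F (Q.pt x)
    rwa [Q.proj_pt] at this
  simp only [l2Inner, h1]
  rw [integral_sub (hF.integrable K B hF)
    (((hF.lamForm K).integrable K B (hF.lamForm K)).const_mul _), integral_const_mul]

/-- The first variation of the squared norm along a polynomial path of forms. -/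
theorem hasDerivAt_l2Inner_path {X Y a b : P → E [⋀^Fin k]→L[ℝ] EG} (hX : IsAdForm Q X)
    (hY : IsAdForm Q Y) (ha : IsAdForm Q a) (hb : IsAdForm Q b) :
    HasDerivAt (fun t : ℝ => l2Inner K Q B (X + t • Y + t ^ 2 • a + t ^ 3 • b)
      (X + t • Y + t ^ 2 • a + t ^ 3 • b)) (2 * l2Inner K Q B Y X) 0 := by
  have h1 : ∀ (t : ℝ) {Z : P → E [⋀^Fin k]→L[ℝ] EG}, IsAdForm Q Z →
      l2Inner K Q B (X + t • Y + t ^ 2 • a + t ^ 3 • b) Z = l2Inner K Q B X Z +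
        t * l2Inner K Q B Y Z + t ^ 2 * l2Inner K Q B a Z + t ^ 3 * l2Inner K Q B b Z :=
    fun t Z hZ => by
    rw [((hX.add (hY.smul t)).add (ha.smul _)).l2Inner_add_left K B (hb.smul _) hZ,
      (hX.add (hY.smul t)).l2Inner_add_left K B (ha.smul _) hZ,
      hX.l2Inner_add_left K B (hY.smul _) hZ, l2Inner_smul_left, l2Inner_smul_left,
      l2Inner_smul_left]
  have h2 : ∀ t : ℝ, IsAdForm Q (X + t • Y + t ^ 2 • a + t ^ 3 • b) := fun t =>
    ((hX.add (hY.smul t)).add (ha.smul _)).add (hb.smul _)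
  have h3 : ∀ {Z : P → E [⋀^Fin k]→L[ℝ] EG}, IsAdForm Q Z → HasDerivAt (fun t : ℝ =>
      l2Inner K Q B Z (X + t • Y + t ^ 2 • a + t ^ 3 • b)) (l2Inner K Q B Y Z) 0 := fun {Z} hZ => by
    have h4 : (fun t : ℝ => l2Inner K Q B Z (X + t • Y + t ^ 2 • a + t ^ 3 • b)) = fun t : ℝ =>
        l2Inner K Q B X Z + t * l2Inner K Q B Y Z + t ^ 2 * l2Inner K Q B a Z +
          t ^ 3 * l2Inner K Q B b Z := funext fun t => by rw [l2Inner_symm, h1 t hZ]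
    rw [h4]
    have h5 := ((((hasDerivAt_const (0 : ℝ) (l2Inner K Q B X Z)).add
      ((hasDerivAt_id (0 : ℝ)).mul_const (l2Inner K Q B Y Z))).add
      ((hasDerivAt_pow 2 (0 : ℝ)).mul_const (l2Inner K Q B a Z))).add
      ((hasDerivAt_pow 3 (0 : ℝ)).mul_const (l2Inner K Q B b Z)))
    refine h5.congr_deriv ?_
    simp
  have h6 : (fun t : ℝ => l2Inner K Q B (X + t • Y + t ^ 2 • a + t ^ 3 • b)
      (X + t • Y + t ^ 2 • a + t ^ 3 • b)) = fun t : ℝ =>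
      l2Inner K Q B X (X + t • Y + t ^ 2 • a + t ^ 3 • b) +
      t * l2Inner K Q B Y (X + t • Y + t ^ 2 • a + t ^ 3 • b) +
      t ^ 2 * l2Inner K Q B a (X + t • Y + t ^ 2 • a + t ^ 3 • b) +
      t ^ 3 * l2Inner K Q B b (X + t • Y + t ^ 2 • a + t ^ 3 • b) := funext fun t => h1 t (h2 t)
  rw [h6]
  have h7 := (((h3 hX).add ((hasDerivAt_id (0 : ℝ)).mul (h3 hY))).add
    ((hasDerivAt_pow 2 (0 : ℝ)).mul (h3 ha))).add ((hasDerivAt_pow 3 (0 : ℝ)).mul (h3 hb))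
  refine h7.congr_deriv ?_
  simp only [id, zero_smul, ne_eq, OfNat.ofNat_ne_zero, not_false_eq_true, zero_pow, add_zero]
  simp
  ring

end L2

/-! ### Formal adjoints and the critical points of the two functionals -/

section Adjoints

open Filter Topology MeasureTheory

variable {E EP EG M P G : Type*}
  [NormedAddCommGroup E] [NormedSpace ℂ E] [FiniteDimensional ℂ E]
  [NormedAddCommGroup EP] [NormedSpace ℝ EP] [FiniteDimensional ℝ EP]
  [NormedAddCommGroup EG] [NormedSpace ℝ EG] [FiniteDimensional ℝ EG]
  [TopologicalSpace M] [ChartedSpace E M] [IsManifold 𝓘(ℂ, E) ω M]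
  [TopologicalSpace P] [ChartedSpace EP P] [IsManifold 𝓘(ℝ, EP) ∞ P]
  [TopologicalSpace G] [ChartedSpace EG G] [Group G] [LieGroup 𝓘(ℝ, EG) ∞ G]
  {Q : PrincipalBundle E EP EG M P G} {k : ℕ}

/-- `d_A^c` on real forms. -/
def covDcR (Q : PrincipalBundle E EP EG M P G) (A : P → EP [⋀^Fin 1]→L[ℝ] EG)
    (α : P → E [⋀^Fin k]→L[ℝ] EG) : P → E [⋀^Fin (k + 1)]→L[ℝ] EG :=
  pullR (-Complex.I) (covD Q A (pullR Complex.I α))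

theorem IsAdForm.covDcR {α : P → E [⋀^Fin k]→L[ℝ] EG} (h : IsAdForm Q α) (A : Connection Q) :
    IsAdForm Q (covDcR Q A.form α) := ((h.pullR _).covD A).pullR _

theorem del_eq (A : P → EP [⋀^Fin 1]→L[ℝ] EG) (β : CForm E EG P k) : del Q A β =
    ((1 / 2 : ℝ) • (covD Q A β.1 + (-1 : ℝ) • covDcR Q A β.2),
      (1 / 2 : ℝ) • (covD Q A β.2 + covDcR Q A β.1)) := by
  have h : covDc Q A β = (covDcR Q A β.1, covDcR Q A β.2) := rfl
  rw [del, h]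
  simp [csmul, covDC]

theorem delbar_eq (A : P → EP [⋀^Fin 1]→L[ℝ] EG) (β : CForm E EG P k) : delbar Q A β =
    ((1 / 2 : ℝ) • (covD Q A β.1 + covDcR Q A β.2),
      (1 / 2 : ℝ) • (covD Q A β.2 + (-1 : ℝ) • covDcR Q A β.1)) := by
  have h : covDc Q A β = (covDcR Q A β.1, covDcR Q A β.2) := rfl
  rw [delbar, h]
  simp [csmul, covDC, sub_eq_add_neg]

theorem IsAdCForm.del {β : CForm E EG P k} (h : IsAdCForm Q β) (A : Connection Q) :
    IsAdCForm Q (del Q A.form β) := by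
  rw [del_eq]
  exact ⟨((h.1.covD A).add ((h.2.covDcR A).smul _)).smul _,
    ((h.2.covD A).add (h.1.covDcR A)).smul _⟩

theorem IsAdCForm.delbar {β : CForm E EG P k} (h : IsAdCForm Q β) (A : Connection Q) :
    IsAdCForm Q (delbar Q A.form β) := by
  rw [delbar_eq]
  exact ⟨((h.1.covD A).add (h.2.covDcR A)).smul _,
    ((h.2.covD A).add ((h.1.covDcR A).smul _)).smul _⟩

variable [CompactSpace M] [T2Space M]
  [MeasurableSpace E] [BorelSpace E] [MeasurableSpace M] [BorelSpace M]
  (K : KahlerStructure E M) (B : AdInvariantInner EG G)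

/-- Once some form has the defining property of the adjoint, the form selected by `formalAdjoint`
has it too. Uniqueness of that form plays no role: adjoints enter only through this property. -/
theorem formalAdjoint_spec {D : CForm E EG P k → CForm E EG P (k + 1)}
    {α : CForm E EG P (k + 1)} {γ : CForm E EG P k} (hγ : IsAdCForm Q γ)
    (h : ∀ β, IsAdCForm Q β → l2InnerC K Q B (D β) α = l2InnerC K Q B β γ) :
    IsAdCForm Q (formalAdjoint K Q B D α) ∧ ∀ β, IsAdCForm Q β →
      l2InnerC K Q B (D β) α = l2InnerC K Q B β (formalAdjoint K Q B D α) := by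
  have hex : ∃ γ : CForm E EG P k, IsAdCForm Q γ ∧
    ∀ β, IsAdCForm Q β → l2InnerC K Q B (D β) α = l2InnerC K Q B β γ := ⟨γ, hγ, h⟩
  rw [formalAdjoint, dif_pos hex]
  exact Classical.choose_spec hex

/-- `a` and `c` represent the values at `α` of the formal adjoints of `d_A` and `d_A^c`. -/
structure IsRealAdjoint (A : Connection Q) (α : P → E [⋀^Fin (k + 1)]→L[ℝ] EG)
    (a c : P → E [⋀^Fin k]→L[ℝ] EG) : Prop where
  source : IsAdForm Q α
  left : IsAdForm Q a
  right : IsAdForm Q c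
  covD : ∀ β, IsAdForm Q β → l2Inner K Q B (covD Q A.form β) α = l2Inner K Q B β a
  covDc : ∀ β, IsAdForm Q β → l2Inner K Q B (covDcR Q A.form β) α = l2Inner K Q B β c

variable {K B} {A : Connection Q} {α₁ α₂ : P → E [⋀^Fin (k + 1)]→L[ℝ] EG}
  {a₁ a₂ c₁ c₂ : P → E [⋀^Fin k]→L[ℝ] EG}

/-- `∂_A^* = (d_A^* - i (d_A^c)^*) / 2`. -/
theorem IsRealAdjoint.delStar (h₁ : IsRealAdjoint K B A α₁ a₁ c₁)
    (h₂ : IsRealAdjoint K B A α₂ a₂ c₂) :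
    IsAdCForm Q (delStar K Q B A.form (α₁, α₂)) ∧ ∀ β : CForm E EG P k, IsAdCForm Q β →
      l2InnerC K Q B (del Q A.form β) (α₁, α₂) =
        l2InnerC K Q B β (delStar K Q B A.form (α₁, α₂)) ∧
      l2InnerC K Q B (del Q A.form β) (α₁, α₂) = l2InnerC K Q B β
        ((1 / 2 : ℝ) • (a₁ + c₂), (1 / 2 : ℝ) • (a₂ + (-1 : ℝ) • c₁)) := by
  have h : ∀ β : CForm E EG P k, IsAdCForm Q β → l2InnerC K Q B (del Q A.form β) (α₁, α₂) =
      l2InnerC K Q B β ((1 / 2 : ℝ) • (a₁ + c₂), (1 / 2 : ℝ) • (a₂ + (-1 : ℝ) • c₁)) := by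
    rintro ⟨β₁, β₂⟩ ⟨hβ₁, hβ₂⟩
    simp only [l2InnerC, del_eq, l2Inner_smul_left, l2Inner_smul_right]
    rw [(hβ₁.covD A).l2Inner_add_left K B ((hβ₂.covDcR A).smul _) h₁.source,
      (hβ₂.covD A).l2Inner_add_left K B (hβ₁.covDcR A) h₂.source,
      (hβ₂.covD A).l2Inner_add_left K B (hβ₁.covDcR A) h₁.source,
      (hβ₁.covD A).l2Inner_add_left K B ((hβ₂.covDcR A).smul _) h₂.source,
      hβ₁.l2Inner_add_right K B h₁.left h₂.right, hβ₂.l2Inner_add_right K B h₁.left h₂.right,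
      hβ₁.l2Inner_add_right K B h₂.left (h₁.right.smul _),
      hβ₂.l2Inner_add_right K B h₂.left (h₁.right.smul _)]
    simp only [l2Inner_smul_left, l2Inner_smul_right]
    rw [h₁.covD _ hβ₁, h₁.covD _ hβ₂, h₂.covD _ hβ₁, h₂.covD _ hβ₂, h₁.covDc _ hβ₁,
      h₁.covDc _ hβ₂, h₂.covDc _ hβ₁, h₂.covDc _ hβ₂]
    congr 1 <;> ring
  have hs := formalAdjoint_spec K B (D := del Q A.form)
    ⟨(h₁.left.add h₂.right).smul _, (h₂.left.add (h₁.right.smul _)).smul _⟩ h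
  exact ⟨hs.1, fun β hβ => ⟨hs.2 β hβ, h β hβ⟩⟩

/-- `∂̄_A^* = (d_A^* + i (d_A^c)^*) / 2`. -/
theorem IsRealAdjoint.delbarStar (h₁ : IsRealAdjoint K B A α₁ a₁ c₁)
    (h₂ : IsRealAdjoint K B A α₂ a₂ c₂) :
    IsAdCForm Q (delbarStar K Q B A.form (α₁, α₂)) ∧ ∀ β : CForm E EG P k, IsAdCForm Q β →
      l2InnerC K Q B (delbar Q A.form β) (α₁, α₂) =
        l2InnerC K Q B β (delbarStar K Q B A.form (α₁, α₂)) ∧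
      l2InnerC K Q B (delbar Q A.form β) (α₁, α₂) = l2InnerC K Q B β
        ((1 / 2 : ℝ) • (a₁ + (-1 : ℝ) • c₂), (1 / 2 : ℝ) • (a₂ + c₁)) := by
  have h : ∀ β : CForm E EG P k, IsAdCForm Q β → l2InnerC K Q B (delbar Q A.form β) (α₁, α₂) =
      l2InnerC K Q B β ((1 / 2 : ℝ) • (a₁ + (-1 : ℝ) • c₂), (1 / 2 : ℝ) • (a₂ + c₁)) := by
    rintro ⟨β₁, β₂⟩ ⟨hβ₁, hβ₂⟩
    simp only [l2InnerC, delbar_eq, l2Inner_smul_left, l2Inner_smul_right]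
    rw [(hβ₁.covD A).l2Inner_add_left K B (hβ₂.covDcR A) h₁.source,
      (hβ₂.covD A).l2Inner_add_left K B ((hβ₁.covDcR A).smul _) h₂.source,
      (hβ₂.covD A).l2Inner_add_left K B ((hβ₁.covDcR A).smul _) h₁.source,
      (hβ₁.covD A).l2Inner_add_left K B (hβ₂.covDcR A) h₂.source,
      hβ₁.l2Inner_add_right K B h₁.left (h₂.right.smul _),
      hβ₂.l2Inner_add_right K B h₁.left (h₂.right.smul _),
      hβ₁.l2Inner_add_right K B h₂.left h₁.right, hβ₂.l2Inner_add_right K B h₂.left h₁.right]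
    simp only [l2Inner_smul_left, l2Inner_smul_right]
    rw [h₁.covD _ hβ₁, h₁.covD _ hβ₂, h₂.covD _ hβ₁, h₂.covD _ hβ₂, h₁.covDc _ hβ₁,
      h₁.covDc _ hβ₂, h₂.covDc _ hβ₁, h₂.covDc _ hβ₂]
    congr 1 <;> ring
  have hs := formalAdjoint_spec K B (D := delbar Q A.form)
    ⟨(h₁.left.add (h₂.right.smul _)).smul _, (h₂.left.add h₁.right).smul _⟩ h
  exact ⟨hs.1, fun β hβ => ⟨hs.2 β hβ, h β hβ⟩⟩

variable (K B A)

/-- On one-forms `d_A^* η = -Λ d_A (η ∘ (-J))` and `(d_A^c)^* η = -Λ d_A η`. -/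
theorem isRealAdjoint_one {η : P → E [⋀^Fin 1]→L[ℝ] EG} (hη : IsAdForm Q η) :
    IsRealAdjoint K B A η
      ((-1 : ℝ) • lamForm K Q (covD Q A.form (pullR (-Complex.I) η)))
      ((-1 : ℝ) • lamForm K Q (covD Q A.form η)) where
  source := hη
  left := ((((hη.pullR _).covD A)).lamForm K).smul _
  right := ((hη.covD A).lamForm K).smul _
  covD f hf := by
    have h := A.l2Inner_covD_pullR K B hf (hη.pullR (-Complex.I))
    rw [pullR_I_neg_I] at h
    rw [h, l2Inner_smul_right, neg_one_mul]
  covDc f hf := by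
    rw [covDcR, l2Inner_pullR_neg_I_left, pullR_zero_form, A.l2Inner_covD_pullR K B hf hη,
      l2Inner_smul_right, neg_one_mul]

variable {K B A}

theorem IsYangMills.l2Inner_covD_curvature (h : IsYangMills K Q B A)
    {η : P → E [⋀^Fin 1]→L[ℝ] EG} (hη : IsAdForm Q η) :
    l2Inner K Q B (covD Q A.form η) (curvature Q A.form) = 0 := by
  obtain ⟨a, b, ha, hb, hab⟩ := A.exists_curvature_shift hη
  have h1 := h η hη
  have h2 := hasDerivAt_l2Inner_path K B A.isAdForm_curvature (hη.covD A) ha hb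
  simp only [yangMills, hab] at h1
  have := h2.unique h1
  linarith

/-- The Kähler identities on the curvature of a Yang–Mills connection: `d_A^* F = 0` and
`(d_A^c)^* F = d_A Λ F`. -/
theorem IsYangMills.isRealAdjoint_curvature (h : IsYangMills K Q B A) :
    IsRealAdjoint K B A (curvature Q A.form) 0
      (KahlerYM.covD Q A.form (lamForm K Q (curvature Q A.form))) where
  source := A.isAdForm_curvature
  left := isAdForm_zero
  right := (A.isAdForm_curvature.lamForm K).covD A
  covD β hβ := by
    rw [h.l2Inner_covD_curvature hβ, l2Inner_symm, l2Inner_zero_left]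
  covDc β hβ := by
    rw [covDcR, l2Inner_pullR_neg_I_left, A.l2Inner_covD_pullR_closed K B (hβ.pullR _)
      A.isAdForm_curvature A.covD_curvature, pullR_I_I, l2Inner_smul_right, l2Inner_symm]
    ring

variable (K B) in
theorem isRealAdjoint_zero (A : Connection Q) :
    IsRealAdjoint K B A (0 : P → E [⋀^Fin (k + 1)]→L[ℝ] EG) 0 0 where
  source := isAdForm_zero
  left := isAdForm_zero
  right := isAdForm_zero
  covD β hβ := by rw [l2Inner_symm, l2Inner_zero_left, l2Inner_symm, l2Inner_zero_left]
  covDc β hβ := by rw [l2Inner_symm, l2Inner_zero_left, l2Inner_symm, l2Inner_zero_left]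

/-- If moreover `(∂_A^*)² F = (∂̄_A^*)² F`, then the one-form `d_A Λ F` has norm zero. Here
`∂_A^* F = -(i / 2) d_A Λ F` and `∂̄_A^* F = (i / 2) d_A Λ F`, so that pairing both sides of the
hypothesis with `Λ F` and moving one adjoint across gives numbers whose imaginary parts are
opposite multiples of the norm of `d_A Λ F`. -/
theorem IsYangMills.l2Inner_covD_lamForm (h : IsYangMills K Q B A)
    (h0 : delStar K Q B A.form (delStar K Q B A.form (curvature Q A.form, 0)) -
      delbarStar K Q B A.form (delbarStar K Q B A.form (curvature Q A.form, 0)) = 0) :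
    l2Inner K Q B (covD Q A.form (lamForm K Q (curvature Q A.form)))
      (covD Q A.form (lamForm K Q (curvature Q A.form))) = 0 := by
  set F := curvature Q A.form with hF
  set φ := lamForm K Q F with hφ
  set ψ := covD Q A.form φ with hψ
  have hφa : IsAdForm Q φ := A.isAdForm_curvature.lamForm K
  have hg : IsAdCForm Q ((φ, 0) : CForm E EG P 0) := ⟨hφa, isAdForm_zero⟩
  have hψa : IsAdForm Q ψ := hφa.covD A
  have hc0 : ∀ A : P → EP [⋀^Fin 1]→L[ℝ] EG,
      covD Q A (0 : P → E [⋀^Fin 0]→L[ℝ] EG) = 0 := fun A => by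
    simpa using covD_smul (Q := Q) (0 : P → E [⋀^Fin 0]→L[ℝ] EG) 0 A
  have hcc0 : ∀ A : P → EP [⋀^Fin 1]→L[ℝ] EG,
      covDcR Q A (0 : P → E [⋀^Fin 0]→L[ℝ] EG) = 0 := fun A => by
    rw [covDcR, pullR_zero_form, hc0]
    rfl
  -- The two first-order adjoints exist by the Kähler identity, the second-order ones because
  -- every one-form has an adjoint.
  obtain ⟨h1a, h1⟩ := h.isRealAdjoint_curvature.delStar (isRealAdjoint_zero K B A)
  obtain ⟨h2a, h2⟩ := h.isRealAdjoint_curvature.delbarStar (isRealAdjoint_zero K B A)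
  obtain ⟨-, h3⟩ := (isRealAdjoint_one K B A h1a.1).delStar (isRealAdjoint_one K B A h1a.2)
  obtain ⟨-, h4⟩ := (isRealAdjoint_one K B A h2a.1).delbarStar (isRealAdjoint_one K B A h2a.2)
  -- Test both second-order adjoints against the section `Λ F`, using only their defining property.
  have h5 := (h3 _ hg).1
  have h6 := (h4 _ hg).1
  rw [Prod.mk.eta] at h5 h6
  rw [sub_eq_zero.1 h0, ← h6, ← (h1 _ (hg.del A)).1, (h1 _ (hg.del A)).2,
    ← (h2 _ (hg.delbar A)).1, (h2 _ (hg.delbar A)).2] at h5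
  have h7 := congrArg Complex.im h5
  simp only [l2InnerC, del_eq, delbar_eq, hc0, hcc0, smul_zero, add_zero, zero_add,
    l2Inner_smul_left, l2Inner_smul_right] at h7
  rw [l2Inner_symm K B _ (0 : P → E [⋀^Fin 1]→L[ℝ] EG), l2Inner_zero_left] at h7
  linarith

/-- A Yang–Mills connection with `(∂_A^*)² F = (∂̄_A^*)² F` is primitive Yang–Mills. -/
theorem IsYangMills.isPrimitiveYangMills (h : IsYangMills K Q B A)
    (h0 : delStar K Q B A.form (delStar K Q B A.form (curvature Q A.form, 0)) -
      delbarStar K Q B A.form (delbarStar K Q B A.form (curvature Q A.form, 0)) = 0) :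
    IsPrimitiveYangMills K Q B A := by
  intro η hη
  obtain ⟨a, b, ha, hb, hab⟩ := A.exists_curvature_shift hη
  have hF := A.isAdForm_curvature
  have hdη := hη.covD A
  have h1 := hasDerivAt_l2Inner_path K B hF hdη ha hb
  have h2 := hasDerivAt_l2Inner_path K B (hF.lamForm K) (hdη.lamForm K) (ha.lamForm K)
    (hb.lamForm K)
  have h3 := h1.sub (h2.const_mul (Module.finrank ℂ E : ℝ)⁻¹)
  have h4 : (fun t : ℝ => primitiveYangMills K Q B (A.form + t • toP Q η)) = _ := funext fun t => by
    rw [primitiveYangMills, hab, l2Inner_primitivePart K B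
      (((hF.add (hdη.smul t)).add (ha.smul _)).add (hb.smul _)), lamForm_add, lamForm_add,
      lamForm_add, lamForm_smul, lamForm_smul, lamForm_smul]
  rw [h4]
  refine h3.congr_deriv ?_
  rw [h.l2Inner_covD_curvature hη, ← A.l2Inner_lamForm_covD K B hη hF A.covD_curvature,
    A.l2Inner_covD_pullR_closed K B hη hF A.covD_curvature,
    ((hF.lamForm K).covD A).l2Inner_eq_zero K B (h.l2Inner_covD_lamForm h0) (hη.pullR _)]
  simp

end Adjoints

/-! ### The types of `∂_A` and `∂̄_A` -/

section Types

open Filter Topology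

variable {E EP EG M P G : Type*}
  [NormedAddCommGroup E] [NormedSpace ℂ E] [FiniteDimensional ℂ E]
  [NormedAddCommGroup EP] [NormedSpace ℝ EP] [FiniteDimensional ℝ EP]
  [NormedAddCommGroup EG] [NormedSpace ℝ EG] [FiniteDimensional ℝ EG]
  [TopologicalSpace M] [ChartedSpace E M] [IsManifold 𝓘(ℂ, E) ω M]
  [TopologicalSpace P] [ChartedSpace EP P] [IsManifold 𝓘(ℝ, EP) ∞ P]
  [TopologicalSpace G] [ChartedSpace EG G] [Group G] [LieGroup 𝓘(ℝ, EG) ∞ G]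
  {Q : PrincipalBundle E EP EG M P G} {k : ℕ}

theorem covDC_eq_del_add_delbar (A : P → EP [⋀^Fin 1]→L[ℝ] EG) (α : CForm E EG P k) :
    covDC Q A α = del Q A α + delbar Q A α := by
  rw [del_eq, delbar_eq, covDC]
  refine Prod.ext ?_ ?_
  · simp only [Prod.fst_add]
    module
  · simp only [Prod.snd_add]
    module

/-- The complex number obtained by evaluating a complex form on tangent vectors and applying a
real functional of the Lie algebra. -/
def evalC (l : EG →L[ℝ] ℝ) (α : CForm E EG P k) (p : P) (v : Fin k → E) : ℂ :=
  ⟨l (α.1 p v), l (α.2 p v)⟩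

theorem evalC_add (l : EG →L[ℝ] ℝ) (α β : CForm E EG P k) (p : P) (v : Fin k → E) :
    evalC l (α + β) p v = evalC l α p v + evalC l β p v := by
  refine Complex.ext ?_ ?_ <;> simp [evalC]

theorem evalC_sub (l : EG →L[ℝ] ℝ) (α β : CForm E EG P k) (p : P) (v : Fin k → E) :
    evalC l (α - β) p v = evalC l α p v - evalC l β p v := by
  refine Complex.ext ?_ ?_ <;> simp [evalC]

theorem evalC_csmul (l : EG →L[ℝ] ℝ) (z : ℂ) (α : CForm E EG P k) (p : P) (v : Fin k → E) :
    evalC l (csmul z α) p v = z * evalC l α p v := by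
  refine Complex.ext ?_ ?_ <;> simp [evalC, csmul]

theorem evalC_pullC (l : EG →L[ℝ] ℝ) (z : ℂ) (α : CForm E EG P k) (p : P) (v : Fin k → E) :
    evalC l (pullC z α) p v = evalC l α p fun i => z • v i := rfl

theorem CForm.ext_evalC {α β : CForm E EG P k}
    (h : ∀ (l : EG →L[ℝ] ℝ) p v, evalC l α p v = evalC l β p v) : α = β := by
  have h1 : ∀ X Y : EG, (∀ l : EG →L[ℝ] ℝ, l X = l Y) → X = Y := fun X Y hXY => by
    by_contra hne
    obtain ⟨l, hl⟩ := SeparatingDual.exists_separating_of_ne (R := ℝ) hne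
    exact hl (hXY l)
  refine Prod.ext ?_ ?_
  · ext p v
    exact h1 _ _ fun l => congrArg Complex.re (h l p v)
  · ext p v
    exact h1 _ _ fun l => congrArg Complex.im (h l p v)

theorem isOfType_iff_evalC {r s : ℕ} {α : CForm E EG P k} : IsOfType r s α ↔
    ∀ (z : ℂ) (l : EG →L[ℝ] ℝ) p v, evalC l α p (fun i => z • v i) =
      z ^ r * (starRingEnd ℂ z) ^ s * evalC l α p v := by
  refine ⟨fun h z l p v => ?_, fun h z => CForm.ext_evalC fun l p v => ?_⟩
  · rw [← evalC_pullC, h z, evalC_csmul]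
  · rw [evalC_pullC, h, evalC_csmul]

theorem covDC_csmul (A : P → EP [⋀^Fin 1]→L[ℝ] EG) (z : ℂ) {α : CForm E EG P k}
    (hα : IsAdCForm Q α) : covDC Q A (csmul z α) = csmul z (covDC Q A α) := by
  have h1 : z.re • α.1 - z.im • α.2 = z.re • α.1 + (-z.im) • α.2 := by module
  refine Prod.ext ?_ ?_
  · change covD Q A (z.re • α.1 - z.im • α.2) = z.re • covD Q A α.1 - z.im • covD Q A α.2
    rw [h1, covD_add (hα.1.smul _) (hα.2.smul _), covD_smul, covD_smul]
    module
  · change covD Q A (z.re • α.2 + z.im • α.1) = z.re • covD Q A α.2 + z.im • covD Q A α.1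
    rw [covD_add (hα.2.smul _) (hα.1.smul _), covD_smul, covD_smul]

/-- At each point, the covariant derivative of a form of type `(r, s)` is the alternation of a real
linear map with values in the forms of type `(r, s)`: in a gauge which is horizontal at the point,
the derivative of the form, whose type is preserved because the coordinates are holomorphic. -/
theorem IsOfType.exists_covDC_eq_sum {r s : ℕ} {α : CForm E EG P k} (h : IsOfType r s α)
    (hα : IsAdCForm Q α) (A : Connection Q) (l : EG →L[ℝ] ℝ) (p : P) :
    ∃ τ : (Fin k → E) → E →L[ℝ] ℂ,
      (∀ (z : ℂ) w u, τ (fun i => z • w i) u = z ^ r * (starRingEnd ℂ z) ^ s * τ w u) ∧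
      ∀ v, evalC l (covDC Q A.form α) p v =
        ∑ i : Fin (k + 1), (-1 : ℂ) ^ (i : ℕ) * τ (i.removeNth v) (v i) := by
  obtain ⟨σ, hσ⟩ := A.exists_horizontal p
  have hd : ∀ {β : P → E [⋀^Fin k]→L[ℝ] EG}, IsAdForm Q β → ∀ w,
      DifferentiableAt ℝ (fun y => σ.loc β y w) (Q.base p) := fun hβ w =>
    differentiableAt_form_apply ((σ.contDiffAt_loc hβ).differentiableAt (by simp)) w
  let f : (Fin k → E) → E → ℂ := fun w y =>
    Complex.ofRealCLM (l (σ.loc α.1 y w)) + Complex.I * Complex.ofRealCLM (l (σ.loc α.2 y w))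
  have hf : ∀ w, HasFDerivAt (f w)
      (Complex.ofRealCLM.comp (l.comp (fderiv ℝ (fun y => σ.loc α.1 y w) (Q.base p))) +
        Complex.I • Complex.ofRealCLM.comp (l.comp (fderiv ℝ (fun y => σ.loc α.2 y w) (Q.base p))))
      (Q.base p) := fun w =>
    (Complex.ofRealCLM.hasFDerivAt.comp _ (l.hasFDerivAt.comp _ (hd hα.1 w).hasFDerivAt)).add
      ((Complex.ofRealCLM.hasFDerivAt.comp _
        (l.hasFDerivAt.comp _ (hd hα.2 w).hasFDerivAt)).const_mul Complex.I)
  refine ⟨fun w => fderiv ℝ (f w) (Q.base p), fun z w u => ?_, fun v => ?_⟩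
  · have h1 : f (fun i => z • w i) =ᶠ[𝓝 (Q.base p)]
        fun y => (z ^ r * (starRingEnd ℂ z) ^ s) * f w y := by
      filter_upwards [(isOpen_extChartAt_target (Q.proj p)).mem_nhds
        (mem_extChartAt_target (I := 𝓘(ℝ, E)) (Q.proj p))] with y hy
      have h2 : ∀ w, f w y = evalC l α (σ.toFun y) fun i => chartSymmDeriv (Q.proj p) y (w i) :=
        fun w => by
          refine Complex.ext ?_ ?_ <;> simp [f, evalC] <;> rfl
      rw [h2, h2, ← isOfType_iff_evalC.1 h z l]
      exact congrArg _ (funext fun i => chartSymmDeriv_mulC hy z (w i))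
    beta_reduce
    rw [h1.fderiv_eq, ((hf w).const_mul _).fderiv, (hf w).fderiv, smul_apply, smul_eq_mul]
  · have h3 : ∀ {β : P → E [⋀^Fin k]→L[ℝ] EG}, IsAdForm Q β → l (covD Q A.form β p v) =
        ∑ i : Fin (k + 1), (-1 : ℝ) ^ (i : ℕ) *
          l (fderiv ℝ (fun y => σ.loc β y (i.removeNth v)) (Q.base p) (v i)) := fun hβ => by
      rw [← hσ.extDeriv_loc hβ,
        extDeriv_apply ((σ.contDiffAt_loc hβ).differentiableAt (by simp)), map_sum]
      refine Finset.sum_congr rfl fun i _ => ?_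
      rcases Nat.even_or_odd (i : ℕ) with hi | hi <;> simp [hi.neg_one_pow]
    have h4 : evalC l (covDC Q A.form α) p v =
        Complex.ofReal (l (covD Q A.form α.1 p v)) +
          Complex.I * Complex.ofReal (l (covD Q A.form α.2 p v)) := by
      refine Complex.ext ?_ ?_ <;> simp [evalC, covDC]
    rw [h4, h3 hα.1, h3 hα.2]
    push_cast
    rw [Finset.mul_sum, ← Finset.sum_add_distrib]
    refine Finset.sum_congr rfl fun i _ => ?_
    rw [(hf _).fderiv]
    simp only [add_apply, smul_apply, ContinuousLinearMap.comp_apply, smul_eq_mul,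
      Complex.ofRealCLM_apply]
    ring

theorem covDc_of_isOfType {r s : ℕ} {α : CForm E EG P k} (h : IsOfType r s α)
    (hα : IsAdCForm Q α) (A : P → EP [⋀^Fin 1]→L[ℝ] EG) :
    covDc Q A α = csmul (Complex.I ^ r * (starRingEnd ℂ Complex.I) ^ s)
      (pullC (-Complex.I) (covDC Q A α)) := by
  rw [covDc, h Complex.I, covDC_csmul A _ hα]
  rfl

theorem I_pow_mul_neg_I_pow (r s : ℕ) :
    (Complex.I ^ r * (starRingEnd ℂ Complex.I) ^ s) *
      ((-Complex.I) ^ r * (starRingEnd ℂ (-Complex.I)) ^ s) = 1 := by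
  rw [map_neg, Complex.conj_I, neg_neg, mul_mul_mul_comm, ← mul_pow, ← mul_pow]
  simp

/-- With `τ` as in `IsOfType.exists_covDC_eq_sum`, the operator `d_A^c` replaces the derivative
`τ(u)` by `τ(-i u)`. -/
theorem IsOfType.evalC_covDc {r s : ℕ} {α : CForm E EG P k} (h : IsOfType r s α)
    (hα : IsAdCForm Q α) (A : P → EP [⋀^Fin 1]→L[ℝ] EG) {l : EG →L[ℝ] ℝ} {p : P}
    {τ : (Fin k → E) → E →L[ℝ] ℂ}
    (h1 : ∀ (z : ℂ) w u, τ (fun i => z • w i) u = z ^ r * (starRingEnd ℂ z) ^ s * τ w u)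
    (h2 : ∀ v, evalC l (covDC Q A α) p v =
      ∑ i : Fin (k + 1), (-1 : ℂ) ^ (i : ℕ) * τ (i.removeNth v) (v i)) (v : Fin (k + 1) → E) :
    evalC l (covDc Q A α) p v =
      ∑ i : Fin (k + 1), (-1 : ℂ) ^ (i : ℕ) * τ (i.removeNth v) (-Complex.I • v i) := by
  rw [covDc_of_isOfType h hα, evalC_csmul, evalC_pullC, h2, Finset.mul_sum]
  refine Finset.sum_congr rfl fun i _ => ?_
  have h3 : i.removeNth (fun i => -Complex.I • v i) = fun j => -Complex.I • i.removeNth v j := rfl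
  rw [h3, h1]
  linear_combination (-1 : ℂ) ^ (i : ℕ) * τ (i.removeNth v) (-Complex.I • v i) *
    I_pow_mul_neg_I_pow r s

theorem apply_complex_smul (τ : E →L[ℝ] ℂ) (z : ℂ) (u : E) :
    τ (z • u) = z.re * τ u + z.im * τ (Complex.I • u) := by
  have h : z • u = z.re • u + z.im • (Complex.I • u) := by
    conv_lhs => rw [← Complex.re_add_im z]
    rw [add_smul, mul_smul, Complex.coe_smul, Complex.coe_smul]
  rw [h, map_add, map_smul, map_smul, Complex.real_smul, Complex.real_smul]

/-- `∂_A` maps forms of type `(r, s)` to forms of type `(r + 1, s)`. -/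
theorem IsOfType.del {r s : ℕ} {α : CForm E EG P k} (h : IsOfType r s α)
    (hα : IsAdCForm Q α) (A : Connection Q) : IsOfType (r + 1) s (del Q A.form α) := by
  refine isOfType_iff_evalC.2 fun z l p v => ?_
  obtain ⟨τ, h1, h2⟩ := h.exists_covDC_eq_sum hα A l p
  have h3 : ∀ v, evalC l (KahlerYM.del Q A.form α) p v = ∑ i : Fin (k + 1), (-1 : ℂ) ^ (i : ℕ) *
      (1 / 2 * (τ (i.removeNth v) (v i) - Complex.I * τ (i.removeNth v) (Complex.I • v i))) :=
    fun v => by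
      rw [KahlerYM.del, evalC_csmul, evalC_add, evalC_csmul, h.evalC_covDc hα A.form h1 h2, h2,
        Finset.mul_sum, ← Finset.sum_add_distrib, Finset.mul_sum]
      refine Finset.sum_congr rfl fun i _ => ?_
      rw [neg_smul, map_neg]
      ring
  rw [h3, h3, Finset.mul_sum]
  refine Finset.sum_congr rfl fun i _ => ?_
  have h4 : i.removeNth (fun i => z • v i) = fun j => z • i.removeNth v j := rfl
  have hz : (z.re : ℂ) + z.im * Complex.I = z := Complex.re_add_im z
  rw [h4, h1, h1, smul_smul, apply_complex_smul _ z, apply_complex_smul _ (Complex.I * z), pow_succ]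
  simp only [Complex.mul_re, Complex.mul_im, Complex.I_re, Complex.I_im, zero_mul, one_mul, zero_sub,
    zero_add, Complex.ofReal_neg]
  set a := τ (i.removeNth v) (v i)
  set b := τ (i.removeNth v) (Complex.I • v i)
  set c := (-1 : ℂ) ^ (i : ℕ) * z ^ r * (starRingEnd ℂ z) ^ s with hc
  linear_combination 1 / 2 * c * (a - Complex.I * b) * hz + 1 / 2 * c * z.im * b * Complex.I_sq

/-- `∂̄_A` maps forms of type `(r, s)` to forms of type `(r, s + 1)`. -/
theorem IsOfType.delbar {r s : ℕ} {α : CForm E EG P k} (h : IsOfType r s α)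
    (hα : IsAdCForm Q α) (A : Connection Q) : IsOfType r (s + 1) (delbar Q A.form α) := by
  refine isOfType_iff_evalC.2 fun z l p v => ?_
  obtain ⟨τ, h1, h2⟩ := h.exists_covDC_eq_sum hα A l p
  have h3 : ∀ v, evalC l (KahlerYM.delbar Q A.form α) p v = ∑ i : Fin (k + 1), (-1 : ℂ) ^ (i : ℕ) *
      (1 / 2 * (τ (i.removeNth v) (v i) + Complex.I * τ (i.removeNth v) (Complex.I • v i))) :=
    fun v => by
      rw [KahlerYM.delbar, evalC_csmul, evalC_sub, evalC_csmul, h.evalC_covDc hα A.form h1 h2, h2,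
        Finset.mul_sum, ← Finset.sum_sub_distrib, Finset.mul_sum]
      refine Finset.sum_congr rfl fun i _ => ?_
      rw [neg_smul, map_neg]
      ring
  rw [h3, h3, Finset.mul_sum]
  refine Finset.sum_congr rfl fun i _ => ?_
  have h4 : i.removeNth (fun i => z • v i) = fun j => z • i.removeNth v j := rfl
  have hz : (z.re : ℂ) - z.im * Complex.I = starRingEnd ℂ z := by
    refine Complex.ext ?_ ?_ <;> simp
  rw [h4, h1, h1, smul_smul, apply_complex_smul _ z, apply_complex_smul _ (Complex.I * z), pow_succ]
  simp only [Complex.mul_re, Complex.mul_im, Complex.I_re, Complex.I_im, zero_mul, one_mul, zero_sub,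
    zero_add, Complex.ofReal_neg]
  set a := τ (i.removeNth v) (v i)
  set b := τ (i.removeNth v) (Complex.I • v i)
  set c := (-1 : ℂ) ^ (i : ℕ) * z ^ r * (starRingEnd ℂ z) ^ s with hc
  linear_combination 1 / 2 * c * (a + Complex.I * b) * hz + 1 / 2 * c * z.im * b * Complex.I_sq

end Types

end KahlerYM

end

theorem mainTheorem6 {E EP EG M P G : Type*}
    [NormedAddCommGroup E] [NormedSpace ℂ E] [FiniteDimensional ℂ E]
    [MeasurableSpace E] [BorelSpace E]
    [NormedAddCommGroup EP] [NormedSpace ℝ EP] [FiniteDimensional ℝ EP]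
    [NormedAddCommGroup EG] [NormedSpace ℝ EG] [FiniteDimensional ℝ EG]
    [TopologicalSpace M] [ChartedSpace E M] [IsManifold 𝓘(ℂ, E) ω M]
    [CompactSpace M] [T2Space M] [MeasurableSpace M] [BorelSpace M]
    [TopologicalSpace P] [ChartedSpace EP P] [IsManifold 𝓘(ℝ, EP) ∞ P]
    [TopologicalSpace G] [ChartedSpace EG G] [Group G] [LieGroup 𝓘(ℝ, EG) ∞ G]
    (K : KahlerYM.KahlerStructure E M) (Q : KahlerYM.PrincipalBundle E EP EG M P G)
    (B : KahlerYM.AdInvariantInner EG G) (A : KahlerYM.Connection Q) :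
    (∀ (k : ℕ) (α : KahlerYM.CForm E EG P k), KahlerYM.IsAdCForm Q α →
      KahlerYM.covDC Q A.form α = KahlerYM.del Q A.form α + KahlerYM.delbar Q A.form α ∧
      ∀ p q : ℕ, KahlerYM.IsOfType p q α →
        KahlerYM.IsOfType (p + 1) q (KahlerYM.del Q A.form α) ∧
        KahlerYM.IsOfType p (q + 1) (KahlerYM.delbar Q A.form α)) ∧
    (KahlerYM.IsYangMills K Q B A →
      KahlerYM.delStar K Q B A.form
          (KahlerYM.delStar K Q B A.form (KahlerYM.curvature Q A.form, 0)) -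
        KahlerYM.delbarStar K Q B A.form
          (KahlerYM.delbarStar K Q B A.form (KahlerYM.curvature Q A.form, 0)) = 0 →
      KahlerYM.IsPrimitiveYangMills K Q B A) := by
  exact ⟨fun _ _ hα => ⟨KahlerYM.covDC_eq_del_add_delbar A.form _,
    fun _ _ h => ⟨h.del hα A, h.delbar hα A⟩⟩, fun h h0 => h.isPrimitiveYangMills h0⟩
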